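/- Let $K$ be a field. For $n\ge 1$ let $Q_n$ be the cyclic quiver with vertices $1,\dots,n$ and arrows $x_i:i\to i+1$ (indices modulo $n$), paths being written from left to right. A \emph{Nakayama algebra of order $n$} is $\Lambda=KQ_n/I$, where $I$ is the two-sided ideal generated by a nonempty set of paths (the \emph{relations}) of length $\ge 1$, none of which is a proper subword of another. Modules are right modules; $e_i$ is the idempotent of the vertex $i$, $P_i=e_i\Lambda$, $S_i=P_i/\operatorname{rad}P_i$, and $|P_i|$ is the composition length of $P_i$. The \emph{resolution quiver} $R(\Lambda)$ has vertices $1,\dots,n$ and one arrow $i\to j$ whenever $\operatorname{soc}P_i\cong S_{j-1}$ (indices modulo $n$). A \emph{leaf} is a vertex that is not the target of an arrow. The \emph{weight} of an oriented cycle of $R(\Lambda)$ is $\frac1n\sum|P_i|$, summed over the vertices $i$ of the cycle. We say that $R(\Lambda)$ has weight $w$ if every component contains an oriented cycle and every oriented cycle has weight $w$. A vertex $i$ is \emph{covered} by a relation if $x_{i-1}x_i$ is a subword of it. The \emph{relation complex} $L(\Lambda)$ is the simplicial complex whose vertices are the relations of length $\le n$; a nonempty set of them spans a simplex if and only if together they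 do not cover all $n$ vertices of $Q_n$. \textbf{Proposition.} Let $\Lambda$ be a Nakayama algebra of order $n$ such that the vertex $n$ is a leaf of $R(\Lambda)$ (so $n\ge2$), and let $\Lambda'=\operatorname{End}_\Lambda(P_1\oplus\cdots\oplus P_{n-1})$. Then $\Lambda'$ is a Nakayama algebra of order $n-1$: there is a $K$-algebra isomorphism from $\Lambda'$ to a Nakayama algebra of order $n-1$ that takes the projection onto the summand $P_i$ to $e_i$ for $1\le i\le n-1$. For every such presentation of $\Lambda'$ (which defines $R(\Lambda')$ and $L(\Lambda')$) the following hold. \begin{enumerate} \item $R(\Lambda')$ is $R(\Lambda)$ with the leaf $n$ removed: for $1\le i,j\le n-1$ there is an arrow $i\to j$ in $R(\Lambda')$ if and only if there is one in $R(\Lambda)$. In particular $R(\Lambda')$ has the same number of components as $R(\Lambda)$, and one fewer vertex not lying in an oriented cycle. \item $R(\Lambda')$ has the same weight as $R(\Lambda)$: there is a $w\in\mathbb Q$ such that both have weight $w$. \item The geometric realizations of $L(\Lambda')$ and $L(\Lambda)$ are homotopy equivalent, and $L(\Lambda')$ and $L(\Lambda)$ have the same Euler characteristic. \end{enumerate}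 Moreover \begin{enumerate} \item[(4)] $\operatorname{gl.dim}\Lambda'\le\operatorname{gl.dim}\Lambda\le\operatorname{gl.dim}\Lambda'+2$ (values in $\mathbb N\cup\{\infty\}$); thus $\operatorname{gl.dim}\Lambda<\infty$ if and only if $\operatorname{gl.dim}\Lambda'<\infty$. \end{enumerate} -/

import Mathlib

open CategoryTheory

universe u

namespace Nakayama

/-! ### The cyclic quiver and its path algebra

The vertices of the cyclic quiver `Q_n` are the elements of `Fin n`; the vertex written `i` in
one-based notation is the element with value `i - 1`.  There is one arrow `x_i : i ⟶ next i`
for every vertex `i`. -/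

/-- The cyclic successor of a vertex. -/
def next {n : ℕ} (i : Fin n) : Fin n :=
  ⟨(i.val + 1) % n, Nat.mod_lt _ i.pos⟩

/-- A path of `Q_n`.  Since every vertex is the source of exactly one arrow, the paths, written
from left to right, are the words `x_i x_{i+1} ⋯ x_{i+ℓ-1}`, given by their starting vertex `i`
and their length `ℓ ≥ 0` (with `ℓ = 0` for the trivial path `e_i`). -/
@[ext]
structure CPath (n : ℕ) where
  /-- the starting vertex -/
  start : Fin n
  /-- the number of arrows -/
  len : ℕ

namespace CPath

variable {n : ℕ}

/-- The end vertex of a path. -/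
def target (p : CPath n) : Fin n := next^[p.len] p.start

/-- The concatenation `p q`, meaningful when `q` starts where `p` ends. -/
def append (p q : CPath n) : CPath n := ⟨p.start, p.len + q.len⟩

/-- `p` is a subword of `q`: we have `q = u p v` for a path `u` of length `a` and a path `v`
of length `b`. -/
def IsSubword (p q : CPath n) : Prop :=
  ∃ a b : ℕ, next^[a] q.start = p.start ∧ q.len = a + p.len + b

/-- The path `p` covers the vertex `i`, i.e. `i` is an internal vertex of `p`: the word
`x_{i-1} x_i` is a subword of `p`. -/
def Covers (p : CPath n) (i : Fin n) : Prop :=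
  ∃ j : Fin n, next j = i ∧ IsSubword ⟨j, 2⟩ p

theorem target_append (p q : CPath n) (h : p.target = q.start) :
    (p.append q).target = q.target := by
  simp only [target, append] at *
  rw [Nat.add_comm, Function.iterate_add_apply, h]

end CPath

/-- The path algebra `K Q_n`: the vector space with basis the paths of `Q_n`. -/
def PathAlgebra (K : Type u) [Field K] (n : ℕ) : Type u := CPath n →₀ K

namespace PathAlgebra

variable (K : Type u) [Field K] {n : ℕ}

noncomputable instance : AddCommGroup (PathAlgebra K n) :=
  inferInstanceAs (AddCommGroup (CPath n →₀ K))

noncomputable instance : Module K (PathAlgebra K n) :=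
  inferInstanceAs (Module K (CPath n →₀ K))

/-- A path, as an element of the path algebra. -/
noncomputable def ofPath (p : CPath n) : PathAlgebra K n := Finsupp.single p (1 : K)

/-- The product of two paths: their concatenation if it is defined, and zero otherwise. -/
noncomputable def mulPath (p q : CPath n) : PathAlgebra K n :=
  if p.target = q.start then ofPath K (p.append q) else 0

/-- The bilinear extension of the product of paths. -/
noncomputable def mulBilin : PathAlgebra K n →ₗ[K] PathAlgebra K n →ₗ[K] PathAlgebra K n :=
  Finsupp.linearCombination K
    (fun p : CPath n => (Finsupp.linearCombination K (fun q : CPath n => mulPath K p q) :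
      (CPath n →₀ K) →ₗ[K] PathAlgebra K n))

noncomputable instance : Mul (PathAlgebra K n) := ⟨fun a b => mulBilin K a b⟩

noncomputable instance : One (PathAlgebra K n) := ⟨∑ i : Fin n, ofPath K ⟨i, 0⟩⟩

variable {K}

theorem mul_def (a b : PathAlgebra K n) : a * b = mulBilin K a b := rfl

theorem one_def : (1 : PathAlgebra K n) = ∑ i : Fin n, ofPath K ⟨i, 0⟩ := rfl

@[simp]
theorem ofPath_mul_ofPath (p q : CPath n) : ofPath K p * ofPath K q = mulPath K p q := by
  rw [mul_def]
  have h1 : mulBilin K (ofPath K p) = (Finsupp.linearCombination K (fun q : CPath n =>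
      mulPath K p q) : (CPath n →₀ K) →ₗ[K] PathAlgebra K n) :=
    (Finsupp.linearCombination_single K (1 : K) p).trans (one_smul K _)
  rw [h1]
  exact (Finsupp.linearCombination_single K (1 : K) q).trans (one_smul K _)

theorem induction_on {motive : PathAlgebra K n → Prop} (a : PathAlgebra K n)
    (zero : motive 0) (add : ∀ a b, motive a → motive b → motive (a + b))
    (smul : ∀ (c : K) (p : CPath n), motive (c • ofPath K p)) : motive a := by
  refine Finsupp.induction_linear (motive := motive) a zero add (fun p c => ?_)
  have h := smul c p
  have e : c • ofPath K p = Finsupp.single p c := by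
    change c • (Finsupp.single p (1 : K)) = _
    rw [Finsupp.smul_single, smul_eq_mul, mul_one]
  rw [e] at h
  exact h

theorem mul_assoc_path (p q r : CPath n) :
    ofPath K p * ofPath K q * ofPath K r = ofPath K p * (ofPath K q * ofPath K r) := by
  rw [ofPath_mul_ofPath, ofPath_mul_ofPath]
  unfold mulPath
  have hz (a : PathAlgebra K n) : a * 0 = 0 := map_zero (mulBilin K a)
  have zh (a : PathAlgebra K n) : 0 * a = 0 := by
    rw [mul_def, map_zero, LinearMap.zero_apply]
  by_cases h1 : p.target = q.start <;> by_cases h2 : q.target = r.start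
  · rw [if_pos h1, if_pos h2, ofPath_mul_ofPath, ofPath_mul_ofPath, mulPath, mulPath, if_pos,
      if_pos]
    · simp [CPath.append, Nat.add_assoc]
    · exact h1
    · rw [CPath.target_append _ _ h1, h2]
  · rw [if_pos h1, if_neg h2, ofPath_mul_ofPath, hz, mulPath, if_neg]
    rw [CPath.target_append _ _ h1]
    exact h2
  · rw [if_neg h1, if_pos h2, ofPath_mul_ofPath, zh, mulPath, if_neg]
    exact h1
  · rw [if_neg h1, if_neg h2, zh, hz]

noncomputable instance : Ring (PathAlgebra K n) :=
  { (inferInstance : AddCommGroup (PathAlgebra K n)) with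
    mul := (· * ·)
    one := 1
    zero_mul := fun a => by rw [mul_def, map_zero, LinearMap.zero_apply]
    mul_zero := fun a => map_zero (mulBilin K a)
    left_distrib := fun a b c => map_add (mulBilin K a) b c
    right_distrib := fun a b c => by
      simp only [mul_def, map_add, LinearMap.add_apply]
    mul_assoc := fun a b c => by
      induction a using induction_on with
      | zero => simp [mul_def]
      | add a a' h h' => simp only [mul_def, map_add, LinearMap.add_apply] at *; rw [h, h']
      | smul s p =>
        induction b using induction_on with
        | zero => simp [mul_def]
        | add a a' h h' => simp only [mul_def, map_add, LinearMap.add_apply] at *; rw [h, h']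
        | smul t q =>
          induction c using induction_on with
          | zero => simp [mul_def]
          | add a a' h h' => simp only [mul_def, map_add] at *; rw [h, h']
          | smul w r =>
            have := mul_assoc_path (K := K) p q r
            simp only [mul_def, map_smul, LinearMap.smul_apply] at *
            rw [this]
    one_mul := fun a => by
      induction a using induction_on with
      | zero => simp [mul_def]
      | add a a' h h' => simp only [mul_def, map_add] at *; rw [h, h']
      | smul s p =>
        have : mulBilin K (1 : PathAlgebra K n) (ofPath K p) = ofPath K p := by
          rw [one_def, map_sum, LinearMap.sum_apply, Finset.sum_eq_single p.start]
          · rw [← mul_def, ofPath_mul_ofPath, mulPath, if_pos]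
            · simp [CPath.append]
            · rfl
          · intro i _ hi
            rw [← mul_def, ofPath_mul_ofPath, mulPath, if_neg]
            exact hi
          · simp
        simp only [mul_def, map_smul, this]
    mul_one := fun a => by
      induction a using induction_on with
      | zero => simp [mul_def]
      | add a a' h h' => simp only [mul_def, map_add, LinearMap.add_apply] at *; rw [h, h']
      | smul s p =>
        have : mulBilin K (ofPath K p) (1 : PathAlgebra K n) = ofPath K p := by
          rw [one_def, map_sum, Finset.sum_eq_single p.target]
          · rw [← mul_def, ofPath_mul_ofPath, mulPath, if_pos]
            · simp [CPath.append]
            · rfl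
          · intro i _ hi
            rw [← mul_def, ofPath_mul_ofPath, mulPath, if_neg]
            exact fun h => hi h.symm
          · simp
        simp only [mul_def, map_smul, LinearMap.smul_apply, this] }

noncomputable instance : Algebra K (PathAlgebra K n) :=
  Algebra.ofModule
    (fun c a b => by simp only [mul_def, map_smul, LinearMap.smul_apply])
    (fun c a b => by simp only [mul_def, map_smul])

end PathAlgebra

/-! ### Nakayama algebras -/

/-- A nonempty irredundant set of monomial relations of positive length on `Q_n`.  (The starting
vertices of irredundant relations are pairwise distinct, so such a set is automatically finite.) -/
structure Relations (n : ℕ) where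
  /-- the relations -/
  rels : Set (CPath n)
  nonempty : rels.Nonempty
  len_pos : ∀ y ∈ rels, 1 ≤ y.len
  irredundant : ∀ y ∈ rels, ∀ z ∈ rels, y.IsSubword z → y = z

section Algebra

variable (K : Type u) [Field K] {n : ℕ} (Y : Relations n)

/-- The two-sided ideal of `K Q_n` generated by the relations. -/
noncomputable def relIdeal : TwoSidedIdeal (PathAlgebra K n) :=
  TwoSidedIdeal.span (PathAlgebra.ofPath K '' Y.rels)

/-- The Nakayama algebra `Λ = K Q_n / I` of order `n`. -/
abbrev Alg : Type u := (relIdeal K Y).ringCon.Quotient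

/-- The class in `Λ` of a path. -/
noncomputable def pathClass (p : CPath n) : Alg K Y :=
  (relIdeal K Y).ringCon.mk' (PathAlgebra.ofPath K p)

/-- The idempotent `e_i` of `Λ`. -/
noncomputable def idem (i : Fin n) : Alg K Y := pathClass K Y ⟨i, 0⟩

/-- The projective right module `P_i = e_i Λ`.  Right modules over `Λ` are modules over the
opposite ring. -/
noncomputable def proj (i : Fin n) : Submodule (Alg K Y)ᵐᵒᵖ (Alg K Y) :=
  Submodule.span (Alg K Y)ᵐᵒᵖ {idem K Y i}

/-- The simple right module `S_i` at the vertex `i`, as the top `P_i / rad P_i` of `P_i`. -/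
abbrev SimpleAt (i : Fin n) : Type u :=
  (proj K Y i) ⧸ Module.jacobson (Alg K Y)ᵐᵒᵖ (proj K Y i)

/-- The composition length `|P_i|`. -/
noncomputable def projLength (i : Fin n) : ℕ :=
  (Module.length (Alg K Y)ᵐᵒᵖ (proj K Y i)).toNat

end Algebra

/-- The socle of a module: the sum of its simple submodules. -/
def socle (R M : Type*) [Ring R] [AddCommGroup M] [Module R M] : Submodule R M :=
  sSup {N : Submodule R M | IsSimpleModule R N}

/-! ### The resolution quiver -/

section Digraphs

variable {V : Type*} (G : Digraph V)

/-- A leaf is a vertex which is not the target of any arrow. -/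
def IsLeaf (j : V) : Prop := ∀ i, ¬ G.Adj i j

/-- The connected components of (the undirected graph underlying) a digraph. -/
abbrev Component : Type _ := G.toSimpleGraphInclusive.ConnectedComponent

/-- An oriented cycle: a nonempty list of distinct vertices `j_1 → j_2 → ⋯ → j_m → j_1`
(a single vertex with a loop is a cycle). -/
def IsOrientedCycle (c : List V) : Prop :=
  c ≠ [] ∧ c.Nodup ∧ (c : Cycle V).Chain G.Adj

/-- The vertex `i` lies in some oriented cycle. -/
def OnCycle (i : V) : Prop := ∃ c : List V, IsOrientedCycle G c ∧ i ∈ c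

end Digraphs

section Resolution

variable (K : Type u) [Field K] {n : ℕ} (Y : Relations n)

/-- The resolution quiver `R(Λ)`: there is an arrow `i → j` if and only if the socle of `P_i`
is `S_{j-1}`.  It has at most one arrow from one vertex to another, and may have loops. -/
def resolutionQuiver : Digraph (Fin n) where
  Adj i j := ∃ k : Fin n, next k = j ∧
    Nonempty (socle (Alg K Y)ᵐᵒᵖ (proj K Y i) ≃ₗ[(Alg K Y)ᵐᵒᵖ] SimpleAt K Y k)

/-- The weight of an oriented cycle of `R(Λ)`. -/
noncomputable def cycleWeight (c : List (Fin n)) : ℚ :=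
  ((c.map (projLength K Y)).sum : ℚ) / n

/-- Every component of `R(Λ)` has weight `w`: every component contains an oriented cycle, and
all oriented cycles have weight `w`. -/
def HasWeight (w : ℚ) : Prop :=
  (∀ C : Component (resolutionQuiver K Y), ∃ c : List (Fin n),
    IsOrientedCycle (resolutionQuiver K Y) c ∧
      ∀ i ∈ c, (resolutionQuiver K Y).toSimpleGraphInclusive.connectedComponentMk i = C) ∧
  ∀ c : List (Fin n), IsOrientedCycle (resolutionQuiver K Y) c → cycleWeight K Y c = w

end Resolution

/-! ### The relation complex -/

section Complex

variable {n : ℕ} (Y : Relations n)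

theorem val_next_iterate (a : ℕ) (i : Fin n) : (next^[a] i).val = (i.val + a) % n := by
  induction a with
  | zero => simp [Nat.mod_eq_of_lt i.isLt]
  | succ a ih =>
    rw [Function.iterate_succ_apply']
    simp only [next, ih]
    simp [Nat.add_assoc]

/-- A path of length at most `n` does not cover its starting vertex. -/
theorem not_covers_start (p : CPath n) (h : p.len ≤ n) : ¬ p.Covers p.start := by
  rintro ⟨j, hj, a, b, ha, hb⟩
  have h1 : next^[a + 1] p.start = p.start := by
    rw [Function.iterate_succ_apply', ha]; exact hj
  have h2 := val_next_iterate (a + 1) p.start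
  rw [h1] at h2
  have h3 := p.start.isLt
  have hab : a + 1 < n := by simp only at hb; omega
  by_cases hc : p.start.val + (a + 1) < n
  · rw [Nat.mod_eq_of_lt hc] at h2; omega
  · rw [Nat.mod_eq_sub_mod (by omega), Nat.mod_eq_of_lt (by omega)] at h2; omega

/-- The vertices of the relation complex: the relations of length at most `n`. -/
abbrev ComplexVertex : Type := {y : CPath n // y ∈ Y.rels ∧ y.len ≤ n}

/-- The relation complex `L(Λ)`: a nonempty set of relations of length at most `n` spans a
simplex if and only if these relations do not cover all vertices of `Q_n`. -/
def relationComplex : AbstractSimplicialComplex (ComplexVertex Y) where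
  faces := {s | s.Nonempty ∧ ∃ i : Fin n, ∀ y ∈ s, ¬ y.val.Covers i}
  isRelLowerSet_faces := by
    rintro s ⟨hs, i, hi⟩
    exact ⟨hs, fun t hts ht => ⟨ht, i, fun y hy => hi y (hts hy)⟩⟩
  singleton_mem := by
    intro y
    refine ⟨Finset.singleton_nonempty y, y.val.start, fun z hz => ?_⟩
    rw [Finset.mem_singleton] at hz
    subst hz
    exact not_covers_start _ z.2.2

/-- The relations have distinct starting vertices. -/
theorem start_injOn : Set.InjOn CPath.start Y.rels := by
  intro y hy z hz h
  rcases le_total y.len z.len with hl | hl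
  · exact Y.irredundant y hy z hz ⟨0, z.len - y.len, h.symm, by omega⟩
  · exact (Y.irredundant z hz y hy ⟨0, y.len - z.len, h, by omega⟩).symm

instance : Finite (ComplexVertex Y) :=
  Finite.of_injective (fun y : ComplexVertex Y => y.val.start)
    (fun y z h => Subtype.ext (start_injOn Y y.2.1 z.2.1 h))

noncomputable instance : Fintype (ComplexVertex Y) := Fintype.ofFinite _

end Complex

/-- The geometric realization of a simplicial complex with finitely many vertices: the points of
the standard simplex (given by barycentric coordinates) whose support is a face. -/
def Realization {ι : Type*} [Fintype ι] (L : AbstractSimplicialComplex ι) : Type _ :=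
  {t : ι → ℝ // t ∈ stdSimplex ℝ ι ∧ ∃ s ∈ L.faces, ∀ v, v ∈ s ↔ t v ≠ 0}

instance {ι : Type*} [Fintype ι] (L : AbstractSimplicialComplex ι) :
    TopologicalSpace (Realization L) :=
  inferInstanceAs (TopologicalSpace
    {t : ι → ℝ // t ∈ stdSimplex ℝ ι ∧ ∃ s ∈ L.faces, ∀ v, v ∈ s ↔ t v ≠ 0})

open Classical in
/-- The Euler characteristic `∑ (-1) ^ dim σ` of a simplicial complex with finitely many
vertices. -/
noncomputable def eulerChar {ι : Type*} [Fintype ι] (L : AbstractSimplicialComplex ι) : ℤ :=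
  ∑ s : Finset ι with s ∈ L.faces, (-1) ^ (s.card - 1)

/-! ### Global dimension and the endomorphism algebra -/

/-- The global dimension of a ring, computed with right modules: the supremum of the projective
dimensions of all right modules. -/
noncomputable def globalDim (A : Type u) [Ring A] : WithBot ℕ∞ :=
  ⨆ M : ModuleCat.{u} Aᵐᵒᵖ, projectiveDimension M

section Endomorphisms

variable (K : Type u) [Field K] {n : ℕ} (Y : Relations (n + 1))

/-- The right `Λ`-module `P' = P_1 ⊕ ⋯ ⊕ P_n` for `Λ` of order `n + 1`: the direct sum of all
indecomposable projectives except the one at the last vertex. -/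
abbrev PPrime : Type u := (i : Fin n) → proj K Y i.castSucc

/-- The algebra `Λ' = End_Λ(P')`, whose product is composition. -/
abbrev EndAlg : Type u := Module.End (Alg K Y)ᵐᵒᵖ (PPrime K Y)

/-- The idempotent of `Λ'` given by the projection of `P'` to its summand `P_i`. -/
noncomputable def endIdem (i : Fin n) : EndAlg K Y :=
  LinearMap.single (Alg K Y)ᵐᵒᵖ (fun i : Fin n => proj K Y i.castSucc) i ∘ₗ
    LinearMap.proj i

/-- A presentation of `Λ'` as a Nakayama algebra of order `n`: an isomorphism of `K`-algebras
`Λ' ≅ K Q_n / I'` under which the projection of `P'` to `P_i` corresponds to `e_i`. -/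
def IsPresentation (Y' : Relations n) (φ : EndAlg K Y ≃ₐ[K] Alg K Y') : Prop :=
  ∀ i : Fin n, φ (endIdem K Y i) = idem K Y' i

end Endomorphisms

end Nakayama

/-!
Everything is controlled by the Kupisch series `c i = |P_i|`, which determines the relations. The
resolution quiver is the functional graph of the Gustafson function `i ↦ i + c i`, and this
function lifts to a monotone map `f : ℕ → ℕ` with `f (a + n) = f a + n`. If the vertex `n` is a
leaf, then `f` avoids the class of `n` and so restricts to the natural numbers outside that class;
numbering these consecutively gives the corresponding map of a Nakayama algebra of order one less.
Sending a path to left multiplication by the path of the larger quiver running through the same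
remaining vertices identifies this algebra with `Λ'`.

The weight of a cycle is the quotient of the displacement of `f` along it by `n`, divided by its
period: a translation number, which is the same for all cycles since `f` is monotone, and is
unaffected by the deletion.

The relations are the jumps of `f`. Those of `Λ'` correspond to relations of `Λ` covering the same
remaining vertices, and `Λ` has at most one further relation, which starts at `n`; it covers all
remaining vertices that a certain other relation `r` covers. So `L(Λ)` arises from `L(Λ')` by adding
at most one vertex, and a simplex containing this vertex remains a simplex when `r` is added to it.

Since no relation ends at `n`, the projectives `P_i` for `i < n` and the radicals of all projectives
belong to the class of modules on which the arrow ending at `n` acts bijectively. These are the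
modules presented by sums of copies of `P' = P_1 ⊕ ⋯ ⊕ P_{n-1}`, and on them `Hom(P', -)` is an
equivalence onto the modules over `Λ'` preserving projective dimensions. A module annihilated by
`Hom(P', -)` is a sum of copies of `S_n`, whose syzygy is a sum of copies of `rad P_n`; this costs
at most two extra dimensions.
-/

namespace Nakayama

section CyclicQuiver

variable {n : ℕ}

theorem next_iterate_add (a b : ℕ) (i : Fin n) : next^[a + b] i = next^[b] (next^[a] i) := by
  rw [add_comm, Function.iterate_add_apply]

theorem exists_next_iterate_eq (i j : Fin n) : ∃ a, next^[a] i = j := by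
  refine ⟨j.val + (n - i.val), Fin.ext ?_⟩
  rw [val_next_iterate, show i.val + (j.val + (n - i.val)) = j.val + n by omega,
    Nat.add_mod_right, Nat.mod_eq_of_lt j.isLt]

theorem next_iterate_eq_iff (a b : ℕ) (i j : Fin n) :
    next^[a] i = next^[b] j ↔ (i.val + a) % n = (j.val + b) % n := by
  rw [Fin.ext_iff, val_next_iterate, val_next_iterate]

theorem next_iterate_injective (a : ℕ) : Function.Injective (next^[a] : Fin n → Fin n) := by
  intro i j h
  have hij : i.val ≡ j.val [MOD n] :=
    Nat.ModEq.add_right_cancel' a ((next_iterate_eq_iff a a i j).1 h)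
  exact Fin.ext (hij.eq_of_lt_of_lt i.isLt j.isLt)

theorem next_injective : Function.Injective (next : Fin n → Fin n) :=
  next_iterate_injective 1

theorem le_iterate_add_of_le_next {c : Fin n → ℕ} (hc : ∀ i, c i ≤ c (next i) + 1) (i : Fin n)
    (a : ℕ) : c i ≤ c (next^[a] i) + a := by
  induction a with
  | zero => simp
  | succ a ih =>
    rw [Function.iterate_succ_apply']
    have := hc (next^[a] i)
    omega

namespace CPath

theorem IsSubword.refl (p : CPath n) : p.IsSubword p := ⟨0, 0, rfl, by omega⟩

theorem IsSubword.trans {p q r : CPath n} (hpq : p.IsSubword q) (hqr : q.IsSubword r) :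
    p.IsSubword r := by
  obtain ⟨a, b, hstart, hlen⟩ := hpq
  obtain ⟨a', b', hstart', hlen'⟩ := hqr
  exact ⟨a' + a, b + b', by rw [next_iterate_add, hstart', hstart], by omega⟩

theorem isSubword_append_right (p q : CPath n) : p.IsSubword (p.append q) :=
  ⟨0, q.len, rfl, by simp only [append]; omega⟩

theorem isSubword_append_left {p q : CPath n} (h : p.target = q.start) :
    q.IsSubword (p.append q) :=
  ⟨p.len, 0, h, rfl⟩

theorem isSubword_of_le (i : Fin n) {l m : ℕ} (h : l ≤ m) :
    IsSubword ⟨i, l⟩ ⟨i, m⟩ :=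
  ⟨0, m - l, rfl, by simp only; omega⟩

theorem covers_iff (p : CPath n) (i : Fin n) :
    p.Covers i ↔ ∃ t, 1 ≤ t ∧ t < p.len ∧ next^[t] p.start = i := by
  constructor
  · rintro ⟨j, rfl, a, b, ha, hb⟩
    refine ⟨a + 1, by omega, ?_, ?_⟩
    · simp only at hb
      omega
    · rw [Function.iterate_succ_apply', ha]
  · rintro ⟨t, h1, h2, rfl⟩
    obtain ⟨s, rfl⟩ : ∃ s, t = s + 1 := ⟨t - 1, by omega⟩
    refine ⟨next^[s] p.start, (Function.iterate_succ_apply' _ _ _).symm, s, p.len - (s + 2), rfl,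
      ?_⟩
    simp only
    omega

/-- The paths which are the relations of a Nakayama algebra with Kupisch series `c`: the shortest
zero path starting at `i`, provided that it contains no shorter one starting at `next i`. -/
def IsRelationFor (c : Fin n → ℕ) (p : CPath n) : Prop :=
  p.len = c p.start ∧ c p.start ≤ c (next p.start)

theorem IsRelationFor.eq_of_isSubword {c : Fin n → ℕ} (hc : ∀ i, c i ≤ c (next i) + 1)
    {p q : CPath n} (hp : p.IsRelationFor c) (hqp : q.IsSubword p) (hq : c q.start ≤ q.len) :
    q = p := by
  obtain ⟨hlen, hle⟩ := hp
  obtain ⟨a, b, hstart, hlen'⟩ := hqp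
  rcases a with _ | a
  · have hstart : p.start = q.start := hstart
    rw [← hstart] at hq
    exact CPath.ext hstart.symm (by omega)
  · have hbound := le_iterate_add_of_le_next hc (next p.start) a
    rw [← Function.iterate_succ_apply, hstart] at hbound
    omega

theorem exists_isRelationFor_isSubword {c : Fin n → ℕ} (hpos : ∀ i, 1 ≤ c i) (l : ℕ) (i : Fin n)
    (h : c i ≤ l) : ∃ p : CPath n, p.IsRelationFor c ∧ p.IsSubword ⟨i, l⟩ := by
  induction l generalizing i with
  | zero => exact absurd (hpos i) (by omega)
  | succ l ih =>
    by_cases hnext : c i ≤ c (next i)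
    · exact ⟨⟨i, c i⟩, ⟨rfl, hnext⟩, isSubword_of_le i h⟩
    · obtain ⟨p, hp, hsub⟩ := ih (next i) (by omega)
      exact ⟨p, hp, hsub.trans ⟨1, 0, rfl, by simp only; omega⟩⟩

end CPath

end CyclicQuiver

namespace Relations

variable {n : ℕ} (Y : Relations n)

/-- The path `p` has a relation as a subword, that is, its class in the Nakayama algebra is zero. -/
def Kills (p : CPath n) : Prop := ∃ y ∈ Y.rels, y.IsSubword p

/-- The Kupisch series: the length of the shortest zero path starting at `i`, which is the
composition length of `P_i`. -/
noncomputable def kupisch (i : Fin n) : ℕ := sInf {l | Y.Kills ⟨i, l⟩}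

variable {Y} in
theorem Kills.of_isSubword {p q : CPath n} (h : Y.Kills p) (hpq : p.IsSubword q) : Y.Kills q := by
  obtain ⟨y, hy, hyp⟩ := h
  exact ⟨y, hy, hyp.trans hpq⟩

variable {Y} in
theorem Kills.of_mem {p : CPath n} (h : p ∈ Y.rels) : Y.Kills p := ⟨p, h, .refl p⟩

theorem exists_kills (i : Fin n) : ∃ l, Y.Kills ⟨i, l⟩ := by
  obtain ⟨y, hy⟩ := Y.nonempty
  obtain ⟨a, ha⟩ := exists_next_iterate_eq i y.start
  exact ⟨a + y.len, y, hy, a, 0, ha, rfl⟩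

theorem kills_iff (p : CPath n) : Y.Kills p ↔ Y.kupisch p.start ≤ p.len := by
  refine ⟨fun h => Nat.sInf_le h, fun h => ?_⟩
  have hmin : Y.Kills ⟨p.start, Y.kupisch p.start⟩ := Nat.sInf_mem (Y.exists_kills p.start)
  exact hmin.of_isSubword (CPath.isSubword_of_le p.start h)

theorem kills_mk_iff (i : Fin n) (l : ℕ) : Y.Kills ⟨i, l⟩ ↔ Y.kupisch i ≤ l := Y.kills_iff _

theorem kupisch_pos (i : Fin n) : 1 ≤ Y.kupisch i := by
  obtain ⟨y, hy, a, b, -, hlen⟩ := (Y.kills_mk_iff i _).2 le_rfl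
  have := Y.len_pos y hy
  simp only at hlen
  omega

theorem kupisch_le_next (i : Fin n) : Y.kupisch i ≤ Y.kupisch (next i) + 1 := by
  rw [← kills_mk_iff]
  exact ((Y.kills_mk_iff (next i) _).2 le_rfl).of_isSubword ⟨1, 0, rfl, by simp only; omega⟩

theorem eq_of_kills_of_isSubword {p q : CPath n} (hp : p ∈ Y.rels) (hq : Y.Kills q)
    (hqp : q.IsSubword p) : q = p := by
  obtain ⟨y, hy, hyq⟩ := hq
  obtain rfl := Y.irredundant y hy p hp (hyq.trans hqp)
  obtain ⟨a, b, hstart, hlen⟩ := hqp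
  obtain ⟨a', b', -, hlen'⟩ := hyq
  obtain rfl : a = 0 := by omega
  exact CPath.ext hstart.symm (by omega)

theorem mem_rels_iff (p : CPath n) : p ∈ Y.rels ↔ p.IsRelationFor Y.kupisch := by
  constructor
  · intro hp
    have hle := (Y.kills_iff p).1 (.of_mem hp)
    constructor
    · have hmin := Y.eq_of_kills_of_isSubword hp ((Y.kills_mk_iff p.start _).2 le_rfl)
        (CPath.isSubword_of_le p.start hle)
      exact (congrArg CPath.len hmin).symm
    · by_contra! hlt
      have hmin := Y.eq_of_kills_of_isSubword hp ((Y.kills_mk_iff (next p.start) _).2 le_rfl)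
        ⟨1, p.len - (Y.kupisch (next p.start) + 1), rfl, by simp only; omega⟩
      have hlen : Y.kupisch (next p.start) = p.len := congrArg CPath.len hmin
      omega
  · intro hp
    obtain ⟨y, hy, hyp⟩ := (Y.kills_iff p).2 hp.1.ge
    rwa [← hp.eq_of_isSubword Y.kupisch_le_next hyp ((Y.kills_iff y).1 (.of_mem hy))]

/-- The relations with a prescribed Kupisch series. -/
def ofKupisch [NeZero n] (c : Fin n → ℕ) (hpos : ∀ i, 1 ≤ c i)
    (hnext : ∀ i, c i ≤ c (next i) + 1) : Relations n where
  rels := {p | p.IsRelationFor c}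
  nonempty := by
    obtain ⟨p, hp, -⟩ := CPath.exists_isRelationFor_isSubword hpos (c 0) 0 le_rfl
    exact ⟨p, hp⟩
  len_pos := fun _ hy => hy.1 ▸ hpos _
  irredundant := fun _ hy _ hz hyz => hz.eq_of_isSubword hnext hyz hy.1.ge

theorem kupisch_ofKupisch [NeZero n] {c : Fin n → ℕ} (hpos : ∀ i, 1 ≤ c i)
    (hnext : ∀ i, c i ≤ c (next i) + 1) : (ofKupisch c hpos hnext).kupisch = c := by
  funext i
  apply le_antisymm
  · rw [← kills_mk_iff]
    exact CPath.exists_isRelationFor_isSubword hpos (c i) i le_rfl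
  · obtain ⟨y, hy, a, b, hstart, hlen⟩ := ((ofKupisch c hpos hnext).kills_mk_iff i _).2 le_rfl
    have hbound := le_iterate_add_of_le_next hnext i a
    simp only at hstart hlen
    rw [hstart, ← hy.1] at hbound
    omega

end Relations

namespace PathAlgebra

variable (K : Type u) [Field K] {n : ℕ}

/-- The defining basis of `K Q_n`, consisting of the paths. -/
noncomputable def basis : Module.Basis (CPath n) K (PathAlgebra K n) :=
  ⟨LinearEquiv.refl K (CPath n →₀ K)⟩

theorem basis_apply (p : CPath n) : basis K p = ofPath K p := rfl

theorem coe_basis : ⇑(basis K : Module.Basis (CPath n) K _) = ofPath K := rfl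

theorem span_range_ofPath : Submodule.span K (Set.range (ofPath K : CPath n → _)) = ⊤ :=
  (basis K).span_eq

variable {K}

/-- The universal property of `K Q_n`: an algebra homomorphism is given by a multiplicative family
of elements indexed by the paths. -/
noncomputable def lift {B : Type*} [Semiring B] [Algebra K B] (θ : CPath n → B)
    (hmul : ∀ p q, θ p * θ q = if p.target = q.start then θ (p.append q) else 0)
    (hone : ∑ i : Fin n, θ ⟨i, 0⟩ = 1) : PathAlgebra K n →ₐ[K] B :=
  AlgHom.ofLinearMap ((basis K).constr K θ)
    (by simp only [one_def, map_sum, ← basis_apply, Module.Basis.constr_basis, hone])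
    (by
      have hext : (LinearMap.mul K (PathAlgebra K n)).compr₂ ((basis K).constr K θ) =
          (LinearMap.mul K B).compl₁₂ ((basis K).constr K θ) ((basis K).constr K θ) :=
        (basis K).ext fun p => (basis K).ext fun q => by
          simp only [LinearMap.compr₂_apply, LinearMap.compl₁₂_apply, LinearMap.mul_apply',
            Module.Basis.constr_basis, hmul]
          rw [basis_apply, basis_apply, ofPath_mul_ofPath, mulPath]
          split_ifs
          · rw [← basis_apply, Module.Basis.constr_basis]
          · rw [map_zero]
      exact fun a b => LinearMap.congr_fun₂ hext a b)

theorem lift_ofPath {B : Type*} [Semiring B] [Algebra K B] (θ : CPath n → B)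
    (hmul : ∀ p q, θ p * θ q = if p.target = q.start then θ (p.append q) else 0)
    (hone : ∑ i : Fin n, θ ⟨i, 0⟩ = 1) (p : CPath n) :
    lift (K := K) θ hmul hone (ofPath K p) = θ p :=
  (basis K).constr_basis K θ p

end PathAlgebra

open PathAlgebra

section AlgebraBasis

variable (K : Type u) [Field K] {n : ℕ} (Y : Relations n)

/-- The span of the zero paths. It is an ideal, and therefore contains `relIdeal K Y`. -/
noncomputable def killedSpan : Submodule K (PathAlgebra K n) :=
  Submodule.span K (ofPath K '' {p | Y.Kills p})

theorem killedSpan_mul_top : killedSpan K Y * ⊤ ≤ killedSpan K Y := by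
  rw [← span_range_ofPath K, killedSpan, Submodule.span_mul_span, Submodule.span_le]
  rintro _ ⟨_, ⟨p, hp, rfl⟩, _, ⟨q, rfl⟩, rfl⟩
  beta_reduce
  rw [ofPath_mul_ofPath, mulPath]
  split_ifs
  · exact Submodule.subset_span ⟨_, hp.of_isSubword (p.isSubword_append_right q), rfl⟩
  · exact zero_mem _

theorem top_mul_killedSpan : ⊤ * killedSpan K Y ≤ killedSpan K Y := by
  rw [← span_range_ofPath K, killedSpan, Submodule.span_mul_span, Submodule.span_le]
  rintro _ ⟨_, ⟨p, rfl⟩, _, ⟨q, hq, rfl⟩, rfl⟩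
  beta_reduce
  rw [ofPath_mul_ofPath, mulPath]
  split_ifs with h
  · exact Submodule.subset_span ⟨_, hq.of_isSubword (CPath.isSubword_append_left h), rfl⟩
  · exact zero_mem _

theorem mem_killedSpan_of_mem_relIdeal {a : PathAlgebra K n} (ha : a ∈ relIdeal K Y) :
    a ∈ killedSpan K Y := by
  have hle : relIdeal K Y ≤ TwoSidedIdeal.mk' (killedSpan K Y : Set (PathAlgebra K n))
      (zero_mem _) (fun h h' => add_mem h h') (fun h => neg_mem h)
      (fun h => top_mul_killedSpan K Y (Submodule.mul_mem_mul Submodule.mem_top h))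
      (fun h => killedSpan_mul_top K Y (Submodule.mul_mem_mul h Submodule.mem_top)) := by
    refine TwoSidedIdeal.span_le.2 ?_
    rintro _ ⟨p, hp, rfl⟩
    rw [SetLike.mem_coe, TwoSidedIdeal.mem_mk']
    exact Submodule.subset_span ⟨p, .of_mem hp, rfl⟩
  have hmem := hle ha
  rwa [TwoSidedIdeal.mem_mk'] at hmem

/-- The projection of the path algebra onto the Nakayama algebra. -/
noncomputable def algMk : PathAlgebra K n →ₐ[K] Alg K Y := RingCon.mkₐ K (relIdeal K Y).ringCon

theorem algMk_ofPath (p : CPath n) : algMk K Y (ofPath K p) = pathClass K Y p := rfl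

theorem algMk_surjective : Function.Surjective (algMk K Y) :=
  RingCon.mk'_surjective _

theorem algMk_eq_zero_iff (a : PathAlgebra K n) : algMk K Y a = 0 ↔ a ∈ relIdeal K Y := by
  rw [TwoSidedIdeal.mem_iff, ← map_zero (algMk K Y)]
  exact (relIdeal K Y).ringCon.eq

theorem pathClass_mul (p q : CPath n) (h : p.target = q.start) :
    pathClass K Y p * pathClass K Y q = pathClass K Y (p.append q) := by
  rw [← algMk_ofPath, ← algMk_ofPath, ← map_mul, ofPath_mul_ofPath, mulPath, if_pos h,
    algMk_ofPath]

theorem pathClass_mul_of_ne (p q : CPath n) (h : p.target ≠ q.start) :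
    pathClass K Y p * pathClass K Y q = 0 := by
  rw [← algMk_ofPath, ← algMk_ofPath, ← map_mul, ofPath_mul_ofPath, mulPath, if_neg h, map_zero]

theorem sum_idem : ∑ i, idem K Y i = 1 := by
  rw [← map_one (algMk K Y), one_def, map_sum]
  rfl

theorem span_range_pathClass : Submodule.span K (Set.range (pathClass K Y)) = ⊤ := by
  have hrange : Set.range (pathClass K Y) = (algMk K Y).toLinearMap '' Set.range (ofPath K) := by
    rw [← Set.range_comp]; rfl
  rw [hrange, Submodule.span_image, span_range_ofPath, Submodule.map_top, LinearMap.range_eq_top]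
  exact algMk_surjective K Y

variable {K Y}

theorem pathClass_eq_zero {p : CPath n} (hp : Y.Kills p) : pathClass K Y p = 0 := by
  obtain ⟨y, hy, a, b, hstart, hlen⟩ := hp
  have htarget : (⟨p.start, a⟩ : CPath n).target = y.start := hstart
  have hy0 : pathClass K Y y = 0 :=
    (algMk_eq_zero_iff K Y _).2 (TwoSidedIdeal.subset_span ⟨y, hy, rfl⟩)
  have hfactor : p = (CPath.append ⟨p.start, a⟩ y).append ⟨y.target, b⟩ := CPath.ext rfl hlen
  rw [hfactor, ← pathClass_mul K Y _ _ (CPath.target_append _ _ htarget),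
    ← pathClass_mul K Y _ _ htarget, hy0, mul_zero, zero_mul]

theorem Alg.induction_on {motive : Alg K Y → Prop} (a : Alg K Y)
    (zero : motive 0) (add : ∀ a b, motive a → motive b → motive (a + b))
    (smul : ∀ (c : K) (p : CPath n), motive (c • pathClass K Y p)) : motive a := by
  obtain ⟨a, rfl⟩ := algMk_surjective K Y a
  induction a using PathAlgebra.induction_on with
  | zero => rwa [map_zero]
  | add a b ha hb => rw [map_add]; exact add _ _ ha hb
  | smul c p => rw [map_smul]; exact smul c p

variable (K Y)

theorem linearIndependent_pathClass :
    LinearIndependent K (fun p : {p : CPath n // ¬ Y.Kills p} => pathClass K Y p) := by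
  have hpaths : LinearIndependent K (fun p : {p : CPath n // ¬ Y.Kills p} => ofPath K p.1) :=
    (basis K).linearIndependent.comp _ Subtype.val_injective
  refine hpaths.map (f := (algMk K Y).toLinearMap) ?_
  have hker : LinearMap.ker (algMk K Y).toLinearMap ≤ killedSpan K Y := fun a ha =>
    mem_killedSpan_of_mem_relIdeal K Y ((algMk_eq_zero_iff K Y a).1 ha)
  refine Disjoint.mono_right hker ?_
  have hrange : Set.range (fun p : {p : CPath n // ¬ Y.Kills p} => ofPath K p.1) =
      basis K '' {p | ¬ Y.Kills p} := (Set.image_eq_range _ _).symm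
  rw [hrange, killedSpan, ← coe_basis]
  exact (basis K).linearIndependent.disjoint_span_image disjoint_compl_left

/-- The basis of the Nakayama algebra consisting of the nonzero paths. -/
noncomputable def pathBasis : Module.Basis {p : CPath n // ¬ Y.Kills p} K (Alg K Y) :=
  Module.Basis.mk (linearIndependent_pathClass K Y) (by
    rw [← span_range_pathClass, Submodule.span_le]
    rintro _ ⟨p, rfl⟩
    by_cases h : Y.Kills p
    · rw [pathClass_eq_zero h]; exact zero_mem _
    · exact Submodule.subset_span ⟨⟨p, h⟩, rfl⟩)

theorem pathBasis_apply (p) : pathBasis K Y p = pathClass K Y p.1 := Module.Basis.mk_apply _ _ _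

theorem pathClass_eq_zero_iff (p : CPath n) : pathClass K Y p = 0 ↔ Y.Kills p := by
  refine ⟨fun h => ?_, pathClass_eq_zero⟩
  by_contra hp
  exact (linearIndependent_pathClass K Y).ne_zero ⟨p, hp⟩ h

end AlgebraBasis

section Projectives

variable (K : Type u) [Field K] {n : ℕ} (Y : Relations n)

theorem idem_mul_self (i : Fin n) : idem K Y i * idem K Y i = idem K Y i :=
  pathClass_mul K Y ⟨i, 0⟩ ⟨i, 0⟩ rfl

theorem idem_mul_idem_of_ne {i j : Fin n} (h : i ≠ j) : idem K Y i * idem K Y j = 0 :=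
  pathClass_mul_of_ne K Y ⟨i, 0⟩ ⟨j, 0⟩ h

theorem idem_mul_pathClass (p : CPath n) :
    idem K Y p.start * pathClass K Y p = pathClass K Y p := by
  rw [idem, pathClass_mul K Y _ _ rfl]
  exact congrArg _ (CPath.ext rfl (zero_add _))

theorem pathClass_mul_idem (p : CPath n) :
    pathClass K Y p * idem K Y p.target = pathClass K Y p :=
  pathClass_mul K Y _ _ rfl

theorem pathClass_mul_mk (i : Fin n) (l t : ℕ) :
    pathClass K Y ⟨i, l⟩ * pathClass K Y ⟨next^[l] i, t⟩ = pathClass K Y ⟨i, l + t⟩ :=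
  pathClass_mul K Y _ _ rfl

theorem mem_proj_iff (i : Fin n) (x : Alg K Y) : x ∈ proj K Y i ↔ idem K Y i * x = x := by
  rw [proj, Submodule.mem_span_singleton]
  constructor
  · rintro ⟨a, rfl⟩
    rw [← MulOpposite.op_unop a, op_smul_eq_mul, ← mul_assoc, idem_mul_self]
  · intro h
    exact ⟨MulOpposite.op x, by rw [op_smul_eq_mul, h]⟩

variable {K Y} in
theorem proj_idem_mul {i : Fin n} (x : proj K Y i) : idem K Y i * (x : Alg K Y) = x :=
  (mem_proj_iff K Y i x).1 x.2

/-- The path with start `i` and length `l`, as an element of `P_i`. -/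
noncomputable def projPath (i : Fin n) (l : ℕ) : proj K Y i :=
  ⟨pathClass K Y ⟨i, l⟩, (mem_proj_iff K Y i _).2 (idem_mul_pathClass K Y ⟨i, l⟩)⟩

theorem coe_projPath (i : Fin n) (l : ℕ) :
    (projPath K Y i l : Alg K Y) = pathClass K Y ⟨i, l⟩ := rfl

theorem projPath_eq_zero_iff (i : Fin n) (l : ℕ) :
    projPath K Y i l = 0 ↔ Y.kupisch i ≤ l := by
  rw [← Y.kills_mk_iff, ← pathClass_eq_zero_iff K, ← coe_projPath, ZeroMemClass.coe_eq_zero]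

/-- The submodule of `P_i` generated by the path of length `l`. These form the radical
filtration of `P_i`. -/
noncomputable def projFil (i : Fin n) (l : ℕ) : Submodule (Alg K Y)ᵐᵒᵖ (proj K Y i) :=
  Submodule.span _ {projPath K Y i l}

theorem mem_projFil_iff (i : Fin n) (l : ℕ) (x : proj K Y i) :
    x ∈ projFil K Y i l ↔ ∃ y, pathClass K Y ⟨i, l⟩ * y = x := by
  rw [projFil, Submodule.mem_span_singleton]
  constructor
  · rintro ⟨a, rfl⟩
    exact ⟨a.unop, rfl⟩
  · rintro ⟨y, hy⟩
    exact ⟨MulOpposite.op y, Subtype.ext hy⟩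

theorem projPath_mem_projFil {i : Fin n} {l m : ℕ} (h : l ≤ m) :
    projPath K Y i m ∈ projFil K Y i l := by
  rw [mem_projFil_iff]
  exact ⟨pathClass K Y ⟨next^[l] i, m - l⟩, by
    rw [pathClass_mul_mk, Nat.add_sub_cancel' h, coe_projPath]⟩

theorem projFil_le_iff {i : Fin n} {l : ℕ} {S : Submodule (Alg K Y)ᵐᵒᵖ (proj K Y i)} :
    projFil K Y i l ≤ S ↔ projPath K Y i l ∈ S :=
  Submodule.span_singleton_le_iff_mem _ _

theorem projFil_antitone (i : Fin n) : Antitone (projFil K Y i) := fun _ _ h =>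
  (projFil_le_iff K Y).2 (projPath_mem_projFil K Y h)

theorem projFil_zero (i : Fin n) : projFil K Y i 0 = ⊤ := by
  rw [eq_top_iff]
  rintro x -
  rw [mem_projFil_iff]
  exact ⟨x, proj_idem_mul x⟩

theorem projFil_eq_bot {i : Fin n} {l : ℕ} (h : Y.kupisch i ≤ l) : projFil K Y i l = ⊥ := by
  rw [projFil, (projPath_eq_zero_iff K Y i l).2 h, Submodule.span_singleton_eq_bot]

variable {K Y}

theorem op_pathClass_smul_mem_projFil {i : Fin n} {l : ℕ} {x : proj K Y i}
    (hx : x ∈ projFil K Y i l) (p : CPath n) :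
    MulOpposite.op (pathClass K Y p) • x ∈ projFil K Y i (l + p.len) := by
  obtain ⟨y, hy⟩ := (mem_projFil_iff K Y i l x).1 hx
  rw [mem_projFil_iff]
  change ∃ z, _ = (x : Alg K Y) * pathClass K Y p
  rw [← hy]
  clear hy
  induction y using Alg.induction_on with
  | zero => exact ⟨0, by simp only [mul_zero, zero_mul]⟩
  | add y y' h h' =>
    obtain ⟨z, h⟩ := h
    obtain ⟨z', h'⟩ := h'
    exact ⟨z + z', by rw [mul_add, h, h', mul_add, add_mul]⟩
  | smul c q =>
    by_cases hq : (⟨i, l⟩ : CPath n).target = q.start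
    · by_cases hp : q.target = p.start
      · refine ⟨c • pathClass K Y ⟨next^[l + p.len] i, q.len⟩, ?_⟩
        rw [mul_smul_comm, mul_smul_comm, smul_mul_assoc, pathClass_mul K Y _ _ hq,
          pathClass_mul K Y _ _ ((CPath.target_append _ _ hq).trans hp), pathClass_mul_mk]
        exact congrArg (c • pathClass K Y ·)
          (CPath.ext rfl (by simp only [CPath.append]; omega))
      · exact ⟨0, by rw [mul_assoc, smul_mul_assoc, pathClass_mul_of_ne K Y _ _ hp, smul_zero,
          mul_zero, mul_zero]⟩
    · exact ⟨0, by
        rw [mul_smul_comm, pathClass_mul_of_ne K Y _ _ hq, smul_zero, zero_mul, mul_zero]⟩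

theorem exists_sub_smul_projPath_mem {i : Fin n} {l : ℕ} {x : proj K Y i}
    (hx : x ∈ projFil K Y i l) :
    ∃ a : K, x - a • projPath K Y i l ∈ projFil K Y i (l + 1) := by
  obtain ⟨y, hy⟩ := (mem_projFil_iff K Y i l x).1 hx
  simp only [mem_projFil_iff]
  change ∃ (a : K) (z : Alg K Y), _ = (x : Alg K Y) - a • pathClass K Y ⟨i, l⟩
  rw [← hy]
  clear hy
  induction y using Alg.induction_on with
  | zero => exact ⟨0, 0, by simp only [mul_zero, zero_smul, sub_zero]⟩
  | add y y' h h' =>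
    obtain ⟨a, z, h⟩ := h
    obtain ⟨a', z', h'⟩ := h'
    exact ⟨a + a', z + z', by rw [mul_add, h, h', add_smul, mul_add]; abel⟩
  | smul c p =>
    by_cases hp : (⟨i, l⟩ : CPath n).target = p.start
    · obtain ⟨j, s⟩ := p
      obtain rfl : next^[l] i = j := hp
      rw [mul_smul_comm, pathClass_mul_mk]
      rcases s with _ | s
      · exact ⟨c, 0, by rw [add_zero, sub_self, mul_zero]⟩
      · refine ⟨0, c • pathClass K Y ⟨next^[l + 1] i, s⟩, ?_⟩
        rw [mul_smul_comm, pathClass_mul_mk, zero_smul, sub_zero, Nat.add_right_comm l 1 s,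
          Nat.add_assoc]
    · exact ⟨0, 0, by
        rw [mul_smul_comm, pathClass_mul_of_ne K Y _ _ hp, mul_zero, smul_zero, zero_smul,
          sub_zero]⟩

theorem projPath_mem_span_sup {i : Fin n} {l m : ℕ} {x : proj K Y i}
    (hx : x ∈ projFil K Y i l) (hx' : x ∉ projFil K Y i (l + 1)) (hlm : l ≤ m) :
    projPath K Y i m ∈ Submodule.span (Alg K Y)ᵐᵒᵖ {x} ⊔ projFil K Y i (m + 1) := by
  obtain ⟨a, ha⟩ := exists_sub_smul_projPath_mem hx
  have ha0 : a ≠ 0 := by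
    rintro rfl
    rw [zero_smul, sub_zero] at ha
    exact hx' ha
  set r := MulOpposite.op (pathClass K Y ⟨next^[l] i, m - l⟩) with hr
  have hshift : r • projPath K Y i l = projPath K Y i m := by
    refine Subtype.ext ?_
    change pathClass K Y ⟨i, l⟩ * pathClass K Y ⟨next^[l] i, m - l⟩ = _
    rw [pathClass_mul_mk, Nat.add_sub_cancel' hlm, coe_projPath]
  have hmem : r • x - a • projPath K Y i m ∈ projFil K Y i (m + 1) := by
    have h := op_pathClass_smul_mem_projFil ha ⟨next^[l] i, m - l⟩
    rwa [← hr, smul_sub, smul_comm, hshift, show l + 1 + (m - l) = m + 1 by omega] at h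
  have hdecomp : projPath K Y i m =
      a⁻¹ • (r • x) - a⁻¹ • (r • x - a • projPath K Y i m) := by
    rw [smul_sub, sub_sub_cancel, inv_smul_smul₀ ha0]
  rw [hdecomp]
  refine sub_mem (Submodule.mem_sup_left ?_) (Submodule.mem_sup_right ?_)
  · exact Submodule.smul_of_tower_mem _ _
      (Submodule.smul_mem _ _ (Submodule.mem_span_singleton_self x))
  · exact Submodule.smul_of_tower_mem _ _ hmem

theorem span_singleton_eq_projFil {i : Fin n} {l : ℕ} {x : proj K Y i}
    (hx : x ∈ projFil K Y i l) (hx' : x ∉ projFil K Y i (l + 1)) :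
    Submodule.span (Alg K Y)ᵐᵒᵖ {x} = projFil K Y i l := by
  refine le_antisymm ((Submodule.span_singleton_le_iff_mem _ _).2 hx) ?_
  have hdescend : ∀ d m, l ≤ m → Y.kupisch i ≤ m + d →
      projFil K Y i m ≤ Submodule.span (Alg K Y)ᵐᵒᵖ {x} := by
    intro d
    induction d with
    | zero => exact fun m _ hm => (projFil_eq_bot K Y hm).trans_le bot_le
    | succ d ih =>
      intro m hlm hm
      rw [projFil_le_iff, ← sup_eq_left.2 (ih (m + 1) (by omega) (by omega))]
      exact projPath_mem_span_sup hx hx' hlm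
  exact hdescend (Y.kupisch i) l le_rfl (by omega)

theorem exists_span_singleton_eq_projFil (i : Fin n) (x : proj K Y i) :
    ∃ l, Submodule.span (Alg K Y)ᵐᵒᵖ {x} = projFil K Y i l := by
  classical
  by_cases hx0 : x = 0
  · exact ⟨Y.kupisch i, by rw [hx0, Submodule.span_zero_singleton, projFil_eq_bot K Y le_rfl]⟩
  have hex : ∃ l, x ∉ projFil K Y i l := ⟨Y.kupisch i, by
    rwa [projFil_eq_bot K Y le_rfl, Submodule.mem_bot]⟩
  obtain ⟨l, hl⟩ : ∃ l, Nat.find hex = l + 1 := by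
    refine Nat.exists_eq_add_one_of_ne_zero fun h0 => ?_
    have hspec := Nat.find_spec hex
    rw [h0, projFil_zero] at hspec
    exact hspec trivial
  exact ⟨l, span_singleton_eq_projFil (not_not.1 (Nat.find_min hex (by omega)))
    (hl ▸ Nat.find_spec hex)⟩

/-- The indecomposable projectives are uniserial. -/
theorem exists_eq_projFil (i : Fin n) (S : Submodule (Alg K Y)ᵐᵒᵖ (proj K Y i)) :
    ∃ l ≤ Y.kupisch i, S = projFil K Y i l := by
  classical
  have hzero : projPath K Y i (Y.kupisch i) ∈ S := by
    rw [(projPath_eq_zero_iff K Y i _).2 le_rfl]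
    exact zero_mem _
  have hex : ∃ l, projPath K Y i l ∈ S := ⟨_, hzero⟩
  refine ⟨Nat.find hex, Nat.find_min' hex hzero,
    le_antisymm (fun x hx => ?_) ((projFil_le_iff K Y).2 (Nat.find_spec hex))⟩
  obtain ⟨l, hl⟩ := exists_span_singleton_eq_projFil i x
  have hlS : projFil K Y i l ≤ S := hl ▸ (Submodule.span_singleton_le_iff_mem _ _).2 hx
  exact projFil_antitone K Y i (Nat.find_min' hex ((projFil_le_iff K Y).1 hlS))
    (hl ▸ Submodule.mem_span_singleton_self x)

theorem projFil_le_projFil_iff {i : Fin n} {l m : ℕ} (hl : l < Y.kupisch i) :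
    projFil K Y i l ≤ projFil K Y i m ↔ m ≤ l := by
  refine ⟨fun h => ?_, fun h => projFil_antitone K Y i h⟩
  by_contra! hlt
  -- multiplying with the path of length `c_i - 1 - l` kills the path of length `m`, not that
  -- of length `l`
  have hmem := op_pathClass_smul_mem_projFil ((projFil_le_iff K Y).1 h)
    ⟨next^[l] i, Y.kupisch i - 1 - l⟩
  rw [projFil_eq_bot K Y (by simp only; omega), Submodule.mem_bot] at hmem
  have hzero : pathClass K Y ⟨i, l⟩ * pathClass K Y ⟨next^[l] i, Y.kupisch i - 1 - l⟩ = 0 :=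
    congrArg Subtype.val hmem
  rw [pathClass_mul_mk, pathClass_eq_zero_iff, Relations.kills_mk_iff] at hzero
  omega

theorem projFil_covBy {i : Fin n} {l : ℕ} (hl : l < Y.kupisch i) :
    projFil K Y i (l + 1) ⋖ projFil K Y i l := by
  refine ⟨lt_of_le_not_ge (projFil_antitone K Y i l.le_succ) fun h => ?_, fun S hlt hgt => ?_⟩
  · exact absurd ((projFil_le_projFil_iff hl).1 h) (by omega)
  · obtain ⟨m, -, rfl⟩ := exists_eq_projFil i S
    have hlm : ¬ m ≤ l := fun h => hgt.not_ge (projFil_antitone K Y i h)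
    have hml : ¬ l + 1 ≤ m := fun h => hlt.not_ge (projFil_antitone K Y i h)
    omega

variable (K Y)

theorem projLength_eq (i : Fin n) : projLength K Y i = Y.kupisch i := by
  let s : CompositionSeries (Submodule (Alg K Y)ᵐᵒᵖ (proj K Y i)) :=
    { length := Y.kupisch i
      toFun := fun k => projFil K Y i (Y.kupisch i - k)
      step := fun k => by
        have hk := k.isLt
        have hcov := projFil_covBy (K := K) (Y := Y) (i := i) (l := Y.kupisch i - (k + 1))
          (by omega)
        rwa [show Y.kupisch i - (k.val + 1) + 1 = Y.kupisch i - k by omega] at hcov }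
  have hbot : s.head = ⊥ := projFil_eq_bot K Y (Nat.sub_zero _).ge
  have htop : s.last = ⊤ := by
    change projFil K Y i (Y.kupisch i - Y.kupisch i) = ⊤
    rw [Nat.sub_self, projFil_zero]
  rw [projLength, ← Module.length_compositionSeries s hbot htop]
  rfl

theorem isAtom_projFil (i : Fin n) : IsAtom (projFil K Y i (Y.kupisch i - 1)) := by
  have hpos := Y.kupisch_pos i
  have hcov := projFil_covBy (K := K) (Y := Y) (i := i) (l := Y.kupisch i - 1) (by omega)
  rwa [Nat.sub_add_cancel hpos, projFil_eq_bot K Y le_rfl, bot_covBy_iff] at hcov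

theorem isCoatom_projFil_one (i : Fin n) : IsCoatom (projFil K Y i 1) := by
  rw [← covBy_top_iff, ← projFil_zero]
  exact projFil_covBy (Y.kupisch_pos i)

theorem socle_proj (i : Fin n) :
    socle (Alg K Y)ᵐᵒᵖ (proj K Y i) = projFil K Y i (Y.kupisch i - 1) := by
  refine le_antisymm (sSup_le fun S hS => ?_)
    (le_sSup (isSimpleModule_iff_isAtom.2 (isAtom_projFil K Y i)))
  have hS : IsAtom S := isSimpleModule_iff_isAtom.1 hS
  obtain ⟨m, hm, rfl⟩ := exists_eq_projFil i S
  have hmlt : m < Y.kupisch i := hm.lt_of_ne fun h => hS.1 (projFil_eq_bot K Y h.ge)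
  exact ((hS.le_iff.1 (projFil_antitone K Y i (Nat.le_sub_one_of_lt hmlt))).resolve_left
    (isAtom_projFil K Y i).1).ge

theorem jacobson_proj (i : Fin n) :
    Module.jacobson (Alg K Y)ᵐᵒᵖ (proj K Y i) = projFil K Y i 1 := by
  refine le_antisymm (sInf_le (isCoatom_projFil_one K Y i)) (le_sInf fun S hS => ?_)
  have hS : IsCoatom S := hS
  obtain ⟨m, -, rfl⟩ := exists_eq_projFil i S
  have hm : 1 ≤ m := Nat.one_le_iff_ne_zero.2 fun h => hS.1 (h ▸ projFil_zero K Y i)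
  exact ((hS.le_iff.1 (projFil_antitone K Y i hm)).resolve_left
    (isCoatom_projFil_one K Y i).1).le

/-- Left multiplication by `e_i a`, as a homomorphism `P_j → P_i`. -/
noncomputable def leftMul (i j : Fin n) :
    Alg K Y →ₗ[K] (proj K Y j →ₗ[(Alg K Y)ᵐᵒᵖ] proj K Y i) where
  toFun a :=
    { toFun := fun p => ⟨idem K Y i * a * p, by
        rw [mem_proj_iff, ← mul_assoc, ← mul_assoc, idem_mul_self]⟩
      map_add' := fun p q => Subtype.ext (mul_add _ _ _)
      map_smul' := fun r p => Subtype.ext (mul_assoc _ (p : Alg K Y) r.unop).symm }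
  map_add' a b := LinearMap.ext fun p => Subtype.ext (by
    change _ * (a + b) * _ = _ * a * _ + _ * b * _
    rw [mul_add, add_mul])
  map_smul' c a := LinearMap.ext fun p => Subtype.ext (by
    change _ * (c • a) * _ = c • (_ * a * _)
    rw [mul_smul_comm, smul_mul_assoc])

theorem coe_leftMul (i j : Fin n) (a : Alg K Y) (p : proj K Y j) :
    (leftMul K Y i j a p : Alg K Y) = idem K Y i * a * p := rfl

theorem coe_leftMul_pathClass (q : CPath n) (j : Fin n) (p : proj K Y j) :
    (leftMul K Y q.start j (pathClass K Y q) p : Alg K Y) = pathClass K Y q * p := by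
  rw [coe_leftMul, idem_mul_pathClass]

theorem leftMul_pathClass_projPath (q : CPath n) (t : ℕ) :
    leftMul K Y q.start q.target (pathClass K Y q) (projPath K Y q.target t) =
      projPath K Y q.start (q.len + t) :=
  Subtype.ext ((coe_leftMul_pathClass K Y q _ _).trans (pathClass_mul_mk K Y q.start q.len t))

theorem range_leftMul_pathClass (q : CPath n) :
    LinearMap.range (leftMul K Y q.start q.target (pathClass K Y q)) =
      projFil K Y q.start q.len := by
  rw [LinearMap.range_eq_map, ← projFil_zero, projFil, Submodule.map_span, Set.image_singleton,
    leftMul_pathClass_projPath, add_zero, projFil]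

theorem ker_leftMul_pathClass (q : CPath n) :
    LinearMap.ker (leftMul K Y q.start q.target (pathClass K Y q)) =
      projFil K Y q.target (Y.kupisch q.start - q.len) := by
  have hmem : ∀ t, projPath K Y q.target t ∈
      LinearMap.ker (leftMul K Y q.start q.target (pathClass K Y q)) ↔
        Y.kupisch q.start - q.len ≤ t := fun t => by
    rw [LinearMap.mem_ker, leftMul_pathClass_projPath, projPath_eq_zero_iff,
      Nat.sub_le_iff_le_add']
  obtain ⟨m, -, hm⟩ := exists_eq_projFil q.target
    (LinearMap.ker (leftMul K Y q.start q.target (pathClass K Y q)))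
  refine le_antisymm ?_ ((projFil_le_iff K Y).2 ((hmem _).2 le_rfl))
  rw [hm]
  exact projFil_antitone K Y _ ((hmem m).1 (hm ▸ projPath_mem_projFil K Y le_rfl))

/-- The target of the longest nonzero path starting at `i`. -/
noncomputable def socleVertex (i : Fin n) : Fin n := next^[Y.kupisch i - 1] i

theorem nonempty_socle_proj_equiv (i : Fin n) :
    Nonempty (socle (Alg K Y)ᵐᵒᵖ (proj K Y i) ≃ₗ[(Alg K Y)ᵐᵒᵖ] SimpleAt K Y (socleVertex Y i)) := by
  have hpos := Y.kupisch_pos i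
  let f := leftMul K Y i (socleVertex Y i) (pathClass K Y ⟨i, Y.kupisch i - 1⟩)
  have hker : LinearMap.ker f = Module.jacobson (Alg K Y)ᵐᵒᵖ (proj K Y (socleVertex Y i)) := by
    rw [jacobson_proj, show 1 = Y.kupisch i - (Y.kupisch i - 1) by omega]
    exact ker_leftMul_pathClass K Y ⟨i, Y.kupisch i - 1⟩
  have hrange : LinearMap.range f = socle (Alg K Y)ᵐᵒᵖ (proj K Y i) := by
    rw [socle_proj]
    exact range_leftMul_pathClass K Y ⟨i, Y.kupisch i - 1⟩
  exact ⟨((Submodule.quotEquivOfEq _ _ hker.symm).trans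
    (f.quotKerEquivRange.trans (LinearEquiv.ofEq _ _ hrange))).symm⟩

variable {K Y} in
theorem op_idem_smul_simpleAt {j k : Fin n} (h : k ≠ j) (x : SimpleAt K Y k) :
    MulOpposite.op (idem K Y j) • x = 0 := by
  obtain ⟨x, rfl⟩ := Submodule.Quotient.mk_surjective _ x
  rw [← Submodule.Quotient.mk_smul, Submodule.Quotient.mk_eq_zero, jacobson_proj]
  obtain ⟨a, ha⟩ := exists_sub_smul_projPath_mem (projFil_zero K Y k ▸ Submodule.mem_top (x := x))
  have hproj : MulOpposite.op (idem K Y j) • projPath K Y k 0 = 0 :=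
    Subtype.ext (idem_mul_idem_of_ne K Y h)
  have hsmul := Submodule.smul_mem _ (MulOpposite.op (idem K Y j)) ha
  rwa [smul_sub, smul_comm, hproj, smul_zero, sub_zero] at hsmul

theorem nonempty_simpleAt_equiv_iff (j k : Fin n) :
    Nonempty (SimpleAt K Y j ≃ₗ[(Alg K Y)ᵐᵒᵖ] SimpleAt K Y k) ↔ j = k := by
  refine ⟨fun ⟨g⟩ => ?_, fun h => h ▸ ⟨LinearEquiv.refl _ _⟩⟩
  by_contra hne
  let top : SimpleAt K Y j := Submodule.Quotient.mk (projPath K Y j 0)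
  have htop : top ≠ 0 := by
    rw [Ne, Submodule.Quotient.mk_eq_zero, jacobson_proj, ← projFil_le_iff,
      projFil_le_projFil_iff (Y.kupisch_pos j)]
    omega
  have hidem : MulOpposite.op (idem K Y j) • top = top := by
    rw [← Submodule.Quotient.mk_smul]
    exact congrArg _ (Subtype.ext (idem_mul_self K Y j))
  refine htop ((LinearEquiv.map_eq_zero_iff g).1 ?_)
  rw [← hidem, map_smul, op_idem_smul_simpleAt (Ne.symm hne)]

theorem nonempty_socle_equiv_simpleAt_iff (i k : Fin n) :
    Nonempty (socle (Alg K Y)ᵐᵒᵖ (proj K Y i) ≃ₗ[(Alg K Y)ᵐᵒᵖ] SimpleAt K Y k) ↔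
      socleVertex Y i = k := by
  obtain ⟨e⟩ := nonempty_socle_proj_equiv K Y i
  rw [← nonempty_simpleAt_equiv_iff K Y]
  exact ⟨fun ⟨g⟩ => ⟨e.symm.trans g⟩, fun ⟨g⟩ => ⟨e.trans g⟩⟩

/-- The Gustafson function `i ↦ i + |P_i|`, whose graph is the resolution quiver. -/
noncomputable def gustafson (i : Fin n) : Fin n := next^[Y.kupisch i] i

theorem next_socleVertex (i : Fin n) : next (socleVertex Y i) = gustafson Y i := by
  rw [socleVertex, ← Function.iterate_succ_apply' next, Nat.succ_eq_add_one,
    Nat.sub_add_cancel (Y.kupisch_pos i), gustafson]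

theorem resolutionQuiver_adj_iff (i j : Fin n) :
    (resolutionQuiver K Y).Adj i j ↔ gustafson Y i = j := by
  change (∃ k, next k = j ∧ _) ↔ _
  simp only [nonempty_socle_equiv_simpleAt_iff, exists_eq_right', next_socleVertex]

end Projectives

section GustafsonLift

variable {n : ℕ} [NeZero n]

theorem ofNat_eq_ofNat_iff (a b : ℕ) : Fin.ofNat n a = Fin.ofNat n b ↔ a % n = b % n :=
  Fin.ext_iff

theorem next_iterate_ofNat (a b : ℕ) : next^[b] (Fin.ofNat n a) = Fin.ofNat n (a + b) :=
  Fin.ext ((val_next_iterate b _).trans (Nat.mod_add_mod a n b))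

theorem next_ofNat (a : ℕ) : next (Fin.ofNat n a) = Fin.ofNat n (a + 1) :=
  next_iterate_ofNat a 1

variable (Y : Relations n)

/-- The lift of the Gustafson function along the projection of `ℕ` onto the `n` vertices. -/
noncomputable def gustafsonLift (a : ℕ) : ℕ := a + Y.kupisch (Fin.ofNat n a)

theorem gustafsonLift_val (i : Fin n) : gustafsonLift Y i.val = i.val + Y.kupisch i := by
  rw [gustafsonLift, Fin.ofNat_val_eq_self]

theorem gustafson_ofNat (a : ℕ) :
    gustafson Y (Fin.ofNat n a) = Fin.ofNat n (gustafsonLift Y a) :=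
  next_iterate_ofNat _ _

theorem lt_gustafsonLift (a : ℕ) : a < gustafsonLift Y a :=
  Nat.lt_add_of_pos_right (Y.kupisch_pos _)

theorem gustafsonLift_monotone : Monotone (gustafsonLift Y) := by
  refine monotone_nat_of_le_succ fun a => ?_
  have h := Y.kupisch_le_next (Fin.ofNat n a)
  rw [next_ofNat] at h
  rw [gustafsonLift, gustafsonLift]
  omega

theorem gustafsonLift_add_mul (a k : ℕ) :
    gustafsonLift Y (a + k * n) = gustafsonLift Y a + k * n := by
  rw [gustafsonLift, gustafsonLift,
    (ofNat_eq_ofNat_iff (a + k * n) a).2 (Nat.add_mul_mod_self_right a k n), Nat.add_right_comm]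

end GustafsonLift

section Skip

/-- The increasing enumeration of the natural numbers not congruent to `n` modulo `n + 1`. -/
def skip (n a : ℕ) : ℕ := a + a / n

variable {n : ℕ}

theorem skip_strictMono : StrictMono (skip n) := fun a b h => by
  have hdiv := Nat.div_le_div_right (c := n) h.le
  simp only [skip]
  omega

theorem skip_of_lt {a : ℕ} (h : a < n) : skip n a = a := by
  rw [skip, Nat.div_eq_of_lt h, add_zero]

variable [NeZero n]

theorem skip_add_mul (a k : ℕ) : skip n (a + k * n) = skip n a + k * (n + 1) := by
  rw [skip, skip, Nat.add_mul_div_right _ _ (NeZero.pos n)]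
  ring

theorem skip_add_self (a : ℕ) : skip n (a + n) = skip n a + (n + 1) := by
  simpa only [one_mul] using skip_add_mul (n := n) a 1

theorem skip_eq_mod_add (a : ℕ) : skip n a = a % n + a / n * (n + 1) := by
  conv_lhs => rw [← Nat.mod_add_div a n, mul_comm, skip_add_mul,
    skip_of_lt (Nat.mod_lt a (NeZero.pos n))]

theorem skip_mod (a : ℕ) : skip n a % (n + 1) = a % n := by
  rw [skip_eq_mod_add, Nat.add_mul_mod_self_right]
  exact Nat.mod_eq_of_lt ((Nat.mod_lt a (NeZero.pos n)).trans n.lt_succ_self)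

theorem skip_add (a m : ℕ) : skip n (a + m) + a % n = skip n (a % n + m) + skip n a := by
  have h : a + m = a % n + m + a / n * n := by
    rw [add_right_comm, mul_comm, Nat.mod_add_div]
  rw [h, skip_add_mul, skip_eq_mod_add a]
  omega

theorem exists_skip_eq {b : ℕ} (h : b % (n + 1) ≠ n) : ∃ a, skip n a = b := by
  have hlt : b % (n + 1) < n + 1 := Nat.mod_lt b n.succ_pos
  refine ⟨b % (n + 1) + b / (n + 1) * n, ?_⟩
  rw [skip_add_mul, skip_of_lt (by omega), mul_comm, Nat.mod_add_div]

theorem ofNat_skip (a : ℕ) : Fin.ofNat (n + 1) (skip n a) = (Fin.ofNat n a).castSucc :=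
  Fin.ext (skip_mod a)

end Skip

section Deletion

variable {n : ℕ}

theorem isLeaf_iff_notMem_range (K : Type u) [Field K] (Y : Relations n) (j : Fin n) :
    IsLeaf (resolutionQuiver K Y) j ↔ j ∉ Set.range (gustafson Y) := by
  simp only [IsLeaf, resolutionQuiver_adj_iff, Set.mem_range, not_exists]

/-- The function `c` is obtained from the Kupisch series of `Y` by deleting the last vertex:
the targets of the longest nonzero paths from the remaining vertices, moved on by one step, stay
the same under the enumeration `skip` of the remaining vertices. -/
def IsDeletion (Y : Relations (n + 1)) (c : Fin n → ℕ) : Prop :=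
  ∀ i : Fin n, skip n (i.val + c i) = i.val + Y.kupisch i.castSucc

variable {Y : Relations (n + 1)}

theorem gustafsonLift_mod_ne (hY : Fin.last n ∉ Set.range (gustafson Y)) (a : ℕ) :
    gustafsonLift Y a % (n + 1) ≠ n := fun h =>
  hY ⟨Fin.ofNat (n + 1) a, (gustafson_ofNat Y a).trans (Fin.ext h)⟩

variable [NeZero n]

theorem IsDeletion.skip_add_apply {c : Fin n → ℕ} (h : IsDeletion Y c) (a : ℕ) :
    skip n (a + c (Fin.ofNat n a)) = gustafsonLift Y (skip n a) := by
  have hmod : skip n (a % n + c (Fin.ofNat n a)) = a % n + Y.kupisch (Fin.ofNat n a).castSucc :=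
    h (Fin.ofNat n a)
  have hadd := skip_add (n := n) a (c (Fin.ofNat n a))
  rw [gustafsonLift, ofNat_skip]
  omega

theorem IsDeletion.skip_gustafsonLift {Y' : Relations n} (h : IsDeletion Y Y'.kupisch) (a : ℕ) :
    skip n (gustafsonLift Y' a) = gustafsonLift Y (skip n a) :=
  h.skip_add_apply a

theorem IsDeletion.le_add_one {c : Fin n → ℕ} (h : IsDeletion Y c) (i : Fin n) :
    c i ≤ c (next i) + 1 := by
  have hle : skip n (i.val + c i) ≤ skip n (i.val + 1 + c (next i)) := by
    have hi := h.skip_add_apply i.val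
    have hnext := h.skip_add_apply (i.val + 1)
    rw [← next_ofNat] at hnext
    rw [Fin.ofNat_val_eq_self] at hi hnext
    rw [hi, hnext]
    exact gustafsonLift_monotone Y (skip_strictMono.monotone (Nat.le_succ _))
  have := skip_strictMono.le_iff_le.1 hle
  omega

theorem exists_isDeletion (hY : Fin.last n ∉ Set.range (gustafson Y)) :
    ∃ Y' : Relations n, IsDeletion Y Y'.kupisch := by
  have h : ∀ i : Fin n, ∃ c, 1 ≤ c ∧ skip n (i.val + c) = i.val + Y.kupisch i.castSucc := by
    intro i
    obtain ⟨b, hb⟩ := exists_skip_eq (gustafsonLift_mod_ne hY i.castSucc.val)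
    rw [gustafsonLift_val, Fin.val_castSucc] at hb
    have hlt : i.val < b := by
      rw [← skip_strictMono.lt_iff_lt (a := i.val) (b := b), hb, skip_of_lt i.isLt]
      exact Nat.lt_add_of_pos_right (Y.kupisch_pos _)
    exact ⟨b - i.val, by omega, by rw [Nat.add_sub_cancel' hlt.le, hb]⟩
  choose c hpos hc using h
  have hdel : IsDeletion Y c := hc
  exact ⟨Relations.ofKupisch c hpos hdel.le_add_one, by rwa [Relations.kupisch_ofKupisch]⟩

end Deletion

section LiftPath

variable {n : ℕ}

/-- The path of `Q_{n+1}` corresponding to a path of `Q_n`, where the new vertex is inserted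
between the last vertex and the first one. -/
def liftPath (p : CPath n) : CPath (n + 1) :=
  ⟨p.start.castSucc, skip n (p.start.val + p.len) - p.start.val⟩

theorem start_liftPath (p : CPath n) : (liftPath p).start = p.start.castSucc := rfl

theorem start_add_len_liftPath (p : CPath n) :
    p.start.val + (liftPath p).len = skip n (p.start.val + p.len) :=
  Nat.add_sub_cancel' ((Nat.le_add_right _ _).trans skip_strictMono.le_apply)

theorem liftPath_trivial (i : Fin n) : liftPath ⟨i, 0⟩ = ⟨i.castSucc, 0⟩ :=
  CPath.ext rfl (by rw [liftPath, add_zero, skip_of_lt i.isLt, Nat.sub_self])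

theorem liftPath_injective : Function.Injective (liftPath (n := n)) := by
  intro p q h
  have hstart : p.start = q.start := Fin.castSucc_injective _ (congrArg CPath.start h)
  have hskip : skip n (p.start.val + p.len) = skip n (p.start.val + q.len) := by
    rw [← start_add_len_liftPath, h, hstart, start_add_len_liftPath]
  exact CPath.ext hstart (Nat.add_left_cancel (skip_strictMono.injective hskip))

theorem IsDeletion.kills_liftPath_iff {Y : Relations (n + 1)} {Y' : Relations n}
    (h : IsDeletion Y Y'.kupisch) (p : CPath n) : Y.Kills (liftPath p) ↔ Y'.Kills p := by
  rw [Relations.kills_iff, Relations.kills_iff, ← add_le_add_iff_left p.start.val,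
    start_add_len_liftPath, start_liftPath, ← h p.start, skip_strictMono.le_iff_le,
    add_le_add_iff_left]

variable [NeZero n]

theorem target_liftPath (p : CPath n) : (liftPath p).target = p.target.castSucc := by
  refine Fin.ext ?_
  rw [CPath.target, val_next_iterate, start_liftPath, Fin.val_castSucc, start_add_len_liftPath,
    skip_mod, Fin.val_castSucc, CPath.target, val_next_iterate]

theorem liftPath_append {p q : CPath n} (h : p.target = q.start) :
    liftPath (p.append q) = (liftPath p).append (liftPath q) := by
  refine CPath.ext rfl ?_
  have hq : q.start.val = (p.start.val + p.len) % n := by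
    rw [← h, CPath.target, val_next_iterate]
  have hlen := start_add_len_liftPath (p.append q)
  have hlenp := start_add_len_liftPath p
  have hlenq := start_add_len_liftPath q
  have hskip := skip_add (n := n) (p.start.val + p.len) q.len
  rw [hq] at hlenq
  simp only [CPath.append, ← add_assoc] at *
  omega

theorem exists_liftPath_eq {q : CPath (n + 1)} {i j : Fin n} (hi : q.start = i.castSucc)
    (hj : q.target = j.castSucc) : ∃ p, liftPath p = q := by
  have hmod : (i.val + q.len) % (n + 1) = j.val := by
    have h := congrArg Fin.val hj
    rwa [CPath.target, val_next_iterate, hi, Fin.val_castSucc, Fin.val_castSucc] at h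
  obtain ⟨a, ha⟩ := exists_skip_eq (hmod.trans_ne j.isLt.ne)
  have hia : i.val ≤ a := by
    rw [← skip_strictMono.le_iff_le (a := i.val) (b := a), ha, skip_of_lt i.isLt]
    exact Nat.le_add_right _ _
  refine ⟨⟨i, a - i.val⟩, CPath.ext hi.symm ?_⟩
  simp only [liftPath]
  rw [Nat.add_sub_cancel' hia, ha, Nat.add_sub_cancel_left]

end LiftPath

section EndAlgebra

variable (K : Type u) [Field K] {n : ℕ} (Y : Relations (n + 1))

/-- The endomorphism of `P'` given by left multiplication with the lift of a path. -/
noncomputable def endPath (p : CPath n) : EndAlg K Y :=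
  LinearMap.pi fun k => leftMul K Y k.castSucc p.target.castSucc
    (if k = p.start then pathClass K Y (liftPath p) else 0) ∘ₗ LinearMap.proj p.target

theorem coe_endPath (p : CPath n) (v : PPrime K Y) (k : Fin n) :
    (endPath K Y p v k : Alg K Y) =
      if k = p.start then pathClass K Y (liftPath p) * v p.target else 0 := by
  change idem K Y k.castSucc * (if k = p.start then pathClass K Y (liftPath p) else 0) *
    (v p.target : Alg K Y) = _
  split_ifs with h
  · subst h
    exact congrArg (· * _) (idem_mul_pathClass K Y (liftPath p))
  · rw [mul_zero, zero_mul]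

theorem endPath_mul_endPath [NeZero n] (p q : CPath n) :
    endPath K Y p * endPath K Y q = if p.target = q.start then endPath K Y (p.append q) else 0 := by
  refine LinearMap.ext fun v => funext fun k => Subtype.ext ?_
  rw [Module.End.mul_apply, coe_endPath, coe_endPath]
  split_ifs with hk hpq hpq
  · have hmul := pathClass_mul K Y (liftPath p) (liftPath q)
      ((target_liftPath p).trans (congrArg Fin.castSucc hpq))
    rw [coe_endPath, liftPath_append hpq, CPath.target_append p q hpq, ← mul_assoc, hmul]
    exact (if_pos hk).symm
  · rw [mul_zero]
    rfl
  · rw [coe_endPath]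
    exact (if_neg hk).symm
  · rfl

theorem endPath_trivial (i : Fin n) : endPath K Y ⟨i, 0⟩ = endIdem K Y i := by
  refine LinearMap.ext fun v => funext fun k => Subtype.ext ?_
  rw [coe_endPath, liftPath_trivial]
  change _ = ((Pi.single i (v i) : PPrime K Y) k : Alg K Y)
  split_ifs with h
  · obtain rfl : k = i := h
    rw [Pi.single_eq_same]
    exact proj_idem_mul (v k)
  · rw [Pi.single_eq_of_ne h, ZeroMemClass.coe_zero]

theorem sum_endPath_trivial : ∑ i : Fin n, endPath K Y ⟨i, 0⟩ = 1 := by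
  simp only [endPath_trivial]
  refine LinearMap.ext fun v => ?_
  rw [LinearMap.sum_apply]
  exact Finset.univ_sum_single v

/-- The algebra homomorphism `K Q_n → End(P')` sending a path to left multiplication with its
lift. -/
noncomputable def endHom [NeZero n] : PathAlgebra K n →ₐ[K] EndAlg K Y :=
  PathAlgebra.lift (endPath K Y) (endPath_mul_endPath K Y) (sum_endPath_trivial K Y)

theorem endHom_ofPath [NeZero n] (p : CPath n) :
    endHom K Y (PathAlgebra.ofPath K p) = endPath K Y p :=
  PathAlgebra.lift_ofPath _ _ _ _

/-- The generator of the summand `P_j` of `P'`. -/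
noncomputable def genPPrime (j : Fin n) : PPrime K Y := Pi.single j (projPath K Y j.castSucc 0)

theorem sum_op_smul_genPPrime (v : PPrime K Y) :
    ∑ j, MulOpposite.op (v j : Alg K Y) • genPPrime K Y j = v := by
  refine (Finset.sum_congr rfl fun j _ => ?_).trans (Finset.univ_sum_single v)
  rw [genPPrime, ← Pi.single_smul]
  exact congrArg _ (Subtype.ext (proj_idem_mul (v j)))

/-- The element of `Λ` whose component in `e_k Λ e_j` represents the component `P_j → P_k` of an
endomorphism of `P'`. -/
noncomputable def endEval : EndAlg K Y →ₗ[K] Alg K Y where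
  toFun g := ∑ k, ∑ j, (g (genPPrime K Y j) k : Alg K Y)
  map_add' g h := by
    simp only [LinearMap.add_apply, Pi.add_apply, Submodule.coe_add, Finset.sum_add_distrib]
  map_smul' c g := by
    simp only [Finset.smul_sum, RingHom.id_apply]
    rfl

theorem endEval_apply (g : EndAlg K Y) :
    endEval K Y g = ∑ k, ∑ j, (g (genPPrime K Y j) k : Alg K Y) := rfl

theorem endEval_endPath [NeZero n] (p : CPath n) :
    endEval K Y (endPath K Y p) = pathClass K Y (liftPath p) := by
  simp only [endEval_apply, coe_endPath]
  rw [Fintype.sum_eq_single p.start fun k hk => by simp only [if_neg hk, Finset.sum_const_zero],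
    Fintype.sum_eq_single p.target fun j hj => by
      rw [if_pos rfl, genPPrime, Pi.single_eq_of_ne hj.symm, ZeroMemClass.coe_zero, mul_zero],
    if_pos rfl, genPPrime, Pi.single_eq_same, coe_projPath]
  have h := pathClass_mul_idem K Y (liftPath p)
  rwa [target_liftPath] at h

theorem apply_genPPrime_mul_idem (g : EndAlg K Y) (j k : Fin n) :
    (g (genPPrime K Y j) k : Alg K Y) * idem K Y j.castSucc = g (genPPrime K Y j) k := by
  have h : MulOpposite.op (idem K Y j.castSucc) • genPPrime K Y j = genPPrime K Y j := by
    rw [genPPrime, ← Pi.single_smul]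
    exact congrArg _ (Subtype.ext (idem_mul_self K Y _))
  conv_rhs => rw [← h, map_smul]
  rfl

theorem idem_mul_endEval_mul_idem (g : EndAlg K Y) (j k : Fin n) :
    idem K Y k.castSucc * endEval K Y g * idem K Y j.castSucc = g (genPPrime K Y j) k := by
  have hne {a b : Fin n} (hab : a ≠ b) : idem K Y a.castSucc * idem K Y b.castSucc = 0 :=
    idem_mul_idem_of_ne K Y ((Fin.castSucc_injective n).ne hab)
  rw [endEval_apply, Finset.mul_sum, Finset.sum_mul, Fintype.sum_eq_single k,
    Finset.mul_sum, Finset.sum_mul, Fintype.sum_eq_single j]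
  · rw [proj_idem_mul, apply_genPPrime_mul_idem]
  · intro j' hj
    rw [← apply_genPPrime_mul_idem, mul_assoc, mul_assoc, hne hj, mul_zero, mul_zero]
  · intro k' hk
    rw [Finset.mul_sum, Finset.sum_mul]
    refine Finset.sum_eq_zero fun j' _ => ?_
    rw [← proj_idem_mul, ← mul_assoc, hne hk.symm, zero_mul, zero_mul]

theorem endEval_injective : Function.Injective (endEval K Y) := by
  refine (injective_iff_map_eq_zero _).2 fun g hg => ?_
  have hgen : ∀ j, g (genPPrime K Y j) = 0 := fun j => funext fun k => Subtype.ext (by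
    rw [← idem_mul_endEval_mul_idem, hg, mul_zero, zero_mul]
    rfl)
  refine LinearMap.ext fun v => ?_
  rw [← sum_op_smul_genPPrime K Y v, map_sum, LinearMap.zero_apply]
  exact Finset.sum_eq_zero fun j _ => by rw [map_smul, hgen, smul_zero]

theorem idem_mul_mul_idem_mem_span [NeZero n] (j k : Fin n) (x : Alg K Y) :
    idem K Y k.castSucc * x * idem K Y j.castSucc ∈
      Submodule.span K (Set.range fun p : CPath n => pathClass K Y (liftPath p)) := by
  induction x using Alg.induction_on with
  | zero => simp only [mul_zero, zero_mul, zero_mem]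
  | add a b ha hb =>
    rw [mul_add, add_mul]
    exact add_mem ha hb
  | smul c q =>
    rw [mul_smul_comm, smul_mul_assoc]
    refine Submodule.smul_mem _ _ ?_
    by_cases hk : k.castSucc = q.start
    · by_cases hj : q.target = j.castSucc
      · rw [hk, idem_mul_pathClass, ← hj, pathClass_mul_idem]
        obtain ⟨p, rfl⟩ := exists_liftPath_eq hk.symm hj
        exact Submodule.subset_span ⟨p, rfl⟩
      · rw [mul_assoc, idem, idem, pathClass_mul_of_ne K Y q ⟨j.castSucc, 0⟩ hj, mul_zero]
        exact zero_mem _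
    · rw [idem, idem, pathClass_mul_of_ne K Y ⟨k.castSucc, 0⟩ q hk, zero_mul]
      exact zero_mem _

theorem endEval_mem_span [NeZero n] (g : EndAlg K Y) : endEval K Y g ∈
    Submodule.span K (Set.range fun p : CPath n => pathClass K Y (liftPath p)) := by
  rw [endEval_apply]
  refine Submodule.sum_mem _ fun k _ => Submodule.sum_mem _ fun j _ => ?_
  rw [← idem_mul_endEval_mul_idem]
  exact idem_mul_mul_idem_mem_span K Y j k _

theorem endPath_eq_zero [NeZero n] {p : CPath n} (h : Y.Kills (liftPath p)) :
    endPath K Y p = 0 :=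
  endEval_injective K Y (by rw [endEval_endPath, pathClass_eq_zero h, map_zero])

variable {Y}

theorem IsDeletion.relIdeal_le_ker_endHom [NeZero n] {Y' : Relations n}
    (h : IsDeletion Y Y'.kupisch) : relIdeal K Y' ≤ TwoSidedIdeal.ker (endHom K Y) := by
  refine TwoSidedIdeal.span_le.2 ?_
  rintro _ ⟨p, hp, rfl⟩
  rw [SetLike.mem_coe, TwoSidedIdeal.mem_ker, endHom_ofPath]
  exact endPath_eq_zero K Y ((h.kills_liftPath_iff p).2 (.of_mem hp))

/-- The homomorphism from the Nakayama algebra with the deleted vertex to `End(P')`. -/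
noncomputable def deletionHom [NeZero n] {Y' : Relations n} (h : IsDeletion Y Y'.kupisch) :
    Alg K Y' →ₐ[K] EndAlg K Y :=
  RingCon.liftₐ _ (endHom K Y) (by
    intro x y hxy
    have hker := h.relIdeal_le_ker_endHom K ((TwoSidedIdeal.rel_iff _ _ _).1 hxy)
    rw [TwoSidedIdeal.mem_ker, map_sub, sub_eq_zero] at hker
    exact hker)

theorem deletionHom_pathClass [NeZero n] {Y' : Relations n} (h : IsDeletion Y Y'.kupisch)
    (p : CPath n) : deletionHom K h (pathClass K Y' p) = endPath K Y p :=
  endHom_ofPath K Y p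

theorem endEval_deletionHom_pathClass [NeZero n] {Y' : Relations n}
    (h : IsDeletion Y Y'.kupisch) (p : CPath n) :
    endEval K Y (deletionHom K h (pathClass K Y' p)) = pathClass K Y (liftPath p) := by
  rw [deletionHom_pathClass, endEval_endPath]

theorem deletionHom_injective [NeZero n] {Y' : Relations n} (h : IsDeletion Y Y'.kupisch) :
    Function.Injective (deletionHom K h) := by
  let f := endEval K Y ∘ₗ (deletionHom K h).toLinearMap
  have hli : LinearIndependent K (f ∘ pathBasis K Y') := by
    have hlift := (linearIndependent_pathClass K Y).comp
      (fun p : {p : CPath n // ¬ Y'.Kills p} =>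
        (⟨liftPath p.1, fun hp => p.2 ((h.kills_liftPath_iff p.1).1 hp)⟩ :
          {p : CPath (n + 1) // ¬ Y.Kills p}))
      (fun p q hpq => Subtype.ext (liftPath_injective (congrArg Subtype.val hpq)))
    convert hlift using 1
    funext p
    rw [Function.comp_apply, pathBasis_apply]
    exact endEval_deletionHom_pathClass K h p.1
  have hf : Function.Injective f := by
    rw [← (pathBasis K Y').constr_self K f]
    exact (pathBasis K Y').injective_constr_of_linearIndependent (R₂ := K) hli
  exact Function.Injective.of_comp (f := endEval K Y) hf

theorem deletionHom_surjective [NeZero n] {Y' : Relations n} (h : IsDeletion Y Y'.kupisch) :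
    Function.Surjective (deletionHom K h) := by
  intro g
  have hspan : Submodule.span K (Set.range fun p : CPath n => pathClass K Y (liftPath p)) ≤
      LinearMap.range (endEval K Y ∘ₗ (deletionHom K h).toLinearMap) := by
    refine Submodule.span_le.2 ?_
    rintro _ ⟨p, rfl⟩
    exact ⟨pathClass K Y' p, endEval_deletionHom_pathClass K h p⟩
  obtain ⟨x, hx⟩ := hspan (endEval_mem_span K Y g)
  exact ⟨x, endEval_injective K Y hx⟩

theorem exists_presentation_of_isDeletion [NeZero n] {Y' : Relations n}
    (h : IsDeletion Y Y'.kupisch) :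
    ∃ φ : EndAlg K Y ≃ₐ[K] Alg K Y', IsPresentation K Y Y' φ := by
  refine ⟨(AlgEquiv.ofBijective _
    ⟨deletionHom_injective K h, deletionHom_surjective K h⟩).symm, fun i => ?_⟩
  rw [AlgEquiv.symm_apply_eq, ← endPath_trivial]
  exact (deletionHom_pathClass K h ⟨i, 0⟩).symm

end EndAlgebra

section Uniqueness

variable (K : Type u) [Field K] {n : ℕ}

theorem range_mulLeft_idem (Y : Relations n) (i : Fin n) :
    LinearMap.range (LinearMap.mulLeft K (idem K Y i)) =
      Submodule.span K (Set.range fun l : Fin (Y.kupisch i) => pathClass K Y ⟨i, l⟩) := by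
  apply le_antisymm
  · rintro _ ⟨x, rfl⟩
    rw [LinearMap.mulLeft_apply]
    induction x using Alg.induction_on with
    | zero => simp only [mul_zero, zero_mem]
    | add a b ha hb =>
      rw [mul_add]
      exact add_mem ha hb
    | smul c p =>
      rw [mul_smul_comm]
      refine Submodule.smul_mem _ _ ?_
      by_cases hi : i = p.start
      · subst hi
        rw [idem_mul_pathClass]
        by_cases hp : Y.Kills p
        · rw [pathClass_eq_zero hp]
          exact zero_mem _
        · rw [Y.kills_iff, not_le] at hp
          exact Submodule.subset_span ⟨⟨p.len, hp⟩, rfl⟩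
      · rw [idem, pathClass_mul_of_ne K Y ⟨i, 0⟩ p hi]
        exact zero_mem _
  · rw [Submodule.span_le]
    rintro _ ⟨l, rfl⟩
    exact ⟨pathClass K Y ⟨i, l⟩, idem_mul_pathClass K Y ⟨i, l⟩⟩

theorem finrank_range_mulLeft_idem (Y : Relations n) (i : Fin n) :
    Module.finrank K (LinearMap.range (LinearMap.mulLeft K (idem K Y i))) = Y.kupisch i := by
  have hli : LinearIndependent K fun l : Fin (Y.kupisch i) => pathClass K Y ⟨i, l⟩ :=
    (linearIndependent_pathClass K Y).comp
      (fun l : Fin (Y.kupisch i) => (⟨⟨i, l⟩, by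
        rw [Y.kills_mk_iff]
        exact l.isLt.not_ge⟩ : {p : CPath n // ¬ Y.Kills p}))
      (fun l m h => Fin.ext (congrArg (fun p : {p : CPath n // ¬ Y.Kills p} => p.1.len) h))
  rw [range_mulLeft_idem, finrank_span_eq_card hli, Fintype.card_fin]

theorem kupisch_eq_of_algEquiv {Y₁ Y₂ : Relations n} (e : Alg K Y₁ ≃ₐ[K] Alg K Y₂)
    (he : ∀ i, e (idem K Y₁ i) = idem K Y₂ i) : Y₁.kupisch = Y₂.kupisch := by
  funext i
  have hcomm : LinearMap.mulLeft K (idem K Y₂ i) ∘ₗ e.toLinearEquiv.toLinearMap =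
      e.toLinearEquiv.toLinearMap ∘ₗ LinearMap.mulLeft K (idem K Y₁ i) :=
    LinearMap.ext fun y => by
      change idem K Y₂ i * e y = e (idem K Y₁ i * y)
      rw [map_mul, he]
  rw [← finrank_range_mulLeft_idem K Y₁ i, ← finrank_range_mulLeft_idem K Y₂ i,
    ← LinearMap.range_comp_of_range_eq_top (LinearMap.mulLeft K (idem K Y₂ i))
      (LinearMap.range_eq_top.2 e.toLinearEquiv.surjective),
    hcomm, LinearMap.range_comp]
  exact (LinearEquiv.finrank_map_eq e.toLinearEquiv _).symm

theorem IsPresentation.isDeletion [NeZero n] {Y : Relations (n + 1)}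
    (hY : Fin.last n ∉ Set.range (gustafson Y)) {Y' : Relations n}
    {φ : EndAlg K Y ≃ₐ[K] Alg K Y'} (hφ : IsPresentation K Y Y' φ) :
    IsDeletion Y Y'.kupisch := by
  obtain ⟨Y₁, hY₁⟩ := exists_isDeletion hY
  obtain ⟨φ₁, hφ₁⟩ := exists_presentation_of_isDeletion K hY₁
  rwa [← kupisch_eq_of_algEquiv K (φ₁.symm.trans φ) fun i => by
    rw [AlgEquiv.trans_apply, ← hφ₁ i, AlgEquiv.symm_apply_apply, hφ i]]

end Uniqueness

section FunctionDigraph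

variable {V W : Type*}

/-- The digraph with an arrow `i → f i` for every vertex `i`. -/
def functionDigraph (f : V → V) : Digraph V where
  Adj i j := f i = j

variable {f : V → V}

theorem eq_iterate_of_isChain {a : V} {l : List V}
    (h : List.IsChain (functionDigraph f).Adj (a :: l)) :
    a :: l = List.iterate f a (l.length + 1) := by
  induction l generalizing a with
  | nil => rfl
  | cons b l ih =>
    obtain ⟨rfl, hl⟩ := List.isChain_cons_cons.1 h
    rw [ih hl, List.length_iterate]
    rfl

theorem isOrientedCycle_functionDigraph_iff {c : List V} :
    IsOrientedCycle (functionDigraph f) c ↔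
      ∃ a ∈ Function.periodicPts f, c = List.iterate f a (Function.minimalPeriod f a) := by
  constructor
  · rintro ⟨hne, hnodup, hchain⟩
    obtain ⟨a, l, rfl⟩ := List.exists_cons_of_ne_nil hne
    have hiter := eq_iterate_of_isChain ((Cycle.chain_coe_cons _ _ _).1 hchain)
    rw [List.length_append, List.length_singleton, List.iterate_add, ← List.cons_append] at hiter
    obtain ⟨hl, ha⟩ := List.append_inj hiter (List.length_iterate ..).symm
    have hper : Function.IsPeriodicPt f (l.length + 1) a := (List.cons.inj ha).1.symm
    refine ⟨a, ⟨_, Nat.succ_pos _, hper⟩, ?_⟩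
    have hmem := Function.minimalPeriod_pos_iff_mem_periodicPts.2 ⟨_, Nat.succ_pos _, hper⟩
    rw [hl]
    congr 1
    refine (hper.minimalPeriod_le (Nat.succ_pos _)).antisymm' (not_lt.1 fun hlt => ?_)
    rw [hl] at hnodup
    refine hmem.ne' ((List.Nodup.getElem_inj_iff hnodup
      (hi := (List.length_iterate ..).symm ▸ hlt)
      (hj := (List.length_iterate ..).symm ▸ Nat.succ_pos _)).1 ?_)
    rw [List.getElem_iterate, List.getElem_iterate, Function.iterate_minimalPeriod,
      Function.iterate_zero_apply]
  · rintro ⟨a, ha, rfl⟩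
    rw [← List.range_map_iterate]
    refine ⟨?_, Cycle.nodup_coe_iff.1 Function.nodup_periodicOrbit,
      (Function.periodicOrbit_chain' _ ha).2 fun k => (Function.iterate_succ_apply' f k a).symm⟩
    rw [Ne, List.map_eq_nil_iff, List.range_eq_nil]
    exact (Function.minimalPeriod_pos_of_mem_periodicPts ha).ne'

theorem onCycle_functionDigraph_iff {i : V} :
    OnCycle (functionDigraph f) i ↔ i ∈ Function.periodicPts f := by
  simp only [OnCycle, isOrientedCycle_functionDigraph_iff]
  constructor
  · rintro ⟨_, ⟨a, ha, rfl⟩, hi⟩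
    obtain ⟨k, -, rfl⟩ := List.mem_iterate.1 hi
    obtain ⟨m, hm, hper⟩ := ha
    exact ⟨m, hm, hper.apply_iterate k⟩
  · exact fun hi => ⟨_, ⟨i, hi, rfl⟩,
      List.mem_iterate.2 ⟨0, Function.minimalPeriod_pos_of_mem_periodicPts hi, rfl⟩⟩

theorem reachable_apply (i : V) :
    (functionDigraph f).toSimpleGraphInclusive.Reachable i (f i) := by
  by_cases hi : i = f i
  · rw [← hi]
  · exact SimpleGraph.Adj.reachable ⟨hi, Or.inl rfl⟩

theorem reachable_iterate (i : V) (k : ℕ) :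
    (functionDigraph f).toSimpleGraphInclusive.Reachable i (f^[k] i) := by
  induction k with
  | zero => exact SimpleGraph.Reachable.refl _
  | succ k ih =>
    rw [Function.iterate_succ_apply']
    exact ih.trans (reachable_apply _)

theorem reachable_map {g : W → W} (r : V → W)
    (hr : ∀ i, (functionDigraph g).toSimpleGraphInclusive.Reachable (r i) (r (f i))) {i j : V}
    (h : (functionDigraph f).toSimpleGraphInclusive.Reachable i j) :
    (functionDigraph g).toSimpleGraphInclusive.Reachable (r i) (r j) := by
  obtain ⟨p⟩ := h
  induction p with
  | nil => exact SimpleGraph.Reachable.refl _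
  | cons h _ ih =>
    refine SimpleGraph.Reachable.trans ?_ ih
    obtain ⟨-, rfl | rfl⟩ := h
    · exact hr _
    · exact (hr _).symm

theorem exists_iterate_mem_periodicPts [Finite V] (f : V → V) (i : V) :
    ∃ k, f^[k] i ∈ Function.periodicPts f := by
  obtain ⟨k, l, hne, h⟩ := Finite.exists_ne_map_eq_of_infinite (fun k => f^[k] i)
  wlog hkl : k < l generalizing k l
  · exact this l k hne.symm h.symm (by omega)
  refine ⟨k, l - k, by omega, ?_⟩
  rw [Function.IsPeriodicPt, Function.IsFixedPt, ← Function.iterate_add_apply,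
    Nat.sub_add_cancel hkl.le]
  exact h.symm

theorem exists_isOrientedCycle_of_component [Finite V] (C : Component (functionDigraph f)) :
    ∃ c : List V, IsOrientedCycle (functionDigraph f) c ∧
      ∀ i ∈ c, (functionDigraph f).toSimpleGraphInclusive.connectedComponentMk i = C := by
  obtain ⟨i, rfl⟩ := C.exists_rep
  obtain ⟨k, hk⟩ := exists_iterate_mem_periodicPts f i
  refine ⟨_, isOrientedCycle_functionDigraph_iff.2 ⟨_, hk, rfl⟩, fun j hj => ?_⟩
  obtain ⟨m, -, rfl⟩ := List.mem_iterate.1 hj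
  rw [← Function.iterate_add_apply]
  exact SimpleGraph.ConnectedComponent.sound (reachable_iterate i _).symm

end FunctionDigraph

section DeleteLeaf

variable {n : ℕ} {f : Fin (n + 1) → Fin (n + 1)} {f' : Fin n → Fin n}

theorem reachable_castSucc_iff (hf : Function.Semiconj Fin.castSucc f' f)
    (hlast : Fin.last n ∉ Set.range f) {i j : Fin n} :
    (functionDigraph f).toSimpleGraphInclusive.Reachable i.castSucc j.castSucc ↔
      (functionDigraph f').toSimpleGraphInclusive.Reachable i j := by
  -- retract the last vertex onto its image under `f`
  let last' : Fin n := (f (Fin.last n)).castPred fun h => hlast ⟨_, h⟩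
  let r : Fin (n + 1) → Fin n := Fin.lastCases last' id
  have hr : ∀ i : Fin n, r i.castSucc = i := fun i => Fin.lastCases_castSucc i
  have hrlast : r (Fin.last n) = last' := Fin.lastCases_last
  constructor
  · intro h
    rw [← hr i, ← hr j]
    refine reachable_map r (fun k => ?_) h
    induction k using Fin.lastCases with
    | last => rw [hrlast, ← Fin.castSucc_castPred (f (Fin.last n)) fun h => hlast ⟨_, h⟩, hr]
    | cast k =>
      rw [hr, ← hf, hr]
      exact reachable_apply k
  · exact reachable_map _ fun k => hf k ▸ reachable_apply k.castSucc

theorem card_component_eq_of_semiconj (hf : Function.Semiconj Fin.castSucc f' f)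
    (hlast : Fin.last n ∉ Set.range f) :
    Nat.card (Component (functionDigraph f')) = Nat.card (Component (functionDigraph f)) := by
  refine Nat.card_eq_of_bijective
    (Quot.map Fin.castSucc fun i j h => (reachable_castSucc_iff hf hlast).2 h) ⟨?_, ?_⟩
  · rintro ⟨i⟩ ⟨j⟩ h
    exact SimpleGraph.ConnectedComponent.sound
      ((reachable_castSucc_iff hf hlast).1 (SimpleGraph.ConnectedComponent.exact h))
  · rintro ⟨i⟩
    induction i using Fin.lastCases with
    | last =>
      refine ⟨(functionDigraph f').toSimpleGraphInclusive.connectedComponentMk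
        ((f (Fin.last n)).castPred fun h => hlast ⟨_, h⟩),
        SimpleGraph.ConnectedComponent.sound ?_⟩
      rw [Fin.castSucc_castPred]
      exact (reachable_apply _).symm
    | cast i => exact ⟨(functionDigraph f').toSimpleGraphInclusive.connectedComponentMk i, rfl⟩

theorem castSucc_mem_periodicPts_iff (hf : Function.Semiconj Fin.castSucc f' f) {i : Fin n} :
    i.castSucc ∈ Function.periodicPts f ↔ i ∈ Function.periodicPts f' := by
  refine exists_congr fun k => and_congr_right fun _ => ?_
  rw [Function.IsPeriodicPt, Function.IsFixedPt, ← (hf.iterate_right k).eq]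
  exact (Fin.castSucc_injective n).eq_iff

theorem last_notMem_periodicPts (hlast : Fin.last n ∉ Set.range f) :
    Fin.last n ∉ Function.periodicPts f := by
  rintro ⟨_ | k, hk, h⟩
  · exact absurd hk (lt_irrefl 0)
  · exact hlast ⟨_, (Function.iterate_succ_apply' f k _).symm.trans h⟩

theorem card_not_onCycle_of_semiconj (hf : Function.Semiconj Fin.castSucc f' f)
    (hlast : Fin.last n ∉ Set.range f) :
    Nat.card {i // ¬ OnCycle (functionDigraph f') i} + 1 =
      Nat.card {i // ¬ OnCycle (functionDigraph f) i} := by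
  simp only [onCycle_functionDigraph_iff]
  have hcompl : (Function.periodicPts f)ᶜ =
      insert (Fin.last n) (Fin.castSucc '' (Function.periodicPts f')ᶜ) := by
    ext i
    induction i using Fin.lastCases with
    | last => simpa using last_notMem_periodicPts hlast
    | cast i =>
      rw [Set.mem_insert_iff, or_iff_right (Fin.castSucc_lt_last i).ne,
        (Fin.castSucc_injective n).mem_set_image, Set.mem_compl_iff, Set.mem_compl_iff,
        castSucc_mem_periodicPts_iff hf]
  change (Function.periodicPts f')ᶜ.ncard + 1 = (Function.periodicPts f)ᶜ.ncard
  rw [hcompl, Set.ncard_insert_of_notMem, Set.ncard_image_of_injective _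
    (Fin.castSucc_injective n)]
  rintro ⟨i, -, h⟩
  exact (Fin.castSucc_lt_last i).ne h

end DeleteLeaf

section WindingNumber

variable {N : ℕ} {F : ℕ → ℕ}

/-- The class of `x` modulo `N` has minimal period `m` under the map of the cyclic group of order
`N` with lift `F`, and `F` winds `w` times around the cyclic group along this periodic orbit. -/
structure IsWindingCycle (F : ℕ → ℕ) (N m w x : ℕ) : Prop where
  pos : 0 < m
  iterate_eq : F^[m] x = x + w * N
  iterate_ne : ∀ p, 0 < p → p < m → ∀ v, F^[p] x ≠ x + v * N

theorem iterate_add_mul (hN : ∀ a k, F (a + k * N) = F a + k * N) (m a k : ℕ) :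
    F^[m] (a + k * N) = F^[m] a + k * N :=
  Function.Commute.iterate_left (g := (· + k * N)) (fun a => hN a k) m a

theorem iterate_apply_eq_add_mul (hN : ∀ a k, F (a + k * N) = F a + k * N) {w x : ℕ}
    (h : F x = x + w * N) (k : ℕ) : F^[k] x = x + k * w * N := by
  induction k with
  | zero => rw [zero_mul, zero_mul]; rfl
  | succ k ih =>
    rw [Function.iterate_succ_apply', ih, hN, h]
    ring

theorem translation_le_of_monotone (hF : Monotone F) (hN : ∀ a k, F (a + k * N) = F a + k * N)
    (hNpos : 0 < N) {x y a b : ℕ} (hx : F x = x + a * N) (hy : F y = y + b * N) : a ≤ b := by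
  by_contra! hlt
  let k := y + x * N + 1
  have hle : x + k * a * N ≤ y + k * b * N + x * N := by
    have hxy : x ≤ y + x * N := by nlinarith
    have hiter := hF.iterate k hxy
    rwa [iterate_add_mul hN, iterate_apply_eq_add_mul hN hx,
      iterate_apply_eq_add_mul hN hy] at hiter
  have hmul : k * (b + 1) * N ≤ k * a * N :=
    Nat.mul_le_mul_right _ (Nat.mul_le_mul_left _ hlt)
  have hk : k ≤ k * N := Nat.le_mul_of_pos_right _ hNpos
  have hk' : k = y + x * N + 1 := rfl
  linarith [show k * (b + 1) * N = k * b * N + k * N by ring]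

theorem iterate_eq_of_iterate_mul_eq (hF : Monotone F)
    (hN : ∀ a k, F (a + k * N) = F a + k * N) {p v x d : ℕ} (hd : 0 < d)
    (h : F^[p * d] x = x + d * v * N) : F^[p] x = x + v * N := by
  have hcomm : Function.Commute F^[p] (· + v * N) := fun a => iterate_add_mul hN p a v
  refine (hcomm.iterate_pos_eq_iff_map_eq (hF.iterate p) (add_left_strictMono) hd).1 ?_
  rw [← Function.iterate_mul, h, add_right_iterate, smul_eq_mul, mul_assoc]

theorem IsWindingCycle.coprime (hF : Monotone F) (hN : ∀ a k, F (a + k * N) = F a + k * N)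
    {m w x : ℕ} (h : IsWindingCycle F N m w x) : Nat.Coprime m w := by
  by_contra hgcd
  have hpos : 0 < Nat.gcd m w := Nat.gcd_pos_of_pos_left _ h.pos
  have hlt : 1 < Nat.gcd m w := lt_of_le_of_ne hpos (Ne.symm hgcd)
  obtain ⟨p, hp⟩ := Nat.gcd_dvd_left m w
  obtain ⟨v, hv⟩ := Nat.gcd_dvd_right m w
  have hp0 : 0 < p := Nat.pos_of_mul_pos_left (hp ▸ h.pos)
  refine h.iterate_ne p hp0 ?_ v (iterate_eq_of_iterate_mul_eq hF hN hpos ?_)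
  · exact (Nat.lt_mul_iff_one_lt_left hp0).2 hlt |>.trans_eq hp.symm
  · rw [mul_comm p, ← hp, ← hv, h.iterate_eq]

/-- Both cycles have the same rotation number `w / m = w' / m'`, and these fractions are
reduced. -/
theorem IsWindingCycle.winding_eq (hF : Monotone F) (hN : ∀ a k, F (a + k * N) = F a + k * N)
    (hNpos : 0 < N) {m w x m' w' y : ℕ} (h : IsWindingCycle F N m w x)
    (h' : IsWindingCycle F N m' w' y) : w = w' := by
  have hx : F^[m * m'] x = x + m' * w * N := by
    rw [Function.iterate_mul, iterate_apply_eq_add_mul (iterate_add_mul hN m) h.iterate_eq]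
  have hy : F^[m * m'] y = y + m * w' * N := by
    rw [mul_comm, Function.iterate_mul,
      iterate_apply_eq_add_mul (iterate_add_mul hN m') h'.iterate_eq]
  have hmono := hF.iterate (m * m')
  have hper := iterate_add_mul hN (m * m')
  have hrot : m' * w = m * w' :=
    le_antisymm (translation_le_of_monotone hmono hper hNpos hx hy)
      (translation_le_of_monotone hmono hper hNpos hy hx)
  obtain rfl : m = m' := Nat.dvd_antisymm
    ((h.coprime hF hN).dvd_of_dvd_mul_right ⟨w', hrot⟩)
    ((h'.coprime hF hN).dvd_of_dvd_mul_right ⟨w, hrot.symm⟩)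
  exact Nat.eq_of_mul_eq_mul_left h.pos hrot

end WindingNumber

section Weight

variable (K : Type u) [Field K] {n : ℕ}

theorem resolutionQuiver_eq_functionDigraph (Y : Relations n) :
    resolutionQuiver K Y = functionDigraph (gustafson Y) :=
  Digraph.ext (funext₂ fun i j => propext (resolutionQuiver_adj_iff K Y i j))

variable [NeZero n]

theorem gustafson_iterate_ofNat (Y : Relations n) (k a : ℕ) :
    (gustafson Y)^[k] (Fin.ofNat n a) = Fin.ofNat n ((gustafsonLift Y)^[k] a) :=
  (Function.Semiconj.iterate_right (f := Fin.ofNat n)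
    (fun a => (gustafson_ofNat Y a).symm) k a).symm

theorem gustafson_iterate_eq_iff (Y : Relations n) (k : ℕ) (i : Fin n) :
    (gustafson Y)^[k] i = i ↔ ∃ v, (gustafsonLift Y)^[k] i.val = i.val + v * n := by
  conv_lhs => rw [← Fin.ofNat_val_eq_self i, gustafson_iterate_ofNat, ofNat_eq_ofNat_iff]
  constructor
  · intro h
    have hle : i.val ≤ (gustafsonLift Y)^[k] i.val :=
      Function.id_le_iterate_of_id_le (fun a => (lt_gustafsonLift Y a).le) k i.val
    obtain ⟨v, hv⟩ := (Nat.modEq_iff_dvd' hle).1 h.symm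
    exact ⟨v, by rw [mul_comm, ← hv, Nat.add_sub_cancel' hle]⟩
  · rintro ⟨v, hv⟩
    rw [hv, Nat.add_mul_mod_self_right]

theorem exists_isWindingCycle (Y : Relations n) {i : Fin n}
    (hi : i ∈ Function.periodicPts (gustafson Y)) :
    ∃ w, IsWindingCycle (gustafsonLift Y) n (Function.minimalPeriod (gustafson Y) i) w i.val := by
  obtain ⟨w, hw⟩ := (gustafson_iterate_eq_iff Y _ i).1 Function.iterate_minimalPeriod
  exact ⟨w, Function.minimalPeriod_pos_of_mem_periodicPts hi, hw, fun p hp hpm v hv =>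
    Function.not_isPeriodicPt_of_pos_of_lt_minimalPeriod hp.ne' hpm
      ((gustafson_iterate_eq_iff Y p i).2 ⟨v, hv⟩)⟩

theorem add_sum_projLength_iterate (Y : Relations n) (a k : ℕ) :
    a + ((List.iterate (gustafson Y) (Fin.ofNat n a) k).map (projLength K Y)).sum =
      (gustafsonLift Y)^[k] a := by
  induction k generalizing a with
  | zero => rfl
  | succ k ih =>
    rw [List.iterate, List.map_cons, List.sum_cons, Function.iterate_succ_apply, ← ih,
      gustafson_ofNat, projLength_eq, ← add_assoc, ← gustafsonLift]

theorem cycleWeight_iterate_of_isWindingCycle (Y : Relations n) {m w : ℕ} {i : Fin n}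
    (h : IsWindingCycle (gustafsonLift Y) n m w i.val) :
    cycleWeight K Y (List.iterate (gustafson Y) i m) = w := by
  have hsum := add_sum_projLength_iterate K Y i.val m
  rw [Fin.ofNat_val_eq_self, h.iterate_eq] at hsum
  rw [cycleWeight, Nat.add_left_cancel hsum, Nat.cast_mul,
    mul_div_cancel_right₀ _ (Nat.cast_ne_zero.2 (NeZero.ne n))]

theorem hasWeight_of_isWindingCycle (Y : Relations n) {m w x : ℕ}
    (h : IsWindingCycle (gustafsonLift Y) n m w x) : HasWeight K Y w := by
  rw [HasWeight, resolutionQuiver_eq_functionDigraph]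
  refine ⟨exists_isOrientedCycle_of_component, fun c hc => ?_⟩
  obtain ⟨i, hi, rfl⟩ := isOrientedCycle_functionDigraph_iff.1 hc
  obtain ⟨v, hv⟩ := exists_isWindingCycle Y hi
  rw [cycleWeight_iterate_of_isWindingCycle K Y hv,
    hv.winding_eq (gustafsonLift_monotone Y) (gustafsonLift_add_mul Y) (NeZero.pos n) h]

end Weight

section DeletionQuiver

variable (K : Type u) [Field K] {n : ℕ} [NeZero n] {Y : Relations (n + 1)} {Y' : Relations n}

theorem IsDeletion.semiconj_gustafson (h : IsDeletion Y Y'.kupisch) :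
    Function.Semiconj Fin.castSucc (gustafson Y') (gustafson Y) := fun i => by
  refine Fin.ext ?_
  rw [gustafson, gustafson, Fin.val_castSucc, val_next_iterate, val_next_iterate,
    ← skip_mod, h i, Fin.val_castSucc]

theorem IsDeletion.resolutionQuiver_adj_iff (h : IsDeletion Y Y'.kupisch) (i j : Fin n) :
    (resolutionQuiver K Y').Adj i j ↔ (resolutionQuiver K Y).Adj i.castSucc j.castSucc := by
  rw [Nakayama.resolutionQuiver_adj_iff, Nakayama.resolutionQuiver_adj_iff,
    ← h.semiconj_gustafson.eq, Fin.castSucc_inj]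

theorem IsDeletion.isWindingCycle (h : IsDeletion Y Y'.kupisch) {m w x : ℕ}
    (hx : IsWindingCycle (gustafsonLift Y') n m w x) :
    IsWindingCycle (gustafsonLift Y) (n + 1) m w (skip n x) := by
  have hskip (k : ℕ) := Function.Semiconj.iterate_right h.skip_gustafsonLift k x
  refine ⟨hx.pos, ?_, fun p hp hpm v hv => hx.iterate_ne p hp hpm v ?_⟩
  · rw [← hskip, hx.iterate_eq, skip_add_mul]
  · rw [← hskip, ← skip_add_mul] at hv
    exact skip_strictMono.injective hv

theorem IsDeletion.exists_hasWeight (h : IsDeletion Y Y'.kupisch) :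
    ∃ w : ℚ, HasWeight K Y w ∧ HasWeight K Y' w := by
  obtain ⟨k, hk⟩ := exists_iterate_mem_periodicPts (gustafson Y') 0
  obtain ⟨w, hw⟩ := exists_isWindingCycle Y' hk
  exact ⟨w, hasWeight_of_isWindingCycle K Y (h.isWindingCycle hw),
    hasWeight_of_isWindingCycle K Y' hw⟩

end DeletionQuiver

section Realization

variable {ι κ : Type*} [Fintype ι] {L : AbstractSimplicialComplex ι}
  {L' : AbstractSimplicialComplex κ}

theorem exists_face_eq_support {t : ι → ℝ} (ht : t ∈ stdSimplex ℝ ι) {s : Finset ι}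
    (hs : s ∈ L.faces) (hts : ∀ i, t i ≠ 0 → i ∈ s) : ∃ s ∈ L.faces, ∀ v, v ∈ s ↔ t v ≠ 0 := by
  classical
  obtain ⟨i, -, hi⟩ : ∃ i ∈ Finset.univ, t i ≠ 0 :=
    Finset.exists_ne_zero_of_sum_ne_zero (ht.2.trans_ne one_ne_zero)
  refine ⟨{i ∈ s | t i ≠ 0}, (L.isRelLowerSet_faces hs).2 (Finset.filter_subset _ _)
    ⟨i, Finset.mem_filter.2 ⟨hts i hi, hi⟩⟩, fun v => ?_⟩
  rw [Finset.mem_filter, and_iff_right_of_imp (hts v)]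

/-- Contiguous maps are joined by the straight-line homotopy. -/
theorem homotopic_of_contiguous {X : Type*} [TopologicalSpace X] (φ ψ : C(X, Realization L))
    (h : ∀ x, ∃ s ∈ L.faces, (∀ i, (φ x).1 i ≠ 0 → i ∈ s) ∧ ∀ i, (ψ x).1 i ≠ 0 → i ∈ s) :
    φ.Homotopic ψ := by
  let H (p : unitInterval × X) : ι → ℝ := AffineMap.lineMap (φ p.2).1 (ψ p.2).1 (p.1 : ℝ)
  have hH (p : unitInterval × X) : H p ∈ stdSimplex ℝ ι :=
    (convex_stdSimplex ℝ ι).lineMap_mem (φ p.2).2.1 (ψ p.2).2.1 p.1.2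
  have hface (p : unitInterval × X) : ∃ s ∈ L.faces, ∀ v, v ∈ s ↔ H p v ≠ 0 := by
    obtain ⟨s, hs, hφ, hψ⟩ := h p.2
    refine exists_face_eq_support (hH p) hs fun i => not_imp_comm.1 fun hi => ?_
    simp only [H, AffineMap.lineMap_apply_module, Pi.add_apply, Pi.smul_apply,
      not_imp_comm.1 (hφ i) hi, not_imp_comm.1 (hψ i) hi, smul_zero, add_zero]
  have hcont : Continuous H := Continuous.lineMap
    (continuous_subtype_val.comp (φ.continuous.comp continuous_snd))
    (continuous_subtype_val.comp (ψ.continuous.comp continuous_snd))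
    (continuous_subtype_val.comp continuous_fst)
  exact ⟨⟨⟨fun p => ⟨H p, hH p, hface p⟩, hcont.subtype_mk _⟩,
    fun x => Subtype.ext (AffineMap.lineMap_apply_zero _ _),
    fun x => Subtype.ext (AffineMap.lineMap_apply_one _ _)⟩⟩

variable [Fintype κ]

theorem exists_of_stdSimplex_map_ne_zero {g : ι → κ} {t : stdSimplex ℝ ι} {k : κ}
    (h : stdSimplex.map g t k ≠ 0) : ∃ i, g i = k ∧ t i ≠ 0 := by
  classical
  rw [stdSimplex.map_coe, FunOnFinite.linearMap_apply_apply] at h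
  obtain ⟨i, hi, hne⟩ := Finset.exists_ne_zero_of_sum_ne_zero h
  exact ⟨i, (Finset.mem_filter.1 hi).2, hne⟩

variable [DecidableEq ι] [DecidableEq κ]

/-- The map of realizations induced by a simplicial map. -/
noncomputable def realizationMap (g : ι → κ) (hg : ∀ s ∈ L.faces, s.image g ∈ L'.faces) :
    C(Realization L, Realization L') where
  toFun x := ⟨stdSimplex.map g ⟨x.1, x.2.1⟩, (stdSimplex.map g _).2, by
    obtain ⟨s, hs, hx⟩ := x.2.2
    refine exists_face_eq_support (stdSimplex.map g _).2 (hg s hs) fun k hk => ?_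
    obtain ⟨i, rfl, hi⟩ := exists_of_stdSimplex_map_ne_zero hk
    exact Finset.mem_image_of_mem _ ((hx i).2 hi)⟩
  continuous_toFun := (continuous_subtype_val.comp ((stdSimplex.continuous_map g).comp
    (continuous_subtype_val.subtype_mk _))).subtype_mk _

theorem realizationMap_comp_homotopic_id (g : ι → κ) (h : κ → ι)
    (hg : ∀ s ∈ L.faces, s.image g ∈ L'.faces) (hh : ∀ s ∈ L'.faces, s.image h ∈ L.faces)
    (hgh : ∀ s ∈ L.faces, s ∪ (s.image g).image h ∈ L.faces) :
    ((realizationMap h hh).comp (realizationMap g hg)).Homotopic (ContinuousMap.id _) := by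
  refine homotopic_of_contiguous _ _ fun x => ?_
  obtain ⟨s, hs, hx⟩ := x.2.2
  refine ⟨_, hgh s hs, fun i hi => ?_, fun i hi => Finset.mem_union_left _ ((hx i).2 hi)⟩
  obtain ⟨k, rfl, hk⟩ := exists_of_stdSimplex_map_ne_zero hi
  obtain ⟨j, rfl, hj⟩ := exists_of_stdSimplex_map_ne_zero hk
  exact Finset.mem_union_right _ (Finset.mem_image_of_mem _ (Finset.mem_image_of_mem _
    ((hx j).2 hj)))

theorem nonempty_homotopyEquiv_of_contiguous (g : ι → κ) (h : κ → ι)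
    (hg : ∀ s ∈ L.faces, s.image g ∈ L'.faces) (hh : ∀ s ∈ L'.faces, s.image h ∈ L.faces)
    (hgh : ∀ s ∈ L.faces, s ∪ (s.image g).image h ∈ L.faces)
    (hhg : ∀ s ∈ L'.faces, s ∪ (s.image h).image g ∈ L'.faces) :
    Nonempty (ContinuousMap.HomotopyEquiv (Realization L) (Realization L')) :=
  ⟨⟨realizationMap g hg, realizationMap h hh, realizationMap_comp_homotopic_id g h hg hh hgh,
    realizationMap_comp_homotopic_id h g hh hg hhg⟩⟩

end Realization

section EulerCharacteristic

variable {ι κ : Type*} [Fintype ι] {L : AbstractSimplicialComplex ι}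
  {L' : AbstractSimplicialComplex κ}

theorem neg_one_pow_card_sub_one_add_insert {ι : Type*} [DecidableEq ι] {s : ι} {σ : Finset ι}
    (hσ : σ.Nonempty) (hs : s ∉ σ) :
    (-1 : ℤ) ^ (σ.card - 1) + (-1) ^ ((insert s σ).card - 1) = 0 := by
  obtain ⟨m, hm⟩ := Nat.exists_eq_succ_of_ne_zero hσ.card_pos.ne'
  rw [Finset.card_insert_of_notMem hs, hm, Nat.succ_sub_one, Nat.add_sub_cancel, pow_succ]
  ring

open Classical in
/-- Toggling the vertex `s` pairs off these faces. -/
theorem sum_faces_of_dominated {r s : ι} (hsr : s ≠ r)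
    (hdom : ∀ σ ∈ L.faces, r ∈ σ → ∃ τ ∈ L.faces, σ ⊆ τ ∧ s ∈ τ) :
    ∑ σ : Finset ι with σ ∈ L.faces ∧ r ∈ σ, (-1 : ℤ) ^ (σ.card - 1) = 0 := by
  refine Finset.sum_involution (fun σ _ => if s ∈ σ then σ.erase s else insert s σ)
    (fun σ hσ => ?_) (fun σ _ _ => ?_) (fun σ hσ => ?_) (fun σ _ => ?_)
  · have hr : r ∈ σ.erase s := Finset.mem_erase.2 ⟨hsr.symm, (Finset.mem_filter.1 hσ).2.2⟩
    split_ifs with h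
    · have hsum := neg_one_pow_card_sub_one_add_insert ⟨r, hr⟩ (Finset.notMem_erase s σ)
      rwa [Finset.insert_erase h, add_comm] at hsum
    · exact neg_one_pow_card_sub_one_add_insert ⟨r, Finset.mem_of_mem_erase hr⟩ h
  · split_ifs with h
    · exact fun he => Finset.erase_eq_self.1 he h
    · exact fun he => h (Finset.insert_eq_self.1 he)
  · obtain ⟨-, hface, hr⟩ := Finset.mem_filter.1 hσ
    refine Finset.mem_filter.2 ⟨Finset.mem_univ _, ?_⟩
    split_ifs with h
    · have hr' : r ∈ σ.erase s := Finset.mem_erase.2 ⟨hsr.symm, hr⟩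
      exact ⟨(L.isRelLowerSet_faces hface).2 (Finset.erase_subset _ _) ⟨r, hr'⟩, hr'⟩
    · obtain ⟨τ, hτ, hστ, hsτ⟩ := hdom σ hface hr
      exact ⟨(L.isRelLowerSet_faces hτ).2 (Finset.insert_subset hsτ hστ)
        (Finset.insert_nonempty _ _), Finset.mem_insert_of_mem hr⟩
  · by_cases h : s ∈ σ
    · simp only [if_pos h, if_neg (Finset.notMem_erase s σ), Finset.insert_erase h]
    · simp only [if_neg h, if_pos (Finset.mem_insert_self s σ), Finset.erase_insert h]

variable [Fintype κ]

open Classical in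
theorem sum_faces_subset_map (h : κ ↪ ι) (hface : ∀ s, s ∈ L'.faces ↔ s.map h ∈ L.faces) :
    ∑ σ : Finset ι with σ ∈ L.faces ∧ σ ⊆ Finset.univ.map h, (-1 : ℤ) ^ (σ.card - 1) =
      eulerChar L' := by
  have hmap : ({σ | σ ∈ L.faces ∧ σ ⊆ Finset.univ.map h} : Finset (Finset ι)) =
      ({s | s ∈ L'.faces} : Finset (Finset κ)).map (Finset.mapEmbedding h).toEmbedding := by
    ext σ
    simp only [Finset.mem_filter_univ, Finset.subset_map_iff, Finset.mem_map, hface,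
      Finset.subset_univ, true_and, RelEmbedding.coe_toEmbedding, Finset.mapEmbedding_apply]
    constructor
    · rintro ⟨hσ, s, rfl⟩
      exact ⟨s, hσ, rfl⟩
    · rintro ⟨s, hs, rfl⟩
      exact ⟨hs, s, rfl⟩
  simp only [hmap, Finset.sum_map, RelEmbedding.coe_toEmbedding, Finset.mapEmbedding_apply,
    Finset.card_map, eulerChar]

open Classical in
theorem eulerChar_eq_of_dominated (h : κ ↪ ι) (hface : ∀ s, s ∈ L'.faces ↔ s.map h ∈ L.faces)
    (hsub : (Set.range h)ᶜ.Subsingleton)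
    (hdom : ∀ v ∉ Set.range h, ∃ s ≠ v, ∀ σ ∈ L.faces, v ∈ σ → ∃ τ ∈ L.faces, σ ⊆ τ ∧ s ∈ τ) :
    eulerChar L' = eulerChar L := by
  rw [← sum_faces_subset_map h hface, eulerChar,
    ← Finset.sum_filter_add_sum_filter_not {σ | σ ∈ L.faces} (fun σ => σ ⊆ Finset.univ.map h),
    Finset.filter_filter, Finset.filter_filter, left_eq_add]
  have hmem (v : ι) : v ∈ Finset.univ.map h ↔ v ∈ Set.range h := by
    rw [← Finset.mem_coe, Finset.coe_map, Finset.coe_univ, Set.image_univ]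
  by_cases hr : ∃ r, r ∉ Set.range h
  · obtain ⟨r, hr⟩ := hr
    obtain ⟨s, hsr, hs⟩ := hdom r hr
    rw [← sum_faces_of_dominated hsr hs]
    refine Finset.sum_congr (Finset.filter_congr fun σ _ => and_congr_right fun _ => ?_)
      fun _ _ => rfl
    rw [Finset.not_subset]
    exact ⟨fun ⟨v, hv, hvr⟩ => hsub ((hmem v).not.1 hvr) hr ▸ hv,
      fun hrσ => ⟨r, hrσ, (hmem r).not.2 hr⟩⟩
  · push Not at hr
    exact Finset.sum_eq_zero fun σ hσ => absurd (fun v _ => (hmem v).2 (hr v))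
      (Finset.mem_filter.1 hσ).2.2

variable [DecidableEq ι] [DecidableEq κ] {f : κ → ι} {g : ι → κ}

theorem homotopyEquiv_and_eulerChar_eq_of_retraction (hgf : Function.LeftInverse g f)
    (hf : ∀ s ∈ L'.faces, s.image f ∈ L.faces) (hg : ∀ s ∈ L.faces, s.image g ∈ L'.faces)
    (hfg : ∀ s ∈ L.faces, s ∪ (s.image g).image f ∈ L.faces)
    (hsub : (Set.range f)ᶜ.Subsingleton) :
    Nonempty (ContinuousMap.HomotopyEquiv (Realization L') (Realization L)) ∧
      eulerChar L' = eulerChar L := by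
  have himage (s : Finset κ) : (s.image f).image g = s := by
    rw [Finset.image_image, hgf.comp_eq_id, Finset.image_id]
  refine ⟨nonempty_homotopyEquiv_of_contiguous f g hf hg (fun s hs => ?_) hfg,
    eulerChar_eq_of_dominated ⟨f, hgf.injective⟩ (fun s => ?_) hsub fun v hv =>
      ⟨f (g v), fun he => hv ⟨_, he⟩, fun σ hσ hvσ => ?_⟩⟩
  · rwa [himage, Finset.union_self]
  · rw [Finset.map_eq_image]
    exact ⟨hf s, fun hs => himage s ▸ hg _ hs⟩
  · exact ⟨_, hfg σ hσ, Finset.subset_union_left,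
      Finset.mem_union_right _ (Finset.mem_image_of_mem _ (Finset.mem_image_of_mem _ hvσ))⟩

end EulerCharacteristic

section ComplexVertex

variable {n : ℕ} {Y : Relations n}

theorem ComplexVertex.ext_start {v w : ComplexVertex Y} (h : v.1.start = w.1.start) : v = w :=
  Subtype.ext (start_injOn Y v.2.1 w.2.1 h)

variable [NeZero n]

theorem mem_rels_iff_gustafsonLift (p : CPath n) :
    p ∈ Y.rels ↔ p.start.val + p.len = gustafsonLift Y p.start.val ∧
      gustafsonLift Y p.start.val < gustafsonLift Y (p.start.val + 1) := by
  have hnext : gustafsonLift Y (p.start.val + 1) = p.start.val + 1 + Y.kupisch (next p.start) := by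
    rw [gustafsonLift, ← next_ofNat, Fin.ofNat_val_eq_self]
  rw [Y.mem_rels_iff, CPath.IsRelationFor, gustafsonLift_val, hnext]
  omega

theorem CPath.covers_iff_exists_ofNat (p : CPath n) (j : Fin n) :
    p.Covers j ↔ ∃ a, p.start.val < a ∧ a < p.start.val + p.len ∧ Fin.ofNat n a = j := by
  rw [CPath.covers_iff]
  constructor
  · rintro ⟨t, hpos, hlt, rfl⟩
    refine ⟨p.start.val + t, by omega, by omega, ?_⟩
    rw [← next_iterate_ofNat, Fin.ofNat_val_eq_self]
  · rintro ⟨a, hlt, hlt', rfl⟩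
    refine ⟨a - p.start.val, by omega, by omega, ?_⟩
    rw [← Nat.add_sub_cancel' hlt.le, ← next_iterate_ofNat, Fin.ofNat_val_eq_self,
      Nat.add_sub_cancel_left]

theorem ComplexVertex.covers_iff (v : ComplexVertex Y) (j : Fin n) :
    v.1.Covers j ↔ ∃ a, v.1.start.val < a ∧ a < gustafsonLift Y v.1.start.val ∧
      Fin.ofNat n a = j := by
  rw [CPath.covers_iff_exists_ofNat, ((mem_rels_iff_gustafsonLift v.1).1 v.2.1).1]

theorem ComplexVertex.gustafsonLift_lt (v : ComplexVertex Y) :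
    gustafsonLift Y v.1.start.val < gustafsonLift Y (v.1.start.val + 1) :=
  ((mem_rels_iff_gustafsonLift v.1).1 v.2.1).2

theorem ComplexVertex.gustafsonLift_le (v : ComplexVertex Y) :
    gustafsonLift Y v.1.start.val ≤ v.1.start.val + n := by
  rw [← ((mem_rels_iff_gustafsonLift v.1).1 v.2.1).1]
  exact Nat.add_le_add_left v.2.2 _

theorem exists_complexVertex_start_eq {i : Fin n}
    (hlt : gustafsonLift Y i.val < gustafsonLift Y (i.val + 1))
    (hle : gustafsonLift Y i.val ≤ i.val + n) : ∃ v : ComplexVertex Y, v.1.start = i := by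
  have hi := lt_gustafsonLift Y i.val
  exact ⟨⟨⟨i, gustafsonLift Y i.val - i.val⟩,
    (mem_rels_iff_gustafsonLift _).2 ⟨Nat.add_sub_cancel' hi.le, hlt⟩,
    Nat.sub_le_iff_le_add'.2 hle⟩, rfl⟩

end ComplexVertex

section DeletionComplex

variable {n : ℕ}

theorem eq_of_mem_Ico_skip {a b c : ℕ} (hb : c ∈ Set.Ico (skip n a) (skip n (a + 1)))
    (hb' : c ∈ Set.Ico (skip n b) (skip n (b + 1))) : a = b :=
  le_antisymm (Nat.lt_succ_iff.1 (skip_strictMono.lt_iff_lt.1 (hb.1.trans_lt hb'.2)))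
    (Nat.lt_succ_iff.1 (skip_strictMono.lt_iff_lt.1 (hb'.1.trans_lt hb.2)))

theorem lt_skip_iff_of_mem_Ico {a b c : ℕ} (h : b ∈ Set.Ico (skip n a) (skip n (a + 1))) :
    b < skip n c ↔ a < c :=
  ⟨fun hc => skip_strictMono.lt_iff_lt.1 (h.1.trans_lt hc),
    fun hc => h.2.trans_le (skip_strictMono.monotone hc)⟩

theorem exists_mem_Ico_eq_and_lt_succ {f : ℕ → ℕ} (hf : Monotone f) {a b : ℕ} (h : f a < f b) :
    ∃ c ∈ Set.Ico a b, f c = f a ∧ f c < f (c + 1) := by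
  obtain ⟨k, rfl⟩ := Nat.exists_eq_add_of_lt (hf.reflect_lt h)
  induction k with
  | zero => exact ⟨a, ⟨le_rfl, a.lt_succ_self⟩, rfl, h⟩
  | succ k ih =>
    rcases (hf (Nat.le_add_right a (k + 1))).eq_or_lt with heq | hlt
    · exact ⟨a + (k + 1), ⟨Nat.le_add_right _ _, Nat.lt_succ_self _⟩, heq.symm, heq.symm.trans_lt h⟩
    · obtain ⟨c, hc, hfc⟩ := ih hlt
      exact ⟨c, ⟨hc.1, hc.2.trans (Nat.lt_succ_self _)⟩, hfc⟩

theorem ComplexVertex.eq_of_start_ne_last {Y : Relations (n + 1)} {v w : ComplexVertex Y} {a : ℕ}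
    (hlast : v.1.start ≠ Fin.last n)
    (hv : v.1.start.val ∈ Set.Ico (skip n a) (skip n (a + 1)))
    (hw : w.1.start.val ∈ Set.Ico (skip n a) (skip n (a + 1)))
    (hG : gustafsonLift Y w.1.start.val = gustafsonLift Y (skip n a)) : w = v := by
  have hskip : skip n v.1.start.val = v.1.start.val := skip_of_lt (Fin.val_lt_last hlast)
  obtain rfl : v.1.start.val = a :=
    eq_of_mem_Ico_skip ⟨hskip.le, hskip.symm.trans_lt (skip_strictMono (Nat.lt_succ_self _))⟩ hv
  rw [hskip] at hG hw
  refine ComplexVertex.ext_start (Fin.ext (hw.1.eq_or_lt.resolve_right fun hlt => ?_).symm)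
  exact absurd (v.gustafsonLift_lt.trans_le (gustafsonLift_monotone Y hlt)) hG.not_gt

variable [NeZero n] {Y : Relations (n + 1)} {Y' : Relations n}

theorem skip_self : skip n n = n + 1 := by
  rw [skip, Nat.div_self (NeZero.pos n)]

theorem exists_mem_Ico_skip (i : Fin (n + 1)) :
    ∃ j : Fin n, i.val ∈ Set.Ico (skip n j.val) (skip n (j.val + 1)) := by
  have hn := NeZero.pos n
  induction i using Fin.lastCases with
  | cast j =>
    have hj := skip_of_lt j.isLt
    exact ⟨j, hj.le, hj.symm.trans_lt (skip_strictMono j.val.lt_succ_self)⟩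
  | last =>
    refine ⟨⟨n - 1, Nat.sub_one_lt hn.ne'⟩, (skip_of_lt (by omega)).trans_le (Nat.sub_le n 1), ?_⟩
    simp only [Fin.val_last, Nat.sub_add_cancel hn, skip_self, Nat.lt_succ_self]

theorem ComplexVertex.covers_castSucc_iff (v : ComplexVertex Y) (j : Fin n) :
    v.1.Covers j.castSucc ↔ ∃ a, v.1.start.val < skip n a ∧
      skip n a < gustafsonLift Y v.1.start.val ∧ Fin.ofNat n a = j := by
  rw [v.covers_iff]
  constructor
  · rintro ⟨b, hlt, hlt', hb⟩
    have hmod : b % (n + 1) ≠ n := (congrArg Fin.val hb).trans_ne j.isLt.ne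
    obtain ⟨a, rfl⟩ := exists_skip_eq hmod
    exact ⟨a, hlt, hlt', Fin.castSucc_injective _ ((ofNat_skip a).symm.trans hb)⟩
  · rintro ⟨a, hlt, hlt', rfl⟩
    exact ⟨skip n a, hlt, hlt', ofNat_skip a⟩

/-- A relation covering the vertex `n - 1` also covers the leaf `n`, since it cannot end there. -/
theorem mem_faces_iff_castSucc (hY : Fin.last n ∉ Set.range (gustafson Y))
    (s : Finset (ComplexVertex Y)) :
    s ∈ (relationComplex Y).faces ↔
      s.Nonempty ∧ ∃ j : Fin n, ∀ y ∈ s, ¬ y.val.Covers j.castSucc := by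
  refine and_congr_right fun _ => ⟨?_, fun ⟨j, hj⟩ => ⟨j.castSucc, hj⟩⟩
  rintro ⟨i, hi⟩
  induction i using Fin.lastCases with
  | cast j => exact ⟨j, hi⟩
  | last =>
    obtain ⟨m, rfl⟩ := Nat.exists_eq_succ_of_ne_zero (NeZero.ne n)
    refine ⟨Fin.last m, fun y hy hc => hi y hy ?_⟩
    obtain ⟨a, hlt, hlt', ha⟩ := y.covers_iff _ |>.1 hc
    have hlast : Fin.ofNat (m + 2) (a + 1) = Fin.last (m + 1) := by
      rw [← next_ofNat, ha]
      exact Fin.ext (Nat.mod_eq_of_lt (Nat.lt_succ_self _))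
    refine y.covers_iff _ |>.2
      ⟨a + 1, hlt.trans a.lt_succ_self, lt_of_le_of_ne hlt' fun he => ?_, hlast⟩
    exact gustafsonLift_mod_ne hY y.1.start.val (he ▸ congrArg Fin.val hlast)

theorem IsDeletion.exists_start_mem_Ico (h : IsDeletion Y Y'.kupisch) (v : ComplexVertex Y) :
    ∃ v' : ComplexVertex Y',
      v.1.start.val ∈ Set.Ico (skip n v'.1.start.val) (skip n (v'.1.start.val + 1)) := by
  obtain ⟨i, hi⟩ := exists_mem_Ico_skip v.1.start
  have hG : skip n (gustafsonLift Y' i.val) ≤ gustafsonLift Y v.1.start.val :=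
    (h.skip_gustafsonLift _).trans_le (gustafsonLift_monotone Y hi.1)
  have hlt : gustafsonLift Y' i.val < gustafsonLift Y' (i.val + 1) := by
    rw [← (skip_strictMono (n := n)).lt_iff_lt, h.skip_gustafsonLift (i.val + 1)]
    exact hG.trans_lt (v.gustafsonLift_lt.trans_le (gustafsonLift_monotone Y hi.2))
  have hle : gustafsonLift Y' i.val < i.val + 1 + n := by
    rw [← (skip_strictMono (n := n)).lt_iff_lt, skip_add_self]
    exact (hG.trans v.gustafsonLift_le).trans_lt (Nat.add_lt_add_right hi.2 _)
  obtain ⟨v', rfl⟩ := exists_complexVertex_start_eq hlt (by omega)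
  exact ⟨v', hi⟩

theorem IsDeletion.covers_castSucc (h : IsDeletion Y Y'.kupisch) {v : ComplexVertex Y}
    {v' : ComplexVertex Y'}
    (hv : v.1.start.val ∈ Set.Ico (skip n v'.1.start.val) (skip n (v'.1.start.val + 1)))
    {j : Fin n} (hj : v'.1.Covers j) : v.1.Covers j.castSucc := by
  obtain ⟨a, hlt, hlt', ha⟩ := (v'.covers_iff j).1 hj
  refine (v.covers_castSucc_iff j).2 ⟨a, (lt_skip_iff_of_mem_Ico hv).2 hlt, ?_, ha⟩
  calc skip n a < skip n (gustafsonLift Y' v'.1.start.val) := skip_strictMono hlt'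
    _ = gustafsonLift Y (skip n v'.1.start.val) := h.skip_gustafsonLift _
    _ ≤ gustafsonLift Y v.1.start.val := gustafsonLift_monotone Y hv.1

theorem IsDeletion.exists_mem_Ico_start (h : IsDeletion Y Y'.kupisch) (v' : ComplexVertex Y') :
    ∃ v : ComplexVertex Y,
      v.1.start.val ∈ Set.Ico (skip n v'.1.start.val) (skip n (v'.1.start.val + 1)) ∧
      gustafsonLift Y v.1.start.val = gustafsonLift Y (skip n v'.1.start.val) := by
  have hlt : gustafsonLift Y (skip n v'.1.start.val) <
      gustafsonLift Y (skip n (v'.1.start.val + 1)) := by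
    rw [← h.skip_gustafsonLift, ← h.skip_gustafsonLift]
    exact skip_strictMono v'.gustafsonLift_lt
  obtain ⟨b, hb, hG, hGlt⟩ := exists_mem_Ico_eq_and_lt_succ (gustafsonLift_monotone Y) hlt
  have hbn : b < n + 1 :=
    hb.2.trans_le ((skip_strictMono.monotone v'.1.start.isLt).trans_eq skip_self)
  have hle : gustafsonLift Y b ≤ b + (n + 1) := by
    calc gustafsonLift Y b = skip n (gustafsonLift Y' v'.1.start.val) := by
          rw [hG, h.skip_gustafsonLift]
      _ ≤ skip n (v'.1.start.val + n) := skip_strictMono.monotone v'.gustafsonLift_le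
      _ = skip n v'.1.start.val + (n + 1) := skip_add_self _
      _ ≤ b + (n + 1) := Nat.add_le_add_right hb.1 _
  obtain ⟨v, hv⟩ := exists_complexVertex_start_eq (Y := Y) (i := ⟨b, hbn⟩) hGlt hle
  rw [← Fin.val_mk hbn, ← hv] at hb hG
  exact ⟨v, hb, hG⟩

theorem IsDeletion.covers_castSucc_iff (h : IsDeletion Y Y'.kupisch) {v : ComplexVertex Y}
    {v' : ComplexVertex Y'}
    (hv : v.1.start.val ∈ Set.Ico (skip n v'.1.start.val) (skip n (v'.1.start.val + 1)))
    (hG : gustafsonLift Y v.1.start.val = gustafsonLift Y (skip n v'.1.start.val)) (j : Fin n) :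
    v.1.Covers j.castSucc ↔ v'.1.Covers j := by
  rw [v.covers_castSucc_iff, v'.covers_iff]
  refine exists_congr fun a => ?_
  rw [lt_skip_iff_of_mem_Ico hv, hG, ← h.skip_gustafsonLift, skip_strictMono.lt_iff_lt]

theorem IsDeletion.exists_retraction (h : IsDeletion Y Y'.kupisch) :
    ∃ (g : ComplexVertex Y → ComplexVertex Y') (f : ComplexVertex Y' → ComplexVertex Y),
      (∀ v j, (g v).1.Covers j → v.1.Covers j.castSucc) ∧
      (∀ v' j, (f v').1.Covers j.castSucc ↔ v'.1.Covers j) ∧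
      Function.LeftInverse g f ∧ (Set.range f)ᶜ.Subsingleton := by
  choose g hg using h.exists_start_mem_Ico
  choose f hf hG using h.exists_mem_Ico_start
  have hlast {v : ComplexVertex Y} (hv : v ∉ Set.range f) : v.1.start = Fin.last n :=
    not_not.1 fun hne => hv ⟨g v, v.eq_of_start_ne_last hne (hg v) (hf (g v)) (hG (g v))⟩
  exact ⟨g, f, fun v j => h.covers_castSucc (hg v),
    fun v' j => h.covers_castSucc_iff (hf v') (hG v') j,
    fun v' => ComplexVertex.ext_start (Fin.ext (eq_of_mem_Ico_skip (hg (f v')) (hf v'))),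
    fun v hv w hw => ComplexVertex.ext_start ((hlast hv).trans (hlast hw).symm)⟩

theorem IsDeletion.homotopyEquiv_and_eulerChar_eq (hY : Fin.last n ∉ Set.range (gustafson Y))
    (hd : IsDeletion Y Y'.kupisch) :
    Nonempty (ContinuousMap.HomotopyEquiv (Realization (relationComplex Y'))
      (Realization (relationComplex Y))) ∧
    eulerChar (relationComplex Y') = eulerChar (relationComplex Y) := by
  classical
  obtain ⟨g, f, hg, hf, hgf, hsub⟩ := hd.exists_retraction
  have hgface : ∀ s ∈ (relationComplex Y).faces, s.image g ∈ (relationComplex Y').faces := by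
    intro s hs
    obtain ⟨hne, j, hj⟩ := (mem_faces_iff_castSucc hY s).1 hs
    exact ⟨hne.image g, j, Finset.forall_mem_image.2 fun v hv hc => hj v hv (hg v j hc)⟩
  have hfface : ∀ s ∈ (relationComplex Y').faces, s.image f ∈ (relationComplex Y).faces := by
    rintro s ⟨hne, j, hj⟩
    exact ⟨hne.image f, j.castSucc,
      Finset.forall_mem_image.2 fun v hv hc => hj v hv ((hf v j).1 hc)⟩
  have hfg : ∀ s ∈ (relationComplex Y).faces,
      s ∪ (s.image g).image f ∈ (relationComplex Y).faces := by
    intro s hs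
    obtain ⟨hne, j, hj⟩ := (mem_faces_iff_castSucc hY s).1 hs
    refine ⟨hne.mono Finset.subset_union_left, j.castSucc, fun y hy hc => ?_⟩
    rw [Finset.image_image, Finset.mem_union, Finset.mem_image] at hy
    obtain hy | ⟨v, hv, rfl⟩ := hy
    · exact hj y hy hc
    · exact hj v hv (hg v j ((hf _ j).1 hc))
  exact homotopyEquiv_and_eulerChar_eq_of_retraction hgf hfface hgface hfg hsub

end DeletionComplex

section ProjectiveDimension

variable {R : Type u} [Ring R] {A B C : Type u} [AddCommGroup A] [Module R A] [AddCommGroup B]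
  [Module R B] [AddCommGroup C] [Module R C]

variable (R A) in
/-- The projective dimension of the `R`-module `A` is less than `d`, for unbundled modules. -/
def ProjDimLT (d : ℕ) : Prop := HasProjectiveDimensionLT (ModuleCat.of R A) d

theorem ProjDimLT.of_equiv (e : A ≃ₗ[R] B) {d : ℕ} (h : ProjDimLT R A d) : ProjDimLT R B d :=
  haveI : HasProjectiveDimensionLT (ModuleCat.of R A) d := h
  hasProjectiveDimensionLT_of_iso e.toModuleIso d

theorem ProjDimLT.mono {d d' : ℕ} (h : ProjDimLT R A d) (hd : d ≤ d') : ProjDimLT R A d' :=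
  haveI : HasProjectiveDimensionLT (ModuleCat.of R A) d := h
  hasProjectiveDimensionLT_of_ge _ d d' hd

theorem projDimLT_one_iff : ProjDimLT R A 1 ↔ Module.Projective R A :=
  projective_iff_hasProjectiveDimensionLT_one.symm.trans (IsProjective.iff_projective A).symm

theorem shortExact_of_exact {f : A →ₗ[R] B} {g : B →ₗ[R] C} (hf : Function.Injective f)
    (hg : Function.Surjective g) (hfg : Function.Exact f g) :
    (ShortComplex.mk (ModuleCat.ofHom f) (ModuleCat.ofHom g) (by
      rw [← ModuleCat.ofHom_comp, hfg.linearMap_comp_eq_zero]; rfl)).ShortExact where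
  exact := (ShortComplex.ShortExact.moduleCat_exact_iff_function_exact _).2 hfg
  mono_f := (ModuleCat.mono_iff_injective _).2 hf
  epi_g := (ModuleCat.epi_iff_surjective _).2 hg

theorem ProjDimLT.of_exact_middle {f : A →ₗ[R] B} {g : B →ₗ[R] C} (hf : Function.Injective f)
    (hg : Function.Surjective g) (hfg : Function.Exact f g) {d : ℕ} (hA : ProjDimLT R A d)
    (hC : ProjDimLT R C d) : ProjDimLT R B d :=
  (shortExact_of_exact hf hg hfg).hasProjectiveDimensionLT_X₂ d hA hC

theorem ProjDimLT.of_submodule_of_quotient (S : Submodule R A) {d : ℕ} (hS : ProjDimLT R S d)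
    (hQ : ProjDimLT R (A ⧸ S) d) : ProjDimLT R A d :=
  hS.of_exact_middle S.injective_subtype S.mkQ_surjective (LinearMap.exact_subtype_mkQ S) hQ

theorem projDimLT_right_iff {f : A →ₗ[R] B} {g : B →ₗ[R] C} (hf : Function.Injective f)
    (hg : Function.Surjective g) (hfg : Function.Exact f g) [Module.Projective R B] (d : ℕ) :
    ProjDimLT R C (d + 2) ↔ ProjDimLT R A (d + 1) :=
  (shortExact_of_exact hf hg hfg).hasProjectiveDimensionLT_X₃_iff d
    ((IsProjective.iff_projective B).1 inferInstance)

theorem globalDim_le_iff {A : Type u} [Ring A] (d : ℕ) :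
    globalDim A ≤ d ↔
      ∀ (M : Type u) [AddCommGroup M] [Module Aᵐᵒᵖ M], ProjDimLT Aᵐᵒᵖ M (d + 1) := by
  rw [globalDim, iSup_le_iff]
  exact ⟨fun h M _ _ => (projectiveDimension_le_iff _ d).1 (h (ModuleCat.of Aᵐᵒᵖ M)),
    fun h M => (projectiveDimension_le_iff _ d).2 (h M)⟩

theorem globalDim_ne_bot {A : Type u} [Ring A] [Nontrivial A] : globalDim A ≠ ⊥ := by
  intro h
  have hdim : projectiveDimension (ModuleCat.of Aᵐᵒᵖ A) = ⊥ :=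
    le_bot_iff.1 (h ▸ le_iSup (fun M : ModuleCat.{u} Aᵐᵒᵖ => projectiveDimension M) _)
  rw [projectiveDimension_eq_bot_iff, ModuleCat.isZero_iff_subsingleton] at hdim
  exact not_subsingleton A hdim

instance projective_finsupp {κ : Type u} [Module.Projective R A] :
    Module.Projective R (κ →₀ A) := by
  classical exact Module.Projective.of_equiv (finsuppLequivDFinsupp R).symm

theorem projDimLT_finsupp_quotient_iff [Module.Projective R A] (S : Submodule R A) (κ : Type u)
    (d : ℕ) : ProjDimLT R (κ →₀ A ⧸ S) (d + 2) ↔ ProjDimLT R (κ →₀ S) (d + 1) := by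
  refine projDimLT_right_iff (f := Finsupp.mapRange.linearMap S.subtype)
    (g := Finsupp.mapRange.linearMap S.mkQ)
    (Finsupp.mapRange_injective _ (map_zero _) S.injective_subtype)
    (Finsupp.mapRange_surjective _ (map_zero _) S.mkQ_surjective) ?_ d
  rw [LinearMap.exact_iff, Finsupp.ker_mapRange,
    Finsupp.range_mapRange_linearMap _ S.ker_subtype, S.ker_mkQ, S.range_subtype]

end ProjectiveDimension

section Hom

variable {R : Type u} [Ring R] {P : Type u} [AddCommGroup P] [Module R P] {M N : Type u}
  [AddCommGroup M] [Module R M] [AddCommGroup N] [Module R N] {κ : Type u}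

/-- `Hom(P, M)` as a right module over the endomorphism ring of `P`, acting by precomposition. -/
@[reducible]
def homModule : Module (Module.End R P)ᵐᵒᵖ (P →ₗ[R] M) :=
  inferInstanceAs (Module (Module.End R P)ᵈᵐᵃ (P →ₗ[R] M))

attribute [local instance] homModule

/-- The functor `Hom(P, -)` on homomorphisms. -/
def postcomp (g : M →ₗ[R] N) : (P →ₗ[R] M) →ₗ[(Module.End R P)ᵐᵒᵖ] (P →ₗ[R] N) where
  toFun f := g ∘ₗ f
  map_add' _ _ := LinearMap.comp_add _ _ _
  map_smul' _ _ := rfl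

@[simp]
theorem postcomp_apply (g : M →ₗ[R] N) (f : P →ₗ[R] M) : postcomp g f = g ∘ₗ f := rfl

theorem postcomp_injective {g : M →ₗ[R] N} (hg : Function.Injective g) :
    Function.Injective (postcomp (P := P) g) := fun _ _ h =>
  LinearMap.ext fun p => hg (LinearMap.congr_fun h p)

theorem postcomp_surjective [Module.Projective R P] {g : M →ₗ[R] N}
    (hg : Function.Surjective g) : Function.Surjective (postcomp (P := P) g) := fun f =>
  Module.projective_lifting_property g f hg

theorem postcomp_exact_subtype_ker (g : M →ₗ[R] N) :
    Function.Exact (postcomp (P := P) (LinearMap.ker g).subtype) (postcomp (P := P) g) := by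
  refine fun f => ⟨fun h => ⟨f.codRestrict _ (LinearMap.congr_fun h), rfl⟩, ?_⟩
  rintro ⟨f, rfl⟩
  exact LinearMap.ext fun p => (f p).2

theorem linearCombination_lsingle_apply (c : κ →₀ (Module.End R P)ᵐᵒᵖ) (p : P) (k : κ) :
    Finsupp.linearCombination (Module.End R P)ᵐᵒᵖ (Finsupp.lsingle : κ → P →ₗ[R] (κ →₀ P)) c p k =
      (c k).unop p := by
  classical
  induction c using Finsupp.induction_linear with
  | zero => rfl
  | add c c' hc hc' =>
    rw [map_add, LinearMap.add_apply, Finsupp.add_apply, hc, hc']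
    rfl
  | single j a =>
    rw [Finsupp.linearCombination_single]
    change Finsupp.single j (a.unop p) k = (Finsupp.single j a k).unop p
    rw [Finsupp.single_apply, Finsupp.single_apply]
    split_ifs <;> rfl

theorem exists_range_le_supported [Module.Finite R P] (f : P →ₗ[R] (κ →₀ M)) :
    ∃ s : Finset κ, LinearMap.range f ≤ Finsupp.supported M R s := by
  classical
  obtain ⟨t, ht⟩ := Module.Finite.fg_top (R := R) (M := P)
  refine ⟨t.biUnion fun p => (f p).support, ?_⟩
  rw [LinearMap.range_eq_map, ← ht, Submodule.map_span_le]
  exact fun p hp => (Finsupp.mem_supported _ _).2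
    (Finset.coe_subset.2 (Finset.subset_biUnion_of_mem (fun p => (f p).support) hp))

theorem span_range_lsingle [Module.Finite R P] :
    Submodule.span (Module.End R P)ᵐᵒᵖ
      (Set.range (Finsupp.lsingle : κ → P →ₗ[R] (κ →₀ P))) = ⊤ := by
  rw [← Finsupp.range_linearCombination, LinearMap.range_eq_top]
  intro f
  obtain ⟨s, hs⟩ := exists_range_le_supported f
  refine ⟨Finsupp.onFinset s (fun k => MulOpposite.op (Finsupp.lapply k ∘ₗ f)) fun k hk => ?_,
    LinearMap.ext fun p => Finsupp.ext fun k => linearCombination_lsingle_apply _ p k⟩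
  by_contra hks
  refine hk (MulOpposite.unop_injective (LinearMap.ext fun p => ?_))
  by_contra hp
  exact hks ((Finsupp.mem_supported R _).1 (hs ⟨p, rfl⟩) (Finsupp.mem_support_iff.2 hp))

/-- `Hom(P, P^(κ))` is a free right module over the endomorphism ring of a finitely generated
module `P`, with basis the canonical embeddings of `P`. -/
noncomputable def homBasis [Module.Finite R P] (κ : Type u) :
    Module.Basis κ (Module.End R P)ᵐᵒᵖ (P →ₗ[R] (κ →₀ P)) :=
  Module.Basis.mk (v := Finsupp.lsingle)
    (fun c c' h => Finsupp.ext fun k => MulOpposite.unop_injective (LinearMap.ext fun p => by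
      rw [← linearCombination_lsingle_apply, h, linearCombination_lsingle_apply]))
    span_range_lsingle.ge

theorem homBasis_apply [Module.Finite R P] (k : κ) :
    homBasis (R := R) (P := P) κ k = Finsupp.lsingle k :=
  Module.Basis.mk_apply _ _ k

instance projective_hom_finsupp [Module.Finite R P] :
    Module.Projective (Module.End R P)ᵐᵒᵖ (P →ₗ[R] (κ →₀ P)) :=
  .of_basis (homBasis κ)

variable (R P M) in
/-- The canonical homomorphism from a direct sum of copies of `P`, one for each homomorphism from
`P` to `M`. Its image is the trace of `P` in `M`, so it is surjective when `P` generates `M`. -/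
noncomputable def traceMap : ((P →ₗ[R] M) →₀ P) →ₗ[R] M := Finsupp.lsum ℕ id

theorem traceMap_comp_lsingle (f : P →ₗ[R] M) : traceMap R P M ∘ₗ Finsupp.lsingle f = f :=
  Finsupp.lsum_comp_lsingle ℕ id f

theorem range_le_range_traceMap (f : P →ₗ[R] M) :
    LinearMap.range f ≤ LinearMap.range (traceMap R P M) := by
  conv_lhs => rw [← traceMap_comp_lsingle f]
  exact LinearMap.range_comp_le_range _ _

theorem traceMap_surjective_of_finsupp {g : (κ →₀ P) →ₗ[R] M} (hg : Function.Surjective g) :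
    Function.Surjective (traceMap R P M) := by
  rw [← LinearMap.range_eq_top, eq_top_iff, ← LinearMap.range_eq_top.2 hg]
  rintro _ ⟨z, rfl⟩
  induction z using Finsupp.induction_linear with
  | zero => exact map_zero g ▸ zero_mem _
  | add x y hx hy => exact map_add g x y ▸ add_mem hx hy
  | single k p => exact range_le_range_traceMap (g ∘ₗ Finsupp.lsingle k) ⟨p, rfl⟩

theorem traceMap_range_surjective (g : (κ →₀ P) →ₗ[R] M) :
    Function.Surjective (traceMap R P (LinearMap.range g)) :=
  traceMap_surjective_of_finsupp g.surjective_rangeRestrict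

theorem hom_quotient_range_traceMap_eq_zero [Module.Projective R P]
    (f : P →ₗ[R] (M ⧸ LinearMap.range (traceMap R P M))) : f = 0 := by
  obtain ⟨g, rfl⟩ := Module.projective_lifting_property _ f
    (LinearMap.range (traceMap R P M)).mkQ_surjective
  exact LinearMap.ext fun p =>
    (Submodule.Quotient.mk_eq_zero _).2 (range_le_range_traceMap g ⟨p, rfl⟩)

theorem projDimLT_of_range_traceMap [Module.Projective R P] {d : ℕ}
    (hzero : ∀ (N : Type u) [AddCommGroup N] [Module R N], (∀ f : P →ₗ[R] N, f = 0) →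
      ProjDimLT R N d) (hM : ProjDimLT R (LinearMap.range (traceMap R P M)) d) :
    ProjDimLT R M d :=
  hM.of_submodule_of_quotient _ (hzero _ hom_quotient_range_traceMap_eq_zero)

theorem hom_ext_of_traceMap_surjective (hM : Function.Surjective (traceMap R P M))
    {g h : M →ₗ[R] N} (hgh : ∀ f : P →ₗ[R] M, g ∘ₗ f = h ∘ₗ f) : g = h := by
  refine (LinearMap.cancel_right hM).1 (Finsupp.lhom_ext' fun f => ?_)
  rw [LinearMap.comp_assoc, LinearMap.comp_assoc, traceMap_comp_lsingle, hgh]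

theorem exists_comp_eq_of_ker_le {L : Type u} [AddCommGroup L] [Module R L] {f : L →ₗ[R] M}
    (hf : Function.Surjective f) {g : L →ₗ[R] N} (h : LinearMap.ker f ≤ LinearMap.ker g) :
    ∃ s : M →ₗ[R] N, s ∘ₗ f = g := by
  refine ⟨(LinearMap.ker f).liftQ g h ∘ₗ (f.quotKerEquivOfSurjective hf).symm,
    LinearMap.ext fun x => ?_⟩
  rw [LinearMap.comp_apply, LinearMap.comp_apply, LinearEquiv.coe_coe,
    LinearMap.quotKerEquivOfSurjective_symm_apply, Submodule.liftQ_apply]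

section Finite

variable [Module.Finite R P]

theorem postcomp_lsum (f : κ → P →ₗ[R] M) {σ : (P →ₗ[R] M) →ₗ[(Module.End R P)ᵐᵒᵖ] (P →ₗ[R] N)}
    {f' : κ → P →ₗ[R] N} (hσ : ∀ k, σ (f k) = f' k) :
    postcomp (Finsupp.lsum ℕ f') = σ ∘ₗ postcomp (Finsupp.lsum ℕ f) := by
  refine (homBasis κ).ext fun k => ?_
  rw [homBasis_apply, LinearMap.comp_apply, postcomp_apply, postcomp_apply,
    Finsupp.lsum_comp_lsingle, Finsupp.lsum_comp_lsingle, hσ]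

/-- The two hypotheses say that `M` is presented by direct sums of copies of `P`. -/
theorem exists_postcomp_eq (hM : Function.Surjective (traceMap R P M))
    (hker : Function.Surjective (traceMap R P (LinearMap.ker (traceMap R P M))))
    (σ : (P →ₗ[R] M) →ₗ[(Module.End R P)ᵐᵒᵖ] (P →ₗ[R] N)) :
    ∃ s : M →ₗ[R] N, postcomp s = σ := by
  let s' : ((P →ₗ[R] M) →₀ P) →ₗ[R] N := Finsupp.lsum ℕ σ
  have hs' : postcomp s' = σ ∘ₗ postcomp (traceMap R P M) := postcomp_lsum id fun _ => rfl
  have hzero : s' ∘ₗ (LinearMap.ker (traceMap R P M)).subtype = 0 := by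
    refine hom_ext_of_traceMap_surjective hker fun f => ?_
    have hf := LinearMap.congr_fun hs' ((LinearMap.ker (traceMap R P M)).subtype ∘ₗ f)
    rwa [LinearMap.comp_apply, postcomp_apply, postcomp_apply, ← LinearMap.comp_assoc,
      ← LinearMap.comp_assoc, LinearMap.comp_ker_subtype, LinearMap.zero_comp, map_zero] at hf
  obtain ⟨s, hs⟩ := exists_comp_eq_of_ker_le hM (LinearMap.le_ker_iff_comp_subtype_eq_zero.2 hzero)
  refine ⟨s, LinearMap.ext fun f => ?_⟩
  rw [postcomp_apply, ← traceMap_comp_lsingle f, ← LinearMap.comp_assoc, hs,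
    Finsupp.lsum_comp_lsingle, traceMap_comp_lsingle]

theorem projective_hom [Module.Projective R M] (hM : Function.Surjective (traceMap R P M)) :
    Module.Projective (Module.End R P)ᵐᵒᵖ (P →ₗ[R] M) := by
  obtain ⟨s, hs⟩ := Module.projective_lifting_property (traceMap R P M) LinearMap.id hM
  refine Module.Projective.of_split (postcomp s) (postcomp (traceMap R P M))
    (LinearMap.ext fun f => ?_)
  rw [LinearMap.comp_apply, postcomp_apply, postcomp_apply, ← LinearMap.comp_assoc, hs]
  rfl

variable [Module.Projective R P]

theorem projective_of_projective_hom [Module.Projective (Module.End R P)ᵐᵒᵖ (P →ₗ[R] M)]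
    (hM : Function.Surjective (traceMap R P M))
    (hker : Function.Surjective (traceMap R P (LinearMap.ker (traceMap R P M)))) :
    Module.Projective R M := by
  obtain ⟨σ, hσ⟩ := Module.projective_lifting_property (postcomp (P := P) (traceMap R P M))
    LinearMap.id (postcomp_surjective hM)
  obtain ⟨s, rfl⟩ := exists_postcomp_eq hM hker σ
  exact Module.Projective.of_split s (traceMap R P M)
    (hom_ext_of_traceMap_surjective hM fun f => LinearMap.congr_fun hσ f)

theorem ker_postcomp_mkQ_range_lsum (V : Submodule (Module.End R P)ᵐᵒᵖ (P →ₗ[R] M)) :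
    LinearMap.ker (postcomp (LinearMap.range
      (Finsupp.lsum ℕ (fun f : V => (f : P →ₗ[R] M)))).mkQ) = V := by
  let g : (V →₀ P) →ₗ[R] M := Finsupp.lsum ℕ fun f : V => (f : P →ₗ[R] M)
  have hg (f : V) : g ∘ₗ Finsupp.lsingle f = f := Finsupp.lsum_comp_lsingle ℕ _ f
  refine le_antisymm (fun f hf => ?_) fun f hf => LinearMap.ext fun p => ?_
  · have hfg (p : P) : f p ∈ LinearMap.range g :=
      (Submodule.Quotient.mk_eq_zero _).1 (LinearMap.congr_fun hf p)
    obtain ⟨θ, hθ⟩ := Module.projective_lifting_property g.rangeRestrict (f.codRestrict _ hfg)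
      g.surjective_rangeRestrict
    have hfθ : f = postcomp g θ := congrArg ((LinearMap.range g).subtype ∘ₗ ·) hθ.symm
    have hrange : LinearMap.range (postcomp (P := P) g) ≤ V := by
      rw [LinearMap.range_eq_map, ← span_range_lsingle, Submodule.map_span_le]
      rintro _ ⟨k, rfl⟩
      rw [postcomp_apply, hg]
      exact k.2
    exact hrange ⟨θ, hfθ.symm⟩
  · exact (Submodule.Quotient.mk_eq_zero _).2 ⟨Finsupp.single ⟨f, hf⟩ p,
      LinearMap.congr_fun (hg ⟨f, hf⟩) p⟩

end Finite

end Hom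

section PresentedClass

variable (R : Type u) [Ring R] (P : Type u) [AddCommGroup P] [Module R P]

attribute [local instance] homModule

/-- A class of modules generated by `P` and containing the direct sums of copies of `P`, closed
under kernels, quotients by members of the class and submodules generated by `P`. On such a class
the functor `Hom(P, -)` preserves and reflects projective dimensions. -/
structure IsPresentedClass (T : ∀ (M : Type u) [AddCommGroup M] [Module R M], Prop) : Prop where
  finsupp : ∀ κ : Type u, T (κ →₀ P)
  traceMap_surjective : ∀ (M : Type u) [AddCommGroup M] [Module R M], T M →
    Function.Surjective (traceMap R P M)
  of_injective : ∀ (N M : Type u) [AddCommGroup N] [Module R N] [AddCommGroup M] [Module R M]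
    (i : N →ₗ[R] M), Function.Injective i → T M → Function.Surjective (traceMap R P N) → T N
  ker : ∀ (M N : Type u) [AddCommGroup M] [Module R M] [AddCommGroup N] [Module R N]
    (g : M →ₗ[R] N), T M → T N → T (LinearMap.ker g)
  quotient : ∀ (M : Type u) [AddCommGroup M] [Module R M] (N : Submodule R M), T N → T M →
    T (M ⧸ N)

variable {R P} {T : ∀ (M : Type u) [AddCommGroup M] [Module R M], Prop} [Module.Finite R P]
  [Module.Projective R P]

theorem IsPresentedClass.projDimLT_iff (hT : IsPresentedClass R P T) (d : ℕ) {M : Type u}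
    [AddCommGroup M] [Module R M] (hM : T M) :
    ProjDimLT R M (d + 1) ↔ ProjDimLT (Module.End R P)ᵐᵒᵖ (P →ₗ[R] M) (d + 1) := by
  induction d generalizing M with
  | zero =>
    have hsurj := hT.traceMap_surjective M hM
    have hker := hT.traceMap_surjective _ (hT.ker _ _ (traceMap R P M) (hT.finsupp _) hM)
    rw [zero_add, projDimLT_one_iff, projDimLT_one_iff]
    exact ⟨fun _ => projective_hom hsurj, fun _ => projective_of_projective_hom hsurj hker⟩
  | succ d ih =>
    have hsurj := hT.traceMap_surjective M hM
    have hinj := (LinearMap.ker (traceMap R P M)).injective_subtype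
    rw [projDimLT_right_iff hinj hsurj (LinearMap.exact_subtype_ker_map _),
      ih (hT.ker _ _ _ (hT.finsupp _) hM), projDimLT_right_iff (postcomp_injective hinj)
        (postcomp_surjective hsurj) (postcomp_exact_subtype_ker _)]

theorem IsPresentedClass.projDimLT_finsupp_quotient (hT : IsPresentedClass R P T) {d : ℕ}
    (h : ∀ (X : Type u) [AddCommGroup X] [Module (Module.End R P)ᵐᵒᵖ X],
      ProjDimLT (Module.End R P)ᵐᵒᵖ X (d + 1)) {B κ : Type u} [AddCommGroup B] [Module R B]
    [Module.Projective R B] {S : Submodule R B} (hS : T (κ →₀ S)) :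
    ProjDimLT R (κ →₀ B ⧸ S) (d + 2) :=
  (projDimLT_finsupp_quotient_iff S κ d).2 ((hT.projDimLT_iff d hS).2 (h _))

theorem IsPresentedClass.exists_hom_equiv (hT : IsPresentedClass R P T) (X : Type u)
    [AddCommGroup X] [Module (Module.End R P)ᵐᵒᵖ X] :
    ∃ (M : Type u) (_ : AddCommGroup M) (_ : Module R M), T M ∧
      Nonempty ((P →ₗ[R] M) ≃ₗ[(Module.End R P)ᵐᵒᵖ] X) := by
  let π : (P →ₗ[R] (X →₀ P)) →ₗ[(Module.End R P)ᵐᵒᵖ] X := (homBasis X).constr ℕ id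
  have hπ : Function.Surjective π := fun x => ⟨homBasis X x, (homBasis X).constr_basis _ _ _⟩
  let N : Submodule R (X →₀ P) := LinearMap.range
    (Finsupp.lsum ℕ fun f : LinearMap.ker π => (f : P →ₗ[R] (X →₀ P)))
  have hN : T N := hT.of_injective N _ N.subtype N.injective_subtype (hT.finsupp X)
    (traceMap_range_surjective _)
  refine ⟨(X →₀ P) ⧸ N, inferInstance, inferInstance, hT.quotient _ N hN (hT.finsupp X), ?_⟩
  exact ⟨((postcomp N.mkQ).quotKerEquivOfSurjective
    (postcomp_surjective N.mkQ_surjective)).symm.trans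
    ((Submodule.quotEquivOfEq _ _ (ker_postcomp_mkQ_range_lsum (LinearMap.ker π))).trans
      (π.quotKerEquivOfSurjective hπ))⟩

theorem IsPresentedClass.projDimLT_end (hT : IsPresentedClass R P T) {d : ℕ}
    (h : ∀ (M : Type u) [AddCommGroup M] [Module R M], ProjDimLT R M (d + 1)) (X : Type u)
    [AddCommGroup X] [Module (Module.End R P)ᵐᵒᵖ X] :
    ProjDimLT (Module.End R P)ᵐᵒᵖ X (d + 1) := by
  obtain ⟨M, _, _, hM, ⟨e⟩⟩ := hT.exists_hom_equiv X
  exact ((hT.projDimLT_iff d hM).1 (h M)).of_equiv e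

theorem IsPresentedClass.projDimLT_of_end (hT : IsPresentedClass R P T) {d : ℕ}
    (hzero : ∀ (N : Type u) [AddCommGroup N] [Module R N], (∀ f : P →ₗ[R] N, f = 0) →
      ProjDimLT R N (d + 2))
    (h : ∀ (X : Type u) [AddCommGroup X] [Module (Module.End R P)ᵐᵒᵖ X],
      ProjDimLT (Module.End R P)ᵐᵒᵖ X (d + 1)) (M : Type u) [AddCommGroup M] [Module R M] :
    ProjDimLT R M (d + 3) := by
  let Z := LinearMap.ker (traceMap R P M)
  have hZ : ProjDimLT R Z (d + 2) := by
    refine projDimLT_of_range_traceMap hzero (((hT.projDimLT_iff d ?_).2 (h _)).mono (by omega))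
    let Z₀ := LinearMap.range (traceMap R P Z)
    exact hT.of_injective Z₀ _ (Z.subtype ∘ₗ Z₀.subtype)
      (Z.injective_subtype.comp Z₀.injective_subtype) (hT.finsupp _) (traceMap_range_surjective _)
  refine projDimLT_of_range_traceMap (fun N _ _ hN => (hzero N hN).mono (by omega)) ?_
  have hexact : Function.Exact Z.subtype (traceMap R P M).rangeRestrict := by
    rw [LinearMap.exact_iff, LinearMap.ker_rangeRestrict, Submodule.range_subtype]
  exact (projDimLT_right_iff Z.injective_subtype (LinearMap.surjective_rangeRestrict _) hexact
    (d + 1)).2 hZ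

end PresentedClass

section ArrowBijective

variable {R : Type*} [Ring R]

/-- For idempotents `e`, `e'` and an element `a = e a e'` of `R`, multiplication by `a` is a
bijection from `e' M` to `e M`. Stated on elements of `M` itself, so that no idempotency is needed
to transfer the two halves along homomorphisms. -/
def ArrowBijective (e' e a : R) (M : Type*) [AddCommGroup M] [Module R M] : Prop :=
  (∀ m : M, a • m = 0 → e' • m = 0) ∧ ∀ m : M, ∃ m' : M, a • m' = e • m

variable {e' e a : R} {M N : Type*} [AddCommGroup M] [Module R M] [AddCommGroup N] [Module R N]

theorem ArrowBijective.of_injective_of_surjective {L : Type*} [AddCommGroup L] [Module R L]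
    (hM : ArrowBijective e' e a M) (hL : ArrowBijective e' e a L) {i : N →ₗ[R] M}
    (hi : Function.Injective i) {g : L →ₗ[R] N} (hg : Function.Surjective g) :
    ArrowBijective e' e a N := by
  refine ⟨fun m hm => hi ?_, fun m => ?_⟩
  · rw [map_zero, map_smul]
    exact hM.1 (i m) (by rw [← map_smul, hm, map_zero])
  · obtain ⟨x, rfl⟩ := hg m
    obtain ⟨y, hy⟩ := hL.2 x
    exact ⟨g y, by rw [← map_smul, hy, map_smul]⟩

theorem ArrowBijective.of_equiv (h : ArrowBijective e' e a M) (f : M ≃ₗ[R] N) :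
    ArrowBijective e' e a N :=
  h.of_injective_of_surjective h (i := f.symm.toLinearMap) f.symm.injective
    (g := f.toLinearMap) f.surjective

theorem ArrowBijective.pi {ι : Type*} {M : ι → Type*} [∀ i, AddCommGroup (M i)]
    [∀ i, Module R (M i)] (h : ∀ i, ArrowBijective e' e a (M i)) :
    ArrowBijective e' e a (∀ i, M i) := by
  refine ⟨fun m hm => funext fun i => (h i).1 (m i) (congrFun hm i), fun m => ?_⟩
  choose y hy using fun i => (h i).2 (m i)
  exact ⟨y, funext hy⟩

theorem ArrowBijective.finsupp (h : ArrowBijective e' e a M) (κ : Type*) :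
    ArrowBijective e' e a (κ →₀ M) := by
  refine ⟨fun m hm => Finsupp.ext fun k => h.1 (m k) (DFunLike.congr_fun hm k), fun m => ?_⟩
  induction m using Finsupp.induction_linear with
  | zero => exact ⟨0, by rw [smul_zero, smul_zero]⟩
  | add x y hx hy =>
    obtain ⟨x', hx⟩ := hx
    obtain ⟨y', hy⟩ := hy
    exact ⟨x' + y', by rw [smul_add, smul_add, hx, hy]⟩
  | single k x =>
    obtain ⟨x', hx⟩ := h.2 x
    exact ⟨Finsupp.single k x', by rw [Finsupp.smul_single, Finsupp.smul_single, hx]⟩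

theorem ArrowBijective.ker (hae : a * e' = a) (hM : ArrowBijective e' e a M)
    (hN : ArrowBijective e' e a N) (g : M →ₗ[R] N) :
    ArrowBijective e' e a (LinearMap.ker g) := by
  refine ⟨fun m hm => Subtype.ext (hM.1 m (congrArg Subtype.val hm)), fun m => ?_⟩
  obtain ⟨y, hy⟩ := hM.2 m
  have hgy : e' • g y = 0 := hN.1 _ (by rw [← map_smul, hy, map_smul, m.2, smul_zero])
  refine ⟨⟨e' • y, (map_smul g _ _).trans hgy⟩, Subtype.ext ?_⟩
  change a • e' • y = e • (m : M)
  rw [smul_smul, hae, hy]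

theorem ArrowBijective.quotient (hea : e * a = a) {S : Submodule R M}
    (hS : ArrowBijective e' e a S) (hM : ArrowBijective e' e a M) :
    ArrowBijective e' e a (M ⧸ S) := by
  refine ⟨fun m hm => ?_, fun m => ?_⟩ <;> obtain ⟨m, rfl⟩ := S.mkQ_surjective m
  · rw [← map_smul, Submodule.mkQ_apply, Submodule.Quotient.mk_eq_zero] at hm ⊢
    obtain ⟨y, hy⟩ := hS.2 ⟨a • m, hm⟩
    have hay : a • (y : M) = a • m := by
      rw [← S.coe_smul, hy, S.coe_smul, smul_smul, hea]
    have hsub : e' • (m - y) = 0 := hM.1 _ (by rw [smul_sub, hay, sub_self])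
    rw [smul_sub, sub_eq_zero] at hsub
    exact hsub ▸ S.smul_mem e' y.2
  · obtain ⟨y, hy⟩ := hM.2 m
    exact ⟨S.mkQ y, by rw [← map_smul, hy, map_smul]⟩

end ArrowBijective

section NakayamaModules

variable (K : Type u) [Field K] {n : ℕ}

section EvalMap

variable {Y : Relations n} {M : Type u} [AddCommGroup M] [Module (Alg K Y)ᵐᵒᵖ M]

/-- The homomorphism from `P_i` to `M` sending `e_i` to `m e_i`. -/
noncomputable def evalMap (i : Fin n) (m : M) : proj K Y i →ₗ[(Alg K Y)ᵐᵒᵖ] M where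
  toFun p := MulOpposite.op (p : Alg K Y) • m
  map_add' p q := by rw [Submodule.coe_add, MulOpposite.op_add, add_smul]
  map_smul' r p := by
    rw [RingHom.id_apply, smul_smul]
    rfl

theorem evalMap_apply (i : Fin n) (m : M) (p : proj K Y i) :
    evalMap K i m p = MulOpposite.op (p : Alg K Y) • m := rfl

theorem evalMap_projPath_zero (i : Fin n) (m : M) :
    evalMap K i m (projPath K Y i 0) = MulOpposite.op (idem K Y i) • m := rfl

instance projective_proj (i : Fin n) : Module.Projective (Alg K Y)ᵐᵒᵖ (proj K Y i) := by
  refine Module.Projective.of_lifting_property'' fun f hf => ?_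
  obtain ⟨x, hx⟩ := hf (projPath K Y i 0)
  refine ⟨evalMap K i x, LinearMap.ext fun p => ?_⟩
  rw [LinearMap.comp_apply, evalMap_apply, map_smul, hx]
  exact Subtype.ext (proj_idem_mul p)

end EvalMap

variable {Y : Relations (n + 1)}

instance projective_pPrime : Module.Projective (Alg K Y)ᵐᵒᵖ (PPrime K Y) :=
  Module.Projective.of_equiv (DFinsupp.linearEquivFunOnFintype (R := (Alg K Y)ᵐᵒᵖ)
    (M := fun j : Fin n => proj K Y j.castSucc))

instance finite_pPrime : Module.Finite (Alg K Y)ᵐᵒᵖ (PPrime K Y) := by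
  have (j : Fin n) : Module.Finite (Alg K Y)ᵐᵒᵖ (proj K Y j.castSucc) :=
    Module.Finite.of_fg (Submodule.fg_span_singleton _)
  infer_instance

instance nontrivial_alg : Nontrivial (Alg K Y) := by
  refine ⟨idem K Y 0, 0, fun h => ?_⟩
  rw [idem, pathClass_eq_zero_iff, Y.kills_mk_iff] at h
  exact absurd (Y.kupisch_pos 0) (by omega)

instance nontrivial_endAlg [NeZero n] : Nontrivial (EndAlg K Y) := by
  have hgen : genPPrime K Y 0 ≠ 0 := by
    intro h
    have hpath := congrFun h 0
    rw [genPPrime, Pi.single_eq_same, Pi.zero_apply, projPath_eq_zero_iff] at hpath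
    exact absurd (Y.kupisch_pos (0 : Fin n).castSucc) (by omega)
  exact ⟨1, 0, fun h => hgen (LinearMap.congr_fun h (genPPrime K Y 0))⟩

section Module

variable {M : Type u} [AddCommGroup M] [Module (Alg K Y)ᵐᵒᵖ M]

theorem sum_op_idem_castSucc_smul_add (m : M) :
    ∑ i : Fin n, MulOpposite.op (idem K Y i.castSucc) • m +
      MulOpposite.op (idem K Y (Fin.last n)) • m = m := by
  rw [← Fin.sum_univ_castSucc (f := fun i => MulOpposite.op (idem K Y i) • m), ← Finset.sum_smul,
    ← Finset.op_sum, sum_idem, MulOpposite.op_one, one_smul]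

theorem op_idem_smul_eq_evalMap (m : M) (j : Fin n) :
    MulOpposite.op (idem K Y j.castSucc) • m =
      (evalMap K j.castSucc m ∘ₗ LinearMap.proj j) (genPPrime K Y j) := by
  rw [LinearMap.comp_apply, LinearMap.proj_apply, genPPrime, Pi.single_eq_same,
    evalMap_projPath_zero]

theorem op_idem_smul_mem_range_traceMap (m : M) (j : Fin n) :
    MulOpposite.op (idem K Y j.castSucc) • m ∈
      LinearMap.range (traceMap (Alg K Y)ᵐᵒᵖ (PPrime K Y) M) := by
  rw [op_idem_smul_eq_evalMap]
  exact range_le_range_traceMap _ ⟨_, rfl⟩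

end Module

end NakayamaModules

section LeafClass

variable {n : ℕ}

variable (n) in
/-- The vertex before the last one. -/
def penult : Fin (n + 1) := ⟨n - 1, by omega⟩

theorem next_penult : next (penult n) = Fin.last n := by
  refine Fin.ext ?_
  rcases n with _ | n
  · rfl
  · exact Nat.mod_eq_of_lt (Nat.lt_succ_self _)

theorem exists_castSucc_eq_penult [NeZero n] : ∃ j : Fin n, j.castSucc = penult n :=
  ⟨⟨n - 1, Nat.sub_one_lt (NeZero.ne n)⟩, rfl⟩

theorem next_last_ne [NeZero n] : next (Fin.last n) ≠ Fin.last n := by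
  intro h
  have hval := congrArg Fin.val h
  simp only [next, Fin.val_last, Nat.mod_self] at hval
  exact NeZero.ne n hval.symm

variable (K : Type u) [Field K] (Y : Relations (n + 1))

/-- The arrow ending at the last vertex. -/
noncomputable def lastArrow : Alg K Y := pathClass K Y ⟨penult n, 1⟩

theorem idem_mul_lastArrow : idem K Y (penult n) * lastArrow K Y = lastArrow K Y :=
  idem_mul_pathClass K Y ⟨penult n, 1⟩

theorem lastArrow_mul_idem : lastArrow K Y * idem K Y (Fin.last n) = lastArrow K Y := by
  rw [← next_penult]
  exact pathClass_mul_idem K Y ⟨penult n, 1⟩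

/-- The class of modules on which the arrow ending at the last vertex acts bijectively. When this
vertex is a leaf, these are the modules presented by direct sums of copies of `P'`. -/
def LeafClass (M : Type u) [AddCommGroup M] [Module (Alg K Y)ᵐᵒᵖ M] : Prop :=
  ArrowBijective (MulOpposite.op (idem K Y (penult n))) (MulOpposite.op (idem K Y (Fin.last n)))
    (MulOpposite.op (lastArrow K Y)) M

theorem pathClass_mul_lastArrow (i : Fin (n + 1)) (l : ℕ) (h : next^[l] i = penult n) :
    pathClass K Y ⟨i, l⟩ * lastArrow K Y = pathClass K Y ⟨i, l + 1⟩ := by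
  rw [lastArrow, ← h, pathClass_mul_mk]

variable {K Y}

/-- A path ending at the last vertex is trivial or ends with the last arrow. -/
theorem exists_mul_idem_last_eq (y : Alg K Y) :
    ∃ (c : K) (z : Alg K Y),
      y * idem K Y (Fin.last n) = c • idem K Y (Fin.last n) + z * lastArrow K Y := by
  induction y using Alg.induction_on with
  | zero => exact ⟨0, 0, by rw [zero_mul, zero_mul, zero_smul, add_zero]⟩
  | add y y' h h' =>
    obtain ⟨c, z, h⟩ := h
    obtain ⟨c', z', h'⟩ := h'
    exact ⟨c + c', z + z', by rw [add_mul, h, h', add_smul, add_mul, add_add_add_comm]⟩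
  | smul c q =>
    by_cases hq : q.target = Fin.last n
    · rw [smul_mul_assoc, ← hq, pathClass_mul_idem, hq]
      obtain ⟨i, _ | l⟩ := q
      · obtain rfl : i = Fin.last n := hq
        exact ⟨c, 0, by rw [zero_mul, add_zero, idem]⟩
      · have hl : next^[l] i = penult n := next_injective (by
          rw [next_penult, ← hq, CPath.target, Function.iterate_succ_apply'])
        exact ⟨0, c • pathClass K Y ⟨i, l⟩, by
          rw [zero_smul, zero_add, smul_mul_assoc, pathClass_mul_lastArrow K Y i l hl]⟩
    · exact ⟨0, 0, by
        rw [smul_mul_assoc, idem, pathClass_mul_of_ne K Y q _ hq, smul_zero, zero_smul, zero_mul,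
          add_zero]⟩

variable (K Y) in
/-- The linear endomorphism of `Λ` removing the last arrow of every path. -/
noncomputable def dropLast : Alg K Y →ₗ[K] Alg K Y :=
  (pathBasis K Y).constr K fun q => pathClass K Y ⟨q.1.start, q.1.len - 1⟩

theorem dropLast_pathClass {q : CPath (n + 1)} (hq : ¬ Y.Kills q) :
    dropLast K Y (pathClass K Y q) = pathClass K Y ⟨q.start, q.len - 1⟩ := by
  rw [← pathBasis_apply K Y ⟨q, hq⟩, dropLast, Module.Basis.constr_basis]

theorem not_kills_succ_of_target_eq_penult (hY : Fin.last n ∉ Set.range (gustafson Y))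
    {i : Fin (n + 1)} {l : ℕ} (hl : ¬ Y.Kills ⟨i, l⟩) (htarget : next^[l] i = penult n) :
    ¬ Y.Kills ⟨i, l + 1⟩ := by
  rw [Y.kills_mk_iff] at hl ⊢
  intro hle
  have hkup : Y.kupisch i = l + 1 := by omega
  refine hY ⟨i, ?_⟩
  rw [gustafson, hkup, Function.iterate_succ_apply', htarget, next_penult]

theorem dropLast_mul_lastArrow (hY : Fin.last n ∉ Set.range (gustafson Y)) (y : Alg K Y) :
    dropLast K Y (y * lastArrow K Y) = y * idem K Y (penult n) := by
  induction y using Alg.induction_on with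
  | zero => rw [zero_mul, zero_mul, map_zero]
  | add y y' h h' => rw [add_mul, add_mul, map_add, h, h']
  | smul c q =>
    rw [smul_mul_assoc, smul_mul_assoc, map_smul]
    congr 1
    by_cases hkills : Y.Kills q
    · rw [pathClass_eq_zero hkills, zero_mul, zero_mul, map_zero]
    by_cases hq : q.target = penult n
    · rw [pathClass_mul_lastArrow K Y q.start q.len hq,
        dropLast_pathClass (not_kills_succ_of_target_eq_penult hY hkills hq), ← hq,
        pathClass_mul_idem]
      rfl
    · rw [idem, lastArrow, pathClass_mul_of_ne K Y q ⟨penult n, 0⟩ hq,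
        pathClass_mul_of_ne K Y q ⟨penult n, 1⟩ hq, map_zero]

theorem mul_idem_penult_eq_zero (hY : Fin.last n ∉ Set.range (gustafson Y)) {y : Alg K Y}
    (hy : y * lastArrow K Y = 0) : y * idem K Y (penult n) = 0 := by
  rw [← dropLast_mul_lastArrow hY, hy, map_zero]

theorem leafClass_projFil (hY : Fin.last n ∉ Set.range (gustafson Y)) {i : Fin (n + 1)} {l : ℕ}
    (hl : next^[l] i ≠ Fin.last n) : LeafClass K Y (projFil K Y i l) := by
  refine ⟨fun x hx => Subtype.ext (Subtype.ext (mul_idem_penult_eq_zero hY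
    (congrArg (fun x : projFil K Y i l => (x : Alg K Y)) hx))), fun x => ?_⟩
  obtain ⟨y, hy⟩ := (mem_projFil_iff K Y i l _).1 x.2
  obtain ⟨c, z, hz⟩ := exists_mul_idem_last_eq y
  have hzero : pathClass K Y ⟨i, l⟩ * idem K Y (Fin.last n) = 0 :=
    pathClass_mul_of_ne K Y ⟨i, l⟩ ⟨Fin.last n, 0⟩ hl
  have hproj : pathClass K Y ⟨i, l⟩ * z ∈ proj K Y i := by
    rw [mem_proj_iff, ← mul_assoc, idem_mul_pathClass K Y ⟨i, l⟩]
  refine ⟨⟨⟨_, hproj⟩, (mem_projFil_iff K Y i l _).2 ⟨z, rfl⟩⟩, Subtype.ext (Subtype.ext ?_)⟩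
  change pathClass K Y ⟨i, l⟩ * z * lastArrow K Y = x * idem K Y (Fin.last n)
  rw [← hy, mul_assoc _ y, hz, mul_add, mul_smul_comm, hzero, smul_zero, zero_add, mul_assoc]

theorem leafClass_pPrime (hY : Fin.last n ∉ Set.range (gustafson Y)) :
    LeafClass K Y (PPrime K Y) :=
  ArrowBijective.pi fun j => (leafClass_projFil hY (l := 0) (Fin.castSucc_lt_last j).ne).of_equiv
    (LinearEquiv.ofTop _ (projFil_zero K Y j.castSucc))

variable [NeZero n]

theorem traceMap_surjective_of_leafClass {M : Type u} [AddCommGroup M] [Module (Alg K Y)ᵐᵒᵖ M]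
    (hM : LeafClass K Y M) : Function.Surjective (traceMap (Alg K Y)ᵐᵒᵖ (PPrime K Y) M) := by
  rw [← LinearMap.range_eq_top, eq_top_iff]
  rintro m -
  rw [← sum_op_idem_castSucc_smul_add K (Y := Y) m]
  refine add_mem (Submodule.sum_mem _ fun j _ => op_idem_smul_mem_range_traceMap K m j) ?_
  obtain ⟨y, hy⟩ := hM.2 m
  obtain ⟨j, hj⟩ := exists_castSucc_eq_penult (n := n)
  rw [← hy, ← idem_mul_lastArrow, MulOpposite.op_mul, mul_smul, ← hj]
  exact Submodule.smul_mem _ _ (op_idem_smul_mem_range_traceMap K y j)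

theorem isPresentedClass_leafClass (hY : Fin.last n ∉ Set.range (gustafson Y)) :
    IsPresentedClass (Alg K Y)ᵐᵒᵖ (PPrime K Y) (LeafClass K Y) where
  finsupp κ := (leafClass_pPrime hY).finsupp κ
  traceMap_surjective _ _ _ hM := traceMap_surjective_of_leafClass hM
  of_injective _ _ _ _ _ _ _ hi hM hN :=
    hM.of_injective_of_surjective ((leafClass_pPrime hY).finsupp _) hi hN
  ker _ _ _ _ _ _ g hM hN :=
    hM.ker (by rw [← MulOpposite.op_mul, idem_mul_lastArrow]) hN g
  quotient _ _ _ _ hS hM :=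
    ArrowBijective.quotient (by rw [← MulOpposite.op_mul, lastArrow_mul_idem]) hS hM

end LeafClass

section Isotypic

variable {R M S : Type u} [Ring R] [AddCommGroup M] [Module R M] [AddCommGroup S] [Module R S]

theorem exists_linearEquiv_finsupp_of_span_singleton [IsSimpleModule R S]
    (h : ∀ m : M, m ≠ 0 → Nonempty (Submodule.span R {m} ≃ₗ[R] S)) :
    ∃ ι : Type u, Nonempty (M ≃ₗ[R] ι →₀ S) := by
  have : IsSemisimpleModule R M := by
    refine .of_sSup_simples_eq_top (eq_top_iff.2 fun m _ => ?_)
    by_cases hm : m = 0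
    · exact hm ▸ zero_mem _
    · obtain ⟨e⟩ := h m hm
      have hsimple : Submodule.span R {m} ∈ {T : Submodule R M | IsSimpleModule R T} := .congr e
      exact le_sSup hsimple (Submodule.mem_span_singleton_self m)
  refine IsIsotypicOfType.linearEquiv_finsupp fun T _ => ?_
  obtain ⟨m, hmT, hm⟩ := T.exists_mem_ne_zero_of_ne_bot
    (Submodule.nontrivial_iff_ne_bot.1 (IsSimpleModule.nontrivial R T))
  have hspan : Submodule.span R {m} = T :=
    ((isSimpleModule_iff_isAtom.1 ‹_›).le_iff_eq (by simpa using hm)).1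
      ((Submodule.span_singleton_le_iff_mem m T).2 hmT)
  exact hspan ▸ h m hm

end Isotypic

section Leaf

variable {K : Type u} [Field K] {n : ℕ} {Y : Relations (n + 1)}
  {M : Type u} [AddCommGroup M] [Module (Alg K Y)ᵐᵒᵖ M]

instance isSimpleModule_simpleAt {m : ℕ} {X : Relations m} (i : Fin m) :
    IsSimpleModule (Alg K X)ᵐᵒᵖ (SimpleAt K X i) := by
  rw [isSimpleModule_iff_isCoatom, jacobson_proj]
  exact isCoatom_projFil_one K X i

theorem op_idem_castSucc_smul_eq_zero (hM : ∀ f : PPrime K Y →ₗ[(Alg K Y)ᵐᵒᵖ] M, f = 0)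
    (j : Fin n) (m : M) : MulOpposite.op (idem K Y j.castSucc) • m = 0 := by
  rw [op_idem_smul_eq_evalMap, hM (evalMap K j.castSucc m ∘ₗ LinearMap.proj j),
    LinearMap.zero_apply]

theorem op_idem_last_smul (hM : ∀ f : PPrime K Y →ₗ[(Alg K Y)ᵐᵒᵖ] M, f = 0) (m : M) :
    MulOpposite.op (idem K Y (Fin.last n)) • m = m := by
  conv_rhs => rw [← sum_op_idem_castSucc_smul_add K (Y := Y) m]
  rw [Finset.sum_eq_zero fun j _ => op_idem_castSucc_smul_eq_zero hM j m, zero_add]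

theorem range_evalMap_last (hM : ∀ f : PPrime K Y →ₗ[(Alg K Y)ᵐᵒᵖ] M, f = 0) (m : M) :
    LinearMap.range (evalMap (Y := Y) K (Fin.last n) m) =
      Submodule.span (Alg K Y)ᵐᵒᵖ {m} := by
  refine le_antisymm ?_ ((Submodule.span_singleton_le_iff_mem _ _).2
    ⟨projPath K Y (Fin.last n) 0, op_idem_last_smul hM m⟩)
  rintro _ ⟨p, rfl⟩
  exact Submodule.smul_mem _ _ (Submodule.mem_span_singleton_self m)

variable [NeZero n]

theorem ker_evalMap_last (hM : ∀ f : PPrime K Y →ₗ[(Alg K Y)ᵐᵒᵖ] M, f = 0) {m : M}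
    (hm : m ≠ 0) : LinearMap.ker (evalMap (Y := Y) K (Fin.last n) m) =
      Module.jacobson (Alg K Y)ᵐᵒᵖ (proj K Y (Fin.last n)) := by
  rw [jacobson_proj]
  have hle : projFil K Y (Fin.last n) 1 ≤ LinearMap.ker (evalMap K (Fin.last n) m) := by
    obtain ⟨j, hj⟩ : ∃ j : Fin n, j.castSucc = next (Fin.last n) :=
      ⟨(next (Fin.last n)).castPred next_last_ne, Fin.castSucc_castPred _ _⟩
    have harrow := pathClass_mul_idem K Y ⟨Fin.last n, 1⟩
    rw [projFil_le_iff, LinearMap.mem_ker, evalMap_apply, coe_projPath, ← harrow,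
      MulOpposite.op_mul, mul_smul, CPath.target, Function.iterate_one, ← hj,
      op_idem_castSucc_smul_eq_zero hM]
  refine ((isCoatom_projFil_one K Y (Fin.last n)).le_iff.1 hle).resolve_left fun htop => hm ?_
  rw [← op_idem_last_smul hM m, ← evalMap_projPath_zero, ← LinearMap.mem_ker, htop]
  exact Submodule.mem_top

theorem exists_linearEquiv_finsupp_simpleAt_last
    (hM : ∀ f : PPrime K Y →ₗ[(Alg K Y)ᵐᵒᵖ] M, f = 0) :
    ∃ κ : Type u, Nonempty (M ≃ₗ[(Alg K Y)ᵐᵒᵖ] κ →₀ SimpleAt K Y (Fin.last n)) :=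
  exists_linearEquiv_finsupp_of_span_singleton fun m hm =>
    ⟨(LinearEquiv.ofEq _ _ (range_evalMap_last hM m)).symm.trans
      ((evalMap K (Fin.last n) m).quotKerEquivRange.symm.trans
        (Submodule.quotEquivOfEq _ _ (ker_evalMap_last hM hm)))⟩

theorem projDimLT_of_hom_pPrime_eq_zero (hY : Fin.last n ∉ Set.range (gustafson Y)) {d : ℕ}
    (h : ∀ (X : Type u) [AddCommGroup X] [Module (EndAlg K Y)ᵐᵒᵖ X],
      ProjDimLT (EndAlg K Y)ᵐᵒᵖ X (d + 1))
    (hM : ∀ f : PPrime K Y →ₗ[(Alg K Y)ᵐᵒᵖ] M, f = 0) : ProjDimLT (Alg K Y)ᵐᵒᵖ M (d + 2) := by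
  obtain ⟨κ, ⟨e⟩⟩ := exists_linearEquiv_finsupp_simpleAt_last hM
  have hrad : LeafClass K Y (projFil K Y (Fin.last n) 1) := leafClass_projFil hY next_last_ne
  rw [← jacobson_proj] at hrad
  exact ((isPresentedClass_leafClass hY).projDimLT_finsupp_quotient h (hrad.finsupp κ)).of_equiv
    e.symm

end Leaf

section GlobalDimension

theorem le_add_of_forall_natCast_le {x y : WithBot ℕ∞} (hx : x ≠ ⊥) (k : ℕ)
    (h : ∀ d : ℕ, x ≤ d → y ≤ (d + k : ℕ)) : y ≤ x + k := by
  induction x with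
  | bot => exact absurd rfl hx
  | coe x =>
    induction x with
    | top => exact le_top
    | coe d => exact h d le_rfl

theorem add_natCast_lt_top {x : WithBot ℕ∞} (hx : x < ⊤) (k : ℕ) : x + k < ⊤ := by
  induction x with
  | bot => exact hx
  | coe x =>
    induction x with
    | top => exact absurd hx (lt_irrefl _)
    | coe d => exact WithBot.coe_lt_coe.2 (ENat.natCast_lt_top (d + k))

variable (K : Type u) [Field K] {n : ℕ} {Y : Relations (n + 1)} [NeZero n]

theorem globalDim_endAlg_le (hY : Fin.last n ∉ Set.range (gustafson Y)) :
    globalDim (EndAlg K Y) ≤ globalDim (Alg K Y) := by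
  have hle : globalDim (EndAlg K Y) ≤ globalDim (Alg K Y) + (0 : ℕ) :=
    le_add_of_forall_natCast_le globalDim_ne_bot 0 fun d hd => (globalDim_le_iff d).2 fun X _ _ =>
      (isPresentedClass_leafClass hY).projDimLT_end ((globalDim_le_iff d).1 hd) X
  rwa [Nat.cast_zero, add_zero] at hle

theorem globalDim_alg_le (hY : Fin.last n ∉ Set.range (gustafson Y)) :
    globalDim (Alg K Y) ≤ globalDim (EndAlg K Y) + 2 :=
  le_add_of_forall_natCast_le globalDim_ne_bot 2 fun d hd =>
    have hend := (globalDim_le_iff (A := EndAlg K Y) d).1 hd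
    (globalDim_le_iff (d + 2)).2 fun M _ _ =>
      (isPresentedClass_leafClass hY).projDimLT_of_end
        (fun _ _ _ => projDimLT_of_hom_pPrime_eq_zero hY hend) hend M

end GlobalDimension

end Nakayama

open Nakayama in
theorem mainTheorem3 (K : Type u) [Field K] (n : ℕ) (Y : Relations (n + 1))
    (hleaf : IsLeaf (resolutionQuiver K Y) (Fin.last n)) :
    (∃ (Y' : Relations n) (φ : EndAlg K Y ≃ₐ[K] Alg K Y'), IsPresentation K Y Y' φ) ∧
    (∀ (Y' : Relations n) (φ : EndAlg K Y ≃ₐ[K] Alg K Y'), IsPresentation K Y Y' φ →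
      ((∀ i j : Fin n, (resolutionQuiver K Y').Adj i j ↔
          (resolutionQuiver K Y).Adj i.castSucc j.castSucc) ∧
        Nat.card (Component (resolutionQuiver K Y')) =
          Nat.card (Component (resolutionQuiver K Y)) ∧
        Nat.card {i // ¬ OnCycle (resolutionQuiver K Y') i} + 1 =
          Nat.card {i // ¬ OnCycle (resolutionQuiver K Y) i}) ∧
      (∃ w : ℚ, HasWeight K Y w ∧ HasWeight K Y' w) ∧
      (Nonempty (ContinuousMap.HomotopyEquiv (Realization (relationComplex Y'))
          (Realization (relationComplex Y))) ∧
        eulerChar (relationComplex Y') = eulerChar (relationComplex Y))) ∧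
    (globalDim (EndAlg K Y) ≤ globalDim (Alg K Y) ∧
      globalDim (Alg K Y) ≤ globalDim (EndAlg K Y) + 2 ∧
      (globalDim (Alg K Y) < ⊤ ↔ globalDim (EndAlg K Y) < ⊤)) := by
  have hY : Fin.last n ∉ Set.range (gustafson Y) := (isLeaf_iff_notMem_range K Y _).1 hleaf
  have : NeZero n := ⟨by
    rintro rfl
    exact hY ⟨0, Subsingleton.elim (α := Fin 1) _ _⟩⟩
  have hEnd := globalDim_endAlg_le K hY
  have hAlg := globalDim_alg_le K hY
  refine ⟨?_, fun Y' φ hφ => ?_, hEnd, hAlg, hEnd.trans_lt,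
    fun h => hAlg.trans_lt (add_natCast_lt_top h 2)⟩
  · obtain ⟨Y', hd⟩ := exists_isDeletion hY
    exact ⟨Y', exists_presentation_of_isDeletion K hd⟩
  · have hd := IsPresentation.isDeletion K hY hφ
    refine ⟨⟨hd.resolutionQuiver_adj_iff K, ?_⟩, hd.exists_hasWeight K,
      hd.homotopyEquiv_and_eulerChar_eq hY⟩
    rw [resolutionQuiver_eq_functionDigraph, resolutionQuiver_eq_functionDigraph]
    exact ⟨card_component_eq_of_semiconj hd.semiconj_gustafson hY,
      card_not_onCycle_of_semiconj hd.semiconj_gustafson hY⟩
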